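/- Let $\omega\in C^1([0,1])$, $\Lambda_0>0$, $\lambda>0$, $R\in\mathbb R$, $Q=\mathbb R\times(0,1)$ with coordinates $(q,p)$, and let $h\in C^2(\overline Q)$ be even and $\Lambda_0$-periodic in $q$, with $h_p>0$ on $\overline Q$, and solve the water wave problem $$\Big(\frac{1+\lambda^2h_q^2}{2h_p^2}+\int_0^p\omega(\tau)\,d\tau\Big)_p-\lambda^2\Big(\frac{h_q}{h_p}\Big)_q=0\ \text{ in } Q,\qquad \frac{1+\lambda^2h_q^2}{2h_p^2}+h=R\ \text{ for } p=1,\qquad h=0\ \text{ for } p=0.$$ Put $$Au=\Big(\frac{\lambda^2h_qu_q}{h_p^2}-\frac{(1+\lambda^2h_q^2)u_p}{h_p^3}\Big)_p-\lambda^2\Big(\frac{u_q}{h_p}-\frac{h_qu_p}{h_p^2}\Big)_q,\qquad Nu=\Big(-\frac{\lambda^2h_qu_q}{h_p^2}+\frac{(1+\lambda^2h_q^2)u_p}{h_p^3}\Big)\Big|_{p=1}.$$ Let $\eta(x)=h(x,1)$, $D_\eta=\{(x,y):0<y<\eta(x)\}$, let $\psi$ on $\overline{D_\eta}$ be given by $\psi(x,h(x,p))=p$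 for $p\in[0,1]$, let $\nu=\nabla\psi/|\nabla\psi|$ be the outward unit normal on the surface $y=\eta(x)$, and let $$\rho=\frac{1+\lambda^2\psi_x\psi_{xy}+\psi_y\psi_{yy}}{\psi_y|\nabla\psi|}\Big|_{y=\eta(x)}.$$ Consider, for functions that are even and $\Lambda_0$-periodic in the first variable, the spectral problems 1. $Au=0$ in $Q$, $\;Nu-u=\mu u$ for $p=1$, $\;u=0$ for $p=0$ (eigenvalue $\mu$); 2. $Au=\theta u$ in $Q$, $\;Nu-u=0$ for $p=1$, $\;u=0$ for $p=0$ (eigenvalue $\theta$); 3. $(\lambda^2\partial_x^2+\partial_y^2)\Gamma+\omega'(\psi)\Gamma+\theta\,\Gamma/\psi_y=0$ in $D_\eta$, $\;\lambda^2\nu_x\Gamma_x+\nu_y\Gamma_y-\rho\Gamma=0$ on $y=\eta(x)$, $\;\Gamma=0$ for $y=0$ (eigenvalue $\theta$); 4. $(\lambda^2\partial_x^2+\partial_y^2)\Gamma+\omega'(\psi)\Gamma=0$ in $D_\eta$, $\;\lambda^2\nu_x\Gamma_x+\nu_y\Gamma_y-\rho\Gamma=\mu\beta\Gamma$ on $y=\eta(x)$,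 $\;\Gamma=0$ for $y=0$ (eigenvalue $\mu$), with the weight $\beta=\psi_y/|\nabla\psi|$; 5. the same as 4 with the weight $\beta=1/(\psi_y|\nabla\psi|)$. All problems are understood in the weak sense: one integrates by parts over one period, and eigenfunctions and test functions range over the even $\Lambda_0$-periodic real-valued functions of class $H^1$ that vanish on the bottom. Then each of the five problems has only finitely many negative eigenvalues, each of finite multiplicity, and the number of negative eigenvalues, counted with multiplicity, is the same for all five. -/

import Mathlib

open MeasureTheory Set

namespace StokesSpectral

noncomputable section

/-! ### Periodic strips, partial derivatives up to the boundary -/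

/-- The closed strip `0 ≤ y ≤ η x`, `x ∈ ℝ`. -/
def closedStrip (η : ℝ → ℝ) : Set (ℝ × ℝ) := {z | 0 ≤ z.2 ∧ z.2 ≤ η z.1}

/-- One period of the open strip: `-L/2 < x < L/2`, `0 < y < η x`. -/
def cell (L : ℝ) (η : ℝ → ℝ) : Set (ℝ × ℝ) :=
  {z | z.1 ∈ Ioo (-L / 2) (L / 2) ∧ 0 < z.2 ∧ z.2 < η z.1}

/-- The flat top `p = 1` of the strip `Q = {0 < p < 1}` in the `(q,p)` variables. -/
def flat : ℝ → ℝ := fun _ => 1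

/-- Partial derivative in the first variable on the closed strip under `η`
(one-sided at the boundary). -/
def pd1 (η : ℝ → ℝ) (f : ℝ × ℝ → ℝ) (z : ℝ × ℝ) : ℝ :=
  fderivWithin ℝ f (closedStrip η) z (1, 0)

/-- Partial derivative in the second variable on the closed strip under `η`
(one-sided at the boundary). -/
def pd2 (η : ℝ → ℝ) (f : ℝ × ℝ → ℝ) (z : ℝ × ℝ) : ℝ :=
  fderivWithin ℝ f (closedStrip η) z (0, 1)

/-! ### The Stokes wave -/

/-- `h` solves the water wave problem in the partial hodograph variables `(q,p)`, with vorticity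
function `ω`, period `L`, wave-length parameter `lam` and Bernoulli constant `R`; it is `C²` up to
the boundary, even and periodic in `q`, and has `h_p > 0` up to the boundary (unidirectional flow).
Here `∫ τ in 0..p, ω τ` is the primitive of the vorticity function. -/
structure IsWave (ω : ℝ → ℝ) (L lam R : ℝ) (h : ℝ × ℝ → ℝ) : Prop where
  smooth : ContDiffOn ℝ 2 h (closedStrip flat)
  periodic : ∀ q, ∀ p ∈ Icc (0 : ℝ) 1, h (q + L, p) = h (q, p)
  even : ∀ q, ∀ p ∈ Icc (0 : ℝ) 1, h (-q, p) = h (q, p)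
  deriv_pos : ∀ z ∈ closedStrip flat, 0 < pd2 flat h z
  interior : ∀ q, ∀ p ∈ Ioo (0 : ℝ) 1,
    pd2 flat (fun z => (1 + lam ^ 2 * pd1 flat h z ^ 2) / (2 * pd2 flat h z ^ 2)
        + ∫ τ in (0 : ℝ)..z.2, ω τ) (q, p)
      - lam ^ 2 * pd1 flat (fun z => pd1 flat h z / pd2 flat h z) (q, p) = 0
  bernoulli : ∀ q, (1 + lam ^ 2 * pd1 flat h (q, 1) ^ 2) / (2 * pd2 flat h (q, 1) ^ 2)
      + h (q, 1) = R
  bottom : ∀ q, h (q, 0) = 0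

/-- The surface profile `η(x) = h(x,1)`. -/
def profile (h : ℝ × ℝ → ℝ) (x : ℝ) : ℝ := h (x, 1)

/-- The stream function: for `0 ≤ y ≤ η(x)`, `ψ(x,y)` is the `p ∈ [0,1]` with `h(x,p) = y`
(unique, since `h_p > 0`). -/
def stream (h : ℝ × ℝ → ℝ) (z : ℝ × ℝ) : ℝ :=
  Function.invFunOn (fun p => h (z.1, p)) (Icc 0 1) z.2

/-! ### Sobolev spaces of even periodic functions -/

/-- Quadruples `(u, u_x, u_y, trace of u on y = η(x))` of square integrable functions on one
period; the trace is written as a function of `x`. -/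
abbrev Quad (L : ℝ) (η : ℝ → ℝ) : Type :=
  Lp ℝ 2 ((volume : Measure (ℝ × ℝ)).restrict (cell L η)) ×
  Lp ℝ 2 ((volume : Measure (ℝ × ℝ)).restrict (cell L η)) ×
  Lp ℝ 2 ((volume : Measure (ℝ × ℝ)).restrict (cell L η)) ×
  Lp ℝ 2 ((volume : Measure ℝ).restrict (Ioo (-L / 2) (L / 2)))

section components

variable {L : ℝ} {η : ℝ → ℝ}

/-- The function itself. -/
def fn (U : Quad L η) : ℝ × ℝ → ℝ := U.1

/-- Its weak derivative in the first variable. -/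
def d1 (U : Quad L η) : ℝ × ℝ → ℝ := U.2.1

/-- Its weak derivative in the second variable. -/
def d2 (U : Quad L η) : ℝ × ℝ → ℝ := U.2.2.1

/-- Its trace on the top boundary. -/
def tr (U : Quad L η) : ℝ → ℝ := U.2.2.2

end components

/-- Functions that are `C¹` on the closed strip, even and `L`-periodic in the first variable, and
zero on the bottom. -/
structure IsCore (L : ℝ) (η : ℝ → ℝ) (u : ℝ × ℝ → ℝ) : Prop where
  smooth : ContDiffOn ℝ 1 u (closedStrip η)
  periodic : ∀ z ∈ closedStrip η, u (z.1 + L, z.2) = u z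
  even : ∀ z ∈ closedStrip η, u (-z.1, z.2) = u z
  bottom : ∀ x, u (x, 0) = 0

/-- The Sobolev space `H¹_pe` of even `L`-periodic functions in `H¹` that vanish on the bottom: the
closure, in the `H¹` norm, of the functions that are `C¹` up to the boundary. An element carries
its weak gradient and its trace on the top, both of which the function determines: the graph
closure in `L² × L² × L² × L²` is the `H¹` closure because of the trace inequality. (The functions
`IsCore` already form a linear space, so `span` only bundles them.) -/
def H1pe (L : ℝ) (η : ℝ → ℝ) : Submodule ℝ (Quad L η) :=
  (Submodule.span ℝ {U : Quad L η | ∃ u : ℝ × ℝ → ℝ, IsCore L η u ∧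
    fn U =ᵐ[volume.restrict (cell L η)] u ∧
    d1 U =ᵐ[volume.restrict (cell L η)] pd1 η u ∧
    d2 U =ᵐ[volume.restrict (cell L η)] pd2 η u ∧
    tr U =ᵐ[volume.restrict (Ioo (-L / 2) (L / 2))] fun x => u (x, η x)}).topologicalClosure

/-! ### Weak eigenvalue problems and the number of negative eigenvalues -/

section counting

variable {E : Type*} [AddCommGroup E] [Module ℝ E]

/-- The eigenspace of the problem `a(u,v) = θ b(u,v)` for all `v ∈ H`, with unknown `u ∈ H`.
(For bilinear `a`, `b` the solutions already form a linear space, so `span` only bundles them.) -/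
def eigenspace (H : Submodule ℝ E) (a b : E → E → ℝ) (θ : ℝ) : Submodule ℝ E :=
  Submodule.span ℝ {u | u ∈ H ∧ ∀ v ∈ H, a u v = θ * b u v}

/-- The multiplicity of `θ` (zero if `θ` is not an eigenvalue). -/
def eigMult (H : Submodule ℝ E) (a b : E → E → ℝ) (θ : ℝ) : ℕ∞ :=
  Cardinal.toENat (Module.rank ℝ (eigenspace H a b θ))

/-- The number of negative eigenvalues, each counted with its multiplicity: the sum over all
`θ < 0` of the multiplicities. -/
def negativeCount (H : Submodule ℝ E) (a b : E → E → ℝ) : ℕ∞ :=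
  ⨆ s : Finset (Iio (0 : ℝ)), ∑ θ ∈ s, eigMult H a b θ

end counting

/-! ### The problems in the `(q,p)` variables -/

/-- The form of the operator
`A u = (λ² h_q u_q / h_p² - (1 + λ² h_q²) u_p / h_p³)_p - λ² (u_q / h_p - h_q u_p / h_p²)_q` with
boundary operator `N u - u` at `p = 1`, where
`N u = -λ² h_q u_q / h_p² + (1 + λ² h_q²) u_p / h_p³`: integration by parts gives
`a(u,v) = ∫ (A u) v dq dp + ∫_{p=1} (N u - u) v dq`. -/
def formQ (L lam : ℝ) (h : ℝ × ℝ → ℝ) (U V : Quad L flat) : ℝ :=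
  (∫ z in cell L flat,
    (((1 + lam ^ 2 * pd1 flat h z ^ 2) / pd2 flat h z ^ 3 * d2 U z
        - lam ^ 2 * pd1 flat h z / pd2 flat h z ^ 2 * d1 U z) * d2 V z
      + lam ^ 2 * (d1 U z / pd2 flat h z
        - pd1 flat h z / pd2 flat h z ^ 2 * d2 U z) * d1 V z))
  - ∫ q in Ioo (-L / 2) (L / 2), tr U q * tr V q

/-- `∫ u v dq dp`. -/
def massQ (L : ℝ) (U V : Quad L flat) : ℝ := ∫ z in cell L flat, fn U z * fn V z

/-- `∫_{p=1} u v dq`. -/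
def topQ (L : ℝ) (U V : Quad L flat) : ℝ := ∫ q in Ioo (-L / 2) (L / 2), tr U q * tr V q

/-- Number of negative eigenvalues `θ` of `A u = θ u` in `Q`, `N u - u = 0` at `p = 1`, `u = 0` at
`p = 0`. -/
def countRobinQ (L lam : ℝ) (h : ℝ × ℝ → ℝ) : ℕ∞ :=
  negativeCount (H1pe L flat) (formQ L lam h) (massQ L)

/-- Number of negative eigenvalues `μ` of `A u = 0` in `Q`, `N u - u = μ u` at `p = 1`, `u = 0` at
`p = 0`. -/
def countSteklovQ (L lam : ℝ) (h : ℝ × ℝ → ℝ) : ℕ∞ :=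
  negativeCount (H1pe L flat) (formQ L lam h) (topQ L)

/-! ### The problems in the `(x,y)` variables -/

/-- `ψ_x`. -/
def streamX (h : ℝ × ℝ → ℝ) : ℝ × ℝ → ℝ := pd1 (profile h) (stream h)

/-- `ψ_y`. -/
def streamY (h : ℝ × ℝ → ℝ) : ℝ × ℝ → ℝ := pd2 (profile h) (stream h)

/-- `|∇ψ|` (Euclidean length) at the surface point `(x, η(x))`. -/
def speed (h : ℝ × ℝ → ℝ) (x : ℝ) : ℝ :=
  √(streamX h (x, profile h x) ^ 2 + streamY h (x, profile h x) ^ 2)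

/-- `ρ(x) = (1 + λ² ψ_x ψ_xy + ψ_y ψ_yy) / (ψ_y |∇ψ|)` at the surface point `(x, η(x))`. -/
def rho (lam : ℝ) (h : ℝ × ℝ → ℝ) (x : ℝ) : ℝ :=
  (1 + lam ^ 2 * streamX h (x, profile h x) * pd2 (profile h) (streamX h) (x, profile h x)
      + streamY h (x, profile h x) * pd2 (profile h) (streamY h) (x, profile h x))
    / (streamY h (x, profile h x) * speed h x)

/-- The arc length density `√(1 + η'²)` of the surface. -/
def arc (h : ℝ × ℝ → ℝ) (x : ℝ) : ℝ := √(1 + deriv (profile h) x ^ 2)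

/-- The form of the operator `-(λ² ∂_x² + ∂_y²) - ω'(ψ)` on `D_η` with boundary operator
`λ² ν_x ∂_x + ν_y ∂_y - ρ` on the surface, `ν` being the unit outward normal:
`∫ (λ² Γ_x φ_x + Γ_y φ_y - ω'(ψ) Γ φ) dx dy - ∫ ρ Γ φ ds`. -/
def formD (ω : ℝ → ℝ) (L lam : ℝ) (h : ℝ × ℝ → ℝ) (U V : Quad L (profile h)) : ℝ :=
  (∫ z in cell L (profile h),
    (lam ^ 2 * d1 U z * d1 V z + d2 U z * d2 V z
      - derivWithin ω (Icc 0 1) (stream h z) * fn U z * fn V z))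
  - ∫ x in Ioo (-L / 2) (L / 2), rho lam h x * tr U x * tr V x * arc h x

/-- `∫ Γ φ / ψ_y dx dy`. -/
def massD (L : ℝ) (h : ℝ × ℝ → ℝ) (U V : Quad L (profile h)) : ℝ :=
  ∫ z in cell L (profile h), fn U z * fn V z / streamY h z

/-- `∫ β Γ φ ds` over the surface. -/
def topD (L : ℝ) (h : ℝ × ℝ → ℝ) (β : ℝ → ℝ) (U V : Quad L (profile h)) : ℝ :=
  ∫ x in Ioo (-L / 2) (L / 2), β x * tr U x * tr V x * arc h x

/-- Number of negative eigenvalues `θ` of `(λ² ∂_x² + ∂_y²) Γ + ω'(ψ) Γ + θ Γ / ψ_y = 0` in `D_η`,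
`λ² ν_x Γ_x + ν_y Γ_y - ρ Γ = 0` on the surface, `Γ = 0` at `y = 0`. -/
def countRobinD (ω : ℝ → ℝ) (L lam : ℝ) (h : ℝ × ℝ → ℝ) : ℕ∞ :=
  negativeCount (H1pe L (profile h)) (formD ω L lam h) (massD L h)

/-- Number of negative eigenvalues `μ` of `(λ² ∂_x² + ∂_y²) Γ + ω'(ψ) Γ = 0` in `D_η`,
`λ² ν_x Γ_x + ν_y Γ_y - ρ Γ = μ β Γ` on the surface, `Γ = 0` at `y = 0`. -/
def countSteklovD (ω : ℝ → ℝ) (L lam : ℝ) (h : ℝ × ℝ → ℝ) (β : ℝ → ℝ) : ℕ∞ :=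
  negativeCount (H1pe L (profile h)) (formD ω L lam h) (topD L h β)

end

end StokesSpectral

namespace StokesSpectral
noncomputable section

/-! ### Negative eigenvalues of a pair of forms and the Morse index -/

section abstract

open Filter Topology

variable {V : Type*} [NormedAddCommGroup V] [NormedSpace ℝ V]

/-! The number of negative eigenvalues of a(u,v) = θ b(u,v) depends on the form a alone. Let b be
nonnegative and compact, and let a + C b be coercive for some C. Then the count is the Morse index
of a, the largest dimension of a subspace on which a is negative definite
(`IsSpectralPair.negativeCount_eq`). It is at most that: eigenvectors for different θ < 0 are
orthogonal for both forms, so a finite sum R of eigenspaces is direct and a is negative definite on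
it. It is at least that: if R has smaller dimension than a negative definite subspace W, some
nonzero vector of W is a-orthogonal to R, so a takes negative values on the a-orthogonal complement
of R, and the minimum of a/b there is a further negative eigenvalue (`exists_eigenvector`,
`exists_new_eigenvalue`). The form b may be degenerate, as it is when the spectral parameter sits in
the boundary condition: on the null vectors of b coercivity makes a positive.

In the variables (q,p) the operators A and N - 1 define one form a. It is admissible with each of
three choices of b: the L² product, the surface product with weight 1, and the surface product with
weight h_p⁻² (`isSpectralPair_mass`, `isSpectralPair_top`). Compactness comes from the Poincaré
inequality on a fine grid of boxes together with the trace inequality. All three choices therefore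
give the same finite number.

The problems in D_η are these three problems in the variables x = q, y = h(q,p), with Γ = ψ_y u = u
/ h_p: a perturbation u of h changes ψ by -u / h_p to first order, so the two formulations have
equivalent linearizations. In weak form (`formD_toProfile`), put k = ψ_y and F = ψ_x as functions of
(q,p), and X = k u v. After the change of variables the two integrands differ by λ² times the
Jacobian F_p X_q - F_q X_p and by -(ω X)_p. Both integrate to terms on p = 1 (`integral_jacobian`,
`integral_deriv_mul`), and by the wave equation on p = 1 the coefficient ρ absorbs exactly these
terms and leaves the integral of u v. Under the same map the weight 1/ψ_y becomes the L² product,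
and the surface weights ψ_y/|∇ψ| and 1/(ψ_y|∇ψ|) become h_p⁻² and 1. -/

/-- A symmetric nonnegative form satisfies: a null vector is in the kernel. -/
lemma form_eq_zero_of_null (a : V →L[ℝ] V →L[ℝ] ℝ) (ha : ∀ u v, a u v = a v u)
    (h0 : ∀ u, 0 ≤ a u u) {u : V} (hu : a u u = 0) (v : V) : a u v = 0 := by
  by_contra hne
  have key : ∀ t : ℝ, 0 ≤ 2 * t * a u v + t ^ 2 * a v v := by
    intro t
    have := h0 (u + t • v)
    simp only [map_add, map_smul, _root_.add_apply, _root_.smul_apply,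
      smul_eq_mul, hu, ha v u] at this
    linarith
  have hv := h0 v
  -- A near-minimiser of the quadratic polynomial in t; the + 1 keeps the denominator positive when
  -- a v v = 0.
  have h1 := key (-(a u v) / (a v v + 1))
  have hpos : 0 < a v v + 1 := by linarith
  have h2 : 2 * (-(a u v) / (a v v + 1)) * a u v + (-(a u v) / (a v v + 1)) ^ 2 * a v v
      = - (a u v) ^ 2 * (a v v + 2) / (a v v + 1) ^ 2 := by
    field_simp
    ring
  rw [h2] at h1
  have : 0 < (a u v) ^ 2 * (a v v + 2) / (a v v + 1) ^ 2 := by positivity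
  have h3 : - (a u v) ^ 2 * (a v v + 2) / (a v v + 1) ^ 2
    = -((a u v) ^ 2 * (a v v + 2) / (a v v + 1) ^ 2) := by ring
  linarith

/-- `b` is compact with respect to the norm: up to an arbitrarily small multiple of the norm it is
controlled by finitely many continuous functionals. -/
def IsCompactForm (b : V →L[ℝ] V →L[ℝ] ℝ) : Prop :=
  ∀ ε > 0, ∃ (m : ℕ) (l : Fin m → V →L[ℝ] ℝ), ∀ u, b u u ≤ ε * ‖u‖ ^ 2 + ∑ i, l i u ^ 2

/-- The hypotheses on the pair of forms in the eigenvalue problem `a(u,v) = θ b(u,v)`. -/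
structure IsSpectralPair (a b : V →L[ℝ] V →L[ℝ] ℝ) : Prop where
  symm_left : ∀ u v, a u v = a v u
  symm_right : ∀ u v, b u v = b v u
  nonneg : ∀ u, 0 ≤ b u u
  coercive : ∃ c > 0, ∃ C, ∀ u, c * ‖u‖ ^ 2 ≤ a u u + C * b u u
  compact : IsCompactForm b

namespace IsSpectralPair

variable {a b : V →L[ℝ] V →L[ℝ] ℝ}

/-- Needed for the a-orthogonal complement of the eigenspaces already found. -/
lemma restrict (hab : IsSpectralPair a b) (K : Submodule ℝ V) :
    IsSpectralPair ((a.bilinearComp K.subtypeL K.subtypeL)) (b.bilinearComp K.subtypeL K.subtypeL) where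
  symm_left u v := hab.symm_left u v
  symm_right u v := hab.symm_right u v
  nonneg u := hab.nonneg u
  coercive := by
    obtain ⟨c, hc, C, h⟩ := hab.coercive
    exact ⟨c, hc, C, fun u => h u⟩
  compact ε hε := by
    obtain ⟨m, l, h⟩ := hab.compact ε hε
    exact ⟨m, fun i => (l i).comp K.subtypeL, fun u => h u⟩

/-- On null vectors of b coercivity reduces to c‖u‖² ≤ a u u. This is what allows b to be
degenerate: a negative value of a forces b u u > 0. -/
lemma eq_zero_of_null (hab : IsSpectralPair a b) {u : V} (hb : b u u = 0) (ha : a u u ≤ 0) :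
    u = 0 := by
  obtain ⟨c, hc, C, h⟩ := hab.coercive
  have h1 := h u
  rw [hb, mul_zero, add_zero] at h1
  have h2 : ‖u‖ ^ 2 ≤ 0 := by
    by_contra hcon
    push Not at hcon
    have := mul_pos hc hcon
    linarith
  have h3 : ‖u‖ = 0 := by
    have := sq_nonneg ‖u‖
    exact pow_eq_zero_iff (two_ne_zero) |>.1 (le_antisymm h2 this)
  exact norm_eq_zero.1 h3

/-- If `a` takes a negative value then there is a negative eigenvalue (the minimum of the Rayleigh
quotient). -/
lemma exists_eigenvector [CompleteSpace V] (hab : IsSpectralPair a b) {w : V} (hw : a w w < 0) :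
    ∃ θ < 0, ∃ u ≠ 0, ∀ v, a u v = θ * b u v := by
  obtain ⟨c, hc, C, hcoer⟩ := hab.coercive
  have hbpos : ∀ u, a u u < 0 → 0 < b u u := by
    intro u hu
    refine lt_of_le_of_ne (hab.nonneg u) fun h0 => ?_
    rw [hab.eq_zero_of_null h0.symm hu.le] at hu
    simp at hu
  -- The Rayleigh quotients, as values of a on the b-unit sphere; coercivity bounds them below by
  -- -C.
  set A : Set ℝ := {t | ∃ u, b u u = 1 ∧ a u u = t} with hA
  have hscale : ∀ u, 0 < b u u → a u u / b u u ∈ A := by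
    intro u hu
    refine ⟨(√(b u u))⁻¹ • u, ?_, ?_⟩ <;>
    · simp only [map_smul, _root_.smul_apply, smul_eq_mul, ← mul_assoc]
      rw [← mul_inv, Real.mul_self_sqrt hu.le]
      field_simp
  have hbdd : BddBelow A := by
    refine ⟨-C, ?_⟩
    rintro t ⟨u, hu, rfl⟩
    have := hcoer u
    rw [hu] at this
    have h2 : 0 ≤ c * ‖u‖ ^ 2 := by positivity
    linarith
  have hwA := hscale w (hbpos w hw)
  set m := sInf A with hm
  have hmneg : m < 0 := lt_of_le_of_lt (csInf_le hbdd hwA) (div_neg_of_neg_of_pos hw (hbpos w hw))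
  have hlow : ∀ u, m * b u u ≤ a u u := by
    intro u
    rcases (hab.nonneg u).lt_or_eq with h | h
    · have := csInf_le hbdd (hscale u h)
      rwa [← hm, le_div_iff₀ h] at this
    · rw [← h, mul_zero]
      by_contra hcon
      push Not at hcon
      exact absurd (hbpos u hcon) (by rw [← h]; exact lt_irrefl _)
  obtain ⟨t, -, ht, htA⟩ := exists_seq_tendsto_sInf ⟨_, hwA⟩ hbdd
  choose x hx1 hx2 using htA
  -- Along an ultrafilter every bounded real sequence converges, so the functionals given by
  -- compactness converge for every ε at once, with no choice of subsequences.
  let 𝒰 : Ultrafilter ℕ := Filter.hyperfilter ℕ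
  have h𝒰 : (𝒰 : Filter ℕ) ≤ atTop := by
    rw [← Nat.cofinite_eq_atTop]; exact Filter.hyperfilter_le_cofinite
  have ht' : Tendsto t 𝒰 (𝓝 m) := ht.mono_left h𝒰
  obtain ⟨T, hT⟩ : ∃ T, ∀ n, t n ≤ T := by
    obtain ⟨T, hT⟩ := ht.bddAbove_range
    exact ⟨T, fun n => hT ⟨n, rfl⟩⟩
  have hbound : ∀ n, ‖x n‖ ^ 2 ≤ (T + C) / c := by
    intro n
    rw [le_div_iff₀ hc]
    have := hcoer (x n)
    rw [hx1, hx2] at this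
    linarith [hT n]
  -- the sequence is Cauchy along the ultrafilter
  have hcauchy : Cauchy (Filter.map x 𝒰) := by
    rw [Metric.cauchy_iff]
    refine ⟨inferInstance, fun ε hε => ?_⟩
    set M := (T + C) / c with hM
    have hM0 : 0 ≤ M := le_trans (sq_nonneg _) (hbound 0)
    -- D dominates |C|. The numbers δ and ζ are chosen so that D times b of a difference x p - x q
    -- stays below c ε² / 2: δ handles the norm term, where ‖x p - x q‖² ≤ 4M, and ζ handles the k
    -- functionals.
    set D := |C| + |m| + 1 with hD
    have hDpos : 0 < D := by positivity
    set δ := c * ε ^ 2 / (4 * D * (4 * M + 1)) with hδ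
    have hδpos : 0 < δ := by positivity
    obtain ⟨k, l, hl⟩ := hab.compact δ hδpos
    have hconv : ∀ i, ∃ y, Tendsto (fun n => l i (x n)) 𝒰 (𝓝 y) := by
      intro i
      have hmem : ∀ n, l i (x n) ∈ Metric.closedBall (0 : ℝ) (‖l i‖ * √M) := by
        intro n
        rw [mem_closedBall_zero_iff]
        refine ((l i).le_opNorm _).trans ?_
        gcongr
        exact Real.le_sqrt_of_sq_le (hbound n)
      obtain ⟨y, -, hy⟩ := (isCompact_closedBall (0 : ℝ) (‖l i‖ * √M)).ultrafilter_le_nhds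
        (𝒰.map fun n => l i (x n)) (by
          rw [le_principal_iff]
          exact Filter.mem_map.2 (Filter.univ_mem' hmem))
      exact ⟨y, hy⟩
    choose y hy using hconv
    set ζ := √(c * ε ^ 2 / (16 * D * (k + 1))) with hζ
    have hζpos : 0 < ζ := by positivity
    have hev : ∀ᶠ n in (𝒰 : Filter ℕ), (∀ i, |l i (x n) - y i| < ζ)
        ∧ t n < m + c * ε ^ 2 / 16 := by
      refine Filter.Eventually.and ?_ ?_
      · rw [Filter.eventually_all]
        intro i
        have := (Metric.tendsto_nhds.1 (hy i)) ζ hζpos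
        simpa [Real.dist_eq] using this
      · exact ht'.eventually (gt_mem_nhds (by have : 0 < c * ε ^ 2 / 16 := by positivity
                                              linarith))
    refine ⟨x '' {n | (∀ i, |l i (x n) - y i| < ζ) ∧ t n < m + c * ε ^ 2 / 16},
      Filter.image_mem_map hev, ?_⟩
    rintro _ ⟨p, ⟨hp1, hp2⟩, rfl⟩ _ ⟨q, ⟨hq1, hq2⟩, rfl⟩
    have hbd : b (x p - x q) (x p - x q) ≤ δ * (4 * M) + k * (2 * ζ) ^ 2 := by
      refine (hl _).trans (add_le_add ?_ ?_)
      · gcongr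
        have h1 := norm_sub_le (x p) (x q)
        have h2 := hbound p
        have h3 := hbound q
        nlinarith [norm_nonneg (x p - x q), sq_nonneg (‖x p‖ - ‖x q‖), norm_nonneg (x p),
          norm_nonneg (x q)]
      · have : ∀ i ∈ Finset.univ, (l i (x p - x q)) ^ 2 ≤ (2 * ζ) ^ 2 := by
          intro i _
          rw [map_sub]
          apply sq_le_sq'
          · have := abs_lt.1 (hp1 i); have := abs_lt.1 (hq1 i); linarith
          · have := abs_lt.1 (hp1 i); have := abs_lt.1 (hq1 i); linarith
        refine (Finset.sum_le_card_nsmul _ _ _ this).trans ?_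
        simp
    have hbd2 : D * b (x p - x q) (x p - x q) < c * ε ^ 2 / 2 := by
      have e1 : D * (δ * (4 * M)) ≤ c * ε ^ 2 / 4 := by
        have : D * (δ * (4 * M)) = c * ε ^ 2 / 4 * ((4 * M) / (4 * M + 1)) := by
          rw [hδ]; field_simp
        rw [this]
        refine mul_le_of_le_one_right (by positivity) ?_
        rw [div_le_one (by positivity)]; linarith
      have e2 : D * (k * (2 * ζ) ^ 2) < c * ε ^ 2 / 4 := by
        have : D * (k * (2 * ζ) ^ 2) = c * ε ^ 2 / 4 * ((k : ℝ) / (k + 1)) := by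
          rw [mul_pow, hζ, Real.sq_sqrt (by positivity)]; field_simp; ring
        rw [this]
        refine mul_lt_of_lt_one_right (by positivity) ?_
        rw [div_lt_one (by positivity)]; linarith
      have := mul_le_mul_of_nonneg_left hbd hDpos.le
      rw [mul_add] at this
      linarith
    have hb0 := hab.nonneg (x p - x q)
    -- Parallelogram identity: x p and x q are almost minimal, so the lower bound `hlow` at their
    -- sum becomes an upper bound for a at their difference. The remaining term m b has the
    -- favourable sign because m < 0.
    have hpar : a (x p - x q) (x p - x q) ≤ c * ε ^ 2 / 4 := by
      have h1 := hlow (x p + x q)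
      have e1 : a (x p + x q) (x p + x q) = 2 * a (x p) (x p) + 2 * a (x q) (x q)
          - a (x p - x q) (x p - x q) := by
        simp only [map_add, map_sub, _root_.add_apply, _root_.sub_apply]
        ring
      have e2 : b (x p + x q) (x p + x q) = 2 * b (x p) (x p) + 2 * b (x q) (x q)
          - b (x p - x q) (x p - x q) := by
        simp only [map_add, map_sub, _root_.add_apply, _root_.sub_apply]
        ring
      rw [e1, e2, hx1, hx1, hx2, hx2] at h1
      linarith [mul_nonneg (neg_nonneg.2 hmneg.le) hb0]
    have hfin := hcoer (x p - x q)
    have hmb : 0 ≤ |m| * b (x p - x q) (x p - x q) := by positivity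
    have hC : C * b (x p - x q) (x p - x q) ≤ |C| * b (x p - x q) (x p - x q) :=
      mul_le_mul_of_nonneg_right (le_abs_self C) hb0
    rw [hD, add_mul, add_mul, one_mul] at hbd2
    rw [dist_eq_norm]
    have hsq : ‖x p - x q‖ ^ 2 < ε ^ 2 := by
      have : c * ‖x p - x q‖ ^ 2 < c * ε ^ 2 := by
        have : 0 < c * ε ^ 2 := by positivity
        linarith
      exact lt_of_mul_lt_mul_left this hc.le
    exact lt_of_pow_lt_pow_left₀ 2 hε.le hsq
  obtain ⟨u, hu⟩ := CompleteSpace.complete hcauchy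
  have hu' : Tendsto x 𝒰 (𝓝 u) := hu
  have hcb : Tendsto (fun n => b (x n) (x n)) 𝒰 (𝓝 (b u u)) :=
    ((b.continuous.clm_apply continuous_id).tendsto u).comp hu'
  have hca : Tendsto (fun n => a (x n) (x n)) 𝒰 (𝓝 (a u u)) :=
    ((a.continuous.clm_apply continuous_id).tendsto u).comp hu'
  have hbu : b u u = 1 := tendsto_nhds_unique hcb (by simp [hx1])
  have hau : a u u = m := tendsto_nhds_unique hca (by simpa only [hx2] using ht')
  refine ⟨m, hmneg, u, ?_, ?_⟩
  · rintro rfl; simp at hbu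
  · intro v
    -- The form a - m b is nonnegative by minimality and vanishes at u, so u lies in its kernel;
    -- this is the weak eigenvalue equation.
    have := form_eq_zero_of_null (a - m • b) (fun u v => by
        simp [hab.symm_left u v, hab.symm_right u v]) (fun u => by
        simpa using hlow u) (u := u) (by simp [hau, hbu]) v
    simpa [sub_eq_zero] using this

end IsSpectralPair

end abstract
-- The Morse index and the count of negative eigenvalues
section abstract

variable {V : Type*} [NormedAddCommGroup V] [NormedSpace ℝ V]

/-- `a` is negative definite on `W`. -/
def NegDefOn (a : V →L[ℝ] V →L[ℝ] ℝ) (W : Submodule ℝ V) : Prop := ∀ w ∈ W, w ≠ 0 → a w w < 0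

/-- `n` is the largest dimension of a subspace on which `a` is negative definite. -/
def IsMorseIndex (a : V →L[ℝ] V →L[ℝ] ℝ) (n : ℕ) : Prop :=
  (∃ W : Submodule ℝ V, NegDefOn a W ∧ Module.finrank ℝ W = n) ∧
    ∀ W : Submodule ℝ V, NegDefOn a W → Module.finrank ℝ W ≤ n

/-- The solutions form the kernel of a - θ b, which is already a subspace, so the `span` in
`eigenspace` adds nothing. -/
lemma mem_eigenspace_top {a b : V →L[ℝ] V →L[ℝ] ℝ} {θ : ℝ} {u : V} :
    u ∈ eigenspace (⊤ : Submodule ℝ V) (fun u v => a u v) (fun u v => b u v) θ ↔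
      ∀ v, a u v = θ * b u v := by
  have : ({u | u ∈ (⊤ : Submodule ℝ V) ∧ ∀ v ∈ (⊤ : Submodule ℝ V), a u v = θ * b u v} : Set V)
      = LinearMap.ker ((a - θ • b).toLinearMap) := by
    ext u
    simp [ContinuousLinearMap.ext_iff, sub_eq_zero]
  rw [eigenspace, this, Submodule.span_eq]
  simp [ContinuousLinearMap.ext_iff, sub_eq_zero]

namespace IsSpectralPair

variable {a b : V →L[ℝ] V →L[ℝ] ℝ}

/-- Compactness with ε = c / (|C| + 1) gives m functionals on whose common kernel |C| b ≤ c‖·‖², so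
that a is nonnegative there. They are therefore jointly injective on a negative definite subspace,
which embeds in ℝ^m. -/
lemma exists_finrank_bound (hab : IsSpectralPair a b) :
    ∃ m : ℕ, ∀ W : Submodule ℝ V, NegDefOn a W →
      Module.Finite ℝ W ∧ Module.finrank ℝ W ≤ m := by
  obtain ⟨c, hc, C, hcoer⟩ := hab.coercive
  have hpos : 0 < c / (|C| + 1) := by positivity
  obtain ⟨m, l, hl⟩ := hab.compact _ hpos
  refine ⟨m, fun W hW => ?_⟩
  let f : W →ₗ[ℝ] (Fin m → ℝ) := LinearMap.pi fun i => (l i).toLinearMap ∘ₗ W.subtype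
  have hf : Function.Injective f := by
    rw [← LinearMap.ker_eq_bot, LinearMap.ker_eq_bot']
    rintro ⟨w, hw⟩ h0
    have hlw : ∀ i, l i w = 0 := fun i => congrFun h0 i
    by_contra hne
    have hne' : w ≠ 0 := fun h => hne (by simpa using h)
    have h1 := hW w hw hne'
    have h2 := hcoer w
    have h3 := hl w
    simp only [hlw, ne_eq, OfNat.ofNat_ne_zero, not_false_eq_true, zero_pow,
      Finset.sum_const_zero, add_zero] at h3
    have h4 : C * b w w ≤ |C| * b w w := mul_le_mul_of_nonneg_right (le_abs_self C) (hab.nonneg w)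
    have h5 : |C| * b w w ≤ c * ‖w‖ ^ 2 := by
      calc |C| * b w w ≤ |C| * (c / (|C| + 1) * ‖w‖ ^ 2) := by gcongr
        _ = (c * ‖w‖ ^ 2) * (|C| / (|C| + 1)) := by ring
        _ ≤ c * ‖w‖ ^ 2 := by
          refine mul_le_of_le_one_right (by positivity) ?_
          rw [div_le_one (by positivity)]; linarith
    linarith
  refine ⟨Module.Finite.of_injective f hf, ?_⟩
  simpa using LinearMap.finrank_le_finrank_of_injective hf

lemma exists_morseIndex (hab : IsSpectralPair a b) : ∃ n, IsMorseIndex a n := by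
  obtain ⟨m, hm⟩ := hab.exists_finrank_bound
  set A : Set ℕ := {n | ∃ W : Submodule ℝ V, NegDefOn a W ∧ Module.finrank ℝ W = n}
  have hbdd : BddAbove A := ⟨m, by rintro _ ⟨W, hW, rfl⟩; exact (hm W hW).2⟩
  have hne : A.Nonempty := ⟨0, ⊥, fun w hw h => absurd (by simpa using hw) h, by simp⟩
  exact ⟨sSup A, Nat.sSup_mem hne hbdd, fun W hW => le_csSup hbdd ⟨W, hW, rfl⟩⟩

/-- The eigenspace as a subspace of `V`. -/
abbrev eig (a b : V →L[ℝ] V →L[ℝ] ℝ) (θ : ℝ) : Submodule ℝ V :=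
  eigenspace (⊤ : Submodule ℝ V) (fun u v => a u v) (fun u v => b u v) θ

/-- The sum map from a finite product of eigenspaces. -/
def sumMap (a b : V →L[ℝ] V →L[ℝ] ℝ) (s : Finset (Iio (0 : ℝ))) :
    (Π θ : s, eig a b (θ : Iio (0 : ℝ))) →ₗ[ℝ] V :=
  ∑ θ : s, (eig a b (θ : Iio (0 : ℝ))).subtype ∘ₗ LinearMap.proj θ

lemma sumMap_apply (s : Finset (Iio (0 : ℝ))) (x : Π θ : s, eig a b (θ : Iio (0 : ℝ))) :
    sumMap a b s x = ∑ θ : s, (x θ : V) := by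
  simp [sumMap]

/-- By symmetry θ_i b = θ_j b on a pair of eigenvectors, so for distinct eigenvalues b, and with it
a, vanishes on the pair and only diagonal terms survive. -/
lemma form_sumMap (hab : IsSpectralPair a b) (s : Finset (Iio (0 : ℝ)))
    (x : Π θ : s, eig a b (θ : Iio (0 : ℝ))) :
    a (sumMap a b s x) (sumMap a b s x) = ∑ θ : s, a (x θ : V) (x θ : V) := by
  rw [sumMap_apply, map_sum]
  refine Finset.sum_congr rfl fun i _ => ?_
  rw [map_sum, _root_.sum_apply]
  refine Finset.sum_eq_single i (fun j _ hij => ?_) (by simp)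
  have h1 := mem_eigenspace_top.1 (x i).2 (x j : V)
  have h2 := mem_eigenspace_top.1 (x j).2 (x i : V)
  rw [hab.symm_left, hab.symm_right, h1] at h2
  have hne : ((i : Iio (0 : ℝ)) : ℝ) ≠ ((j : Iio (0 : ℝ)) : ℝ) := fun h =>
    hij (Subtype.ext (Subtype.ext h.symm))
  have : (((i : Iio (0 : ℝ)) : ℝ) - ((j : Iio (0 : ℝ)) : ℝ)) * b (x i : V) (x j : V) = 0 := by
    linarith
  rw [hab.symm_left, h1, (mul_eq_zero.1 this).resolve_left (sub_ne_zero.2 hne), mul_zero]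

/-- Here a w w = θ b w w ≤ 0, and equality forces b w w = 0, hence w = 0 by coercivity. -/
lemma negDefOn_eig (hab : IsSpectralPair a b) {θ : ℝ} (hθ : θ < 0) : NegDefOn a (eig a b θ) := by
  intro w hw hne
  have h := mem_eigenspace_top.1 hw w
  by_contra hcon
  push Not at hcon
  have h0 := hab.nonneg w
  have hb : b w w = 0 := by nlinarith
  exact hne (hab.eq_zero_of_null hb (by rw [h, hb, mul_zero]))

lemma sumMap_aux (hab : IsSpectralPair a b) (s : Finset (Iio (0 : ℝ)))
    {x : Π θ : s, eig a b (θ : Iio (0 : ℝ))} (hx : x ≠ 0) :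
    a (sumMap a b s x) (sumMap a b s x) < 0 := by
  rw [hab.form_sumMap]
  obtain ⟨i, hi⟩ := Function.ne_iff.1 hx
  have hle : ∀ j, a (x j : V) (x j : V) ≤ 0 := by
    intro j
    by_cases hj : (x j : V) = 0
    · simp [hj]
    · exact (hab.negDefOn_eig (mem_Iio.1 (j : Iio (0 : ℝ)).2) _ (x j).2 hj).le
  refine Finset.sum_neg' (fun j _ => hle j) ⟨i, Finset.mem_univ _, ?_⟩
  exact hab.negDefOn_eig (mem_Iio.1 (i : Iio (0 : ℝ)).2) _ (x i).2 fun h => hi (Subtype.ext h)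

lemma sumMap_injective (hab : IsSpectralPair a b) (s : Finset (Iio (0 : ℝ))) :
    Function.Injective (sumMap a b s) := by
  rw [← LinearMap.ker_eq_bot, LinearMap.ker_eq_bot']
  intro x h0
  by_contra hne
  have := hab.sumMap_aux s hne
  rw [h0] at this
  simp at this

lemma negDefOn_range (hab : IsSpectralPair a b) (s : Finset (Iio (0 : ℝ))) :
    NegDefOn a (LinearMap.range (sumMap a b s)) := by
  rintro _ ⟨x, rfl⟩ hne
  exact hab.sumMap_aux s fun h => hne (by rw [h, map_zero])

/-- Negative definiteness makes the eigenspace finite-dimensional, so the extended multiplicity is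
an ordinary dimension. -/
lemma eigMult_eq (hab : IsSpectralPair a b) {θ : ℝ} (hθ : θ < 0) :
    eigMult (⊤ : Submodule ℝ V) (fun u v => a u v) (fun u v => b u v) θ
      = (Module.finrank ℝ (eig a b θ) : ℕ) := by
  obtain ⟨m, hm⟩ := hab.exists_finrank_bound
  have := (hm _ (hab.negDefOn_eig hθ)).1
  rw [eigMult, ← Module.finrank_eq_rank]
  simp

lemma finrank_range (hab : IsSpectralPair a b) (s : Finset (Iio (0 : ℝ))) :
    Module.finrank ℝ (LinearMap.range (sumMap a b s))
      = ∑ θ ∈ s, Module.finrank ℝ (eig a b (θ : Iio (0 : ℝ))) := by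
  obtain ⟨m, hm⟩ := hab.exists_finrank_bound
  have : ∀ θ : s, Module.Finite ℝ (eig a b (θ : Iio (0 : ℝ))) := fun θ =>
    (hm _ (hab.negDefOn_eig (mem_Iio.1 (θ : Iio (0 : ℝ)).2))).1
  rw [LinearMap.finrank_range_of_inj (hab.sumMap_injective s), Module.finrank_pi_fintype]
  exact Finset.sum_coe_sort s fun θ => Module.finrank ℝ (eig a b (θ : ℝ))

/-- If the total multiplicity over `s` is below the Morse index, there is one more negative
eigenvalue. -/
lemma exists_new_eigenvalue [CompleteSpace V] (hab : IsSpectralPair a b)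
    (s : Finset (Iio (0 : ℝ))) {W : Submodule ℝ V} (hW : NegDefOn a W)
    (hlt : Module.finrank ℝ (LinearMap.range (sumMap a b s)) < Module.finrank ℝ W) :
    ∃ θ : Iio (0 : ℝ), θ ∉ s ∧ 0 < Module.finrank ℝ (eig a b θ) := by
  obtain ⟨m, hm⟩ := hab.exists_finrank_bound
  set R := LinearMap.range (sumMap a b s) with hR
  have hRf : Module.Finite ℝ R := (hm _ (hab.negDefOn_range s)).1
  have hWf : Module.Finite ℝ W := (hm _ hW).1
  -- the `a`-orthogonal complement of `R`
  let g : V →ₗ[ℝ] Module.Dual ℝ R :=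
    { toFun := fun v => (a v).toLinearMap ∘ₗ R.subtype
      map_add' := fun u v => by ext; simp
      map_smul' := fun c v => by ext; simp }
  have hg : ∀ v (r : R), g v r = a v r := fun v r => rfl
  have hdual : Module.finrank ℝ (Module.Dual ℝ R) = Module.finrank ℝ R :=
    Subspace.dual_finrank_eq
  obtain ⟨w, hw, hw0⟩ : ∃ w : W, g w = 0 ∧ w ≠ 0 := by
    have hker : LinearMap.ker (g ∘ₗ W.subtype) ≠ ⊥ := by
      apply LinearMap.ker_ne_bot_of_finrank_lt
      rw [hdual]; exact hlt
    obtain ⟨w, hw, hne⟩ := Submodule.exists_mem_ne_zero_of_ne_bot hker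
    exact ⟨w, hw, hne⟩
  let K : Submodule ℝ V := LinearMap.ker g
  have hKmem : ∀ v, v ∈ K ↔ ∀ r ∈ R, a v r = 0 := by
    intro v
    rw [LinearMap.mem_ker]
    exact ⟨fun h r hr => by rw [← hg v ⟨r, hr⟩, h]; rfl, fun h => by ext r; exact h r r.2⟩
  have hKclosed : IsClosed (K : Set V) := by
    have : (K : Set V) = ⋂ r ∈ R, {v | a v r = 0} := by
      ext v; simp only [mem_iInter, mem_ofPred_eq]; exact hKmem v
    rw [this]
    refine isClosed_biInter fun r _ => ?_
    exact isClosed_eq (by fun_prop) continuous_const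
  have : CompleteSpace K := hKclosed.completeSpace_coe
  have hwneg : a (w : V) (w : V) < 0 := hW w w.2 fun h => hw0 (Subtype.ext h)
  obtain ⟨θ, hθ, u, hu0, hu⟩ := (hab.restrict K).exists_eigenvector (w := ⟨w, hw⟩) hwneg
  have hu' : ∀ v ∈ K, a (u : V) v = θ * b (u : V) v := fun v hv => hu ⟨v, hv⟩
  have hu0' : (u : V) ≠ 0 := fun h => hu0 (Subtype.ext h)
  have huR : ∀ r ∈ R, a (u : V) r = 0 := (hKmem u).1 u.2
  -- The eigenvalues in s are nonzero, so a-orthogonality to their eigenvectors implies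
  -- b-orthogonality.
  have hubR : ∀ r ∈ R, b (u : V) r = 0 := by
    rintro _ ⟨x, rfl⟩
    rw [sumMap_apply, map_sum]
    refine Finset.sum_eq_zero fun i _ => ?_
    have hxi : ((x i : V)) ∈ R := by
      refine ⟨Pi.single i (x i), ?_⟩
      rw [sumMap_apply, Finset.sum_eq_single i] <;> simp +contextual
    have h1 := mem_eigenspace_top.1 (x i).2 (u : V)
    rw [hab.symm_left, huR _ hxi, hab.symm_right] at h1
    exact (mul_eq_zero.1 h1.symm).resolve_left (ne_of_lt (mem_Iio.1 (i : Iio (0 : ℝ)).2))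
  -- The form a is nondegenerate on R, hence V = R + K. An eigenvector of the problem on K is
  -- orthogonal to R for both forms, so it solves the problem on all of V.
  have hdec : ∀ v, ∃ r ∈ R, v - r ∈ K := by
    have hinj : Function.Injective (g ∘ₗ R.subtype) := by
      rw [← LinearMap.ker_eq_bot, LinearMap.ker_eq_bot']
      intro r hr
      by_contra hne
      have h1 : a (r : V) (r : V) = 0 := by
        have := LinearMap.congr_fun hr r
        exact this
      exact absurd (hab.negDefOn_range s r r.2 fun h => hne (Subtype.ext h)) (by rw [h1]; exact lt_irrefl _)
    have hsurj := (LinearMap.injective_iff_surjective_of_finrank_eq_finrank hdual.symm).1 hinj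
    intro v
    obtain ⟨r, hr⟩ := hsurj (g v)
    refine ⟨r, r.2, ?_⟩
    rw [LinearMap.mem_ker, map_sub, ← hr]
    simp
  have hueig : (u : V) ∈ eig a b θ := by
    rw [mem_eigenspace_top]
    intro v
    obtain ⟨r, hr, hvr⟩ := hdec v
    have h1 := hu' _ hvr
    rw [map_sub, map_sub, huR r hr, hubR r hr, sub_zero, sub_zero] at h1
    exact h1
  refine ⟨⟨θ, hθ⟩, fun hmem => ?_, ?_⟩
  -- If θ belonged to s, then u would lie in R and be a-orthogonal to R, against negative
  -- definiteness on R.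
  · have huR' : (u : V) ∈ R := by
      refine ⟨Pi.single ⟨⟨θ, hθ⟩, hmem⟩ ⟨u, hueig⟩, ?_⟩
      rw [sumMap_apply, Finset.sum_eq_single ⟨⟨θ, hθ⟩, hmem⟩]
      · simp
      · intro j _ hj
        simp [hj]
      · simp
    exact absurd (hab.negDefOn_range s _ huR' hu0') (by rw [huR _ huR']; exact lt_irrefl _)
  · have := (hm _ (hab.negDefOn_eig hθ)).1
    rw [Module.finrank_pos_iff_exists_ne_zero]
    exact ⟨⟨u, hueig⟩, fun h => hu0' (congrArg Subtype.val h)⟩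

/-- The number of negative eigenvalues is the Morse index of `a`. -/
theorem negativeCount_eq [CompleteSpace V] (hab : IsSpectralPair a b) {n : ℕ}
    (hn : IsMorseIndex a n) :
    negativeCount (⊤ : Submodule ℝ V) (fun u v => a u v) (fun u v => b u v) = n := by
  have hsum : ∀ s : Finset (Iio (0 : ℝ)),
      (∑ θ ∈ s, eigMult (⊤ : Submodule ℝ V) (fun u v => a u v) (fun u v => b u v) θ)
        = ((∑ θ ∈ s, Module.finrank ℝ (eig a b (θ : Iio (0 : ℝ))) : ℕ) : ℕ∞) := by
    intro s
    rw [Nat.cast_sum]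
    exact Finset.sum_congr rfl fun θ _ => hab.eigMult_eq (mem_Iio.1 θ.2)
  have hle : ∀ s : Finset (Iio (0 : ℝ)),
      ∑ θ ∈ s, Module.finrank ℝ (eig a b (θ : Iio (0 : ℝ))) ≤ n := by
    intro s
    rw [← hab.finrank_range]
    exact hn.2 _ (hab.negDefOn_range s)
  apply le_antisymm
  · refine iSup_le fun s => ?_
    rw [hsum s]
    exact_mod_cast hle s
  · obtain ⟨W, hW, hWn⟩ := hn.1
    set A : Set ℕ := Set.range fun s : Finset (Iio (0 : ℝ)) =>
      ∑ θ ∈ s, Module.finrank ℝ (eig a b (θ : Iio (0 : ℝ)))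
    have hbdd : BddAbove A := ⟨n, by rintro _ ⟨s, rfl⟩; exact hle s⟩
    -- A finite set of largest total multiplicity; it exists because n bounds the sums, and a new
    -- eigenvalue would enlarge it.
    obtain ⟨s, hs⟩ := Nat.sSup_mem (s := A) ⟨_, ∅, rfl⟩ hbdd
    have hs' : n ≤ ∑ θ ∈ s, Module.finrank ℝ (eig a b (θ : Iio (0 : ℝ))) := by
      by_contra hcon
      push Not at hcon
      rw [← hab.finrank_range, ← hWn] at hcon
      obtain ⟨θ, hθs, hθ⟩ := hab.exists_new_eigenvalue s hW hcon
      have h1 : _ ≤ sSup A := le_csSup hbdd ⟨insert θ s, rfl⟩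
      have h2 : (∑ θ ∈ s, Module.finrank ℝ (eig a b (θ : Iio (0 : ℝ)))) = sSup A := hs
      rw [← h2] at h1
      simp only [Finset.sum_insert hθs] at h1
      omega
    refine le_iSup_of_le s ?_
    rw [hsum s]
    exact_mod_cast hs'

end IsSpectralPair

/-- A linear bijection that matches the forms preserves the number of negative eigenvalues. -/
lemma negativeCount_congr {E₁ E₂ : Type*} [AddCommGroup E₁] [Module ℝ E₁] [AddCommGroup E₂]
    [Module ℝ E₂] {H₁ : Submodule ℝ E₁} {H₂ : Submodule ℝ E₂} (Φ : E₁ ≃ₗ[ℝ] E₂)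
    (hΦ : H₁.map Φ.toLinearMap = H₂) {a₁ b₁ : E₁ → E₁ → ℝ} {a₂ b₂ : E₂ → E₂ → ℝ}
    (ha : ∀ u ∈ H₁, ∀ v ∈ H₁, a₂ (Φ u) (Φ v) = a₁ u v)
    (hb : ∀ u ∈ H₁, ∀ v ∈ H₁, b₂ (Φ u) (Φ v) = b₁ u v) :
    negativeCount H₂ a₂ b₂ = negativeCount H₁ a₁ b₁ := by
  have key : ∀ θ, eigenspace H₂ a₂ b₂ θ = (eigenspace H₁ a₁ b₁ θ).map Φ.toLinearMap := by
    intro θ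
    rw [eigenspace, eigenspace, Submodule.map_span]
    congr 1
    subst hΦ
    ext y
    constructor
    · rintro ⟨⟨u, hu, rfl⟩, h⟩
      refine ⟨u, ⟨hu, fun v hv => ?_⟩, rfl⟩
      have := h (Φ v) ⟨v, hv, rfl⟩
      have e1 := ha u hu v hv
      have e2 := hb u hu v hv
      rw [← e1, ← e2]
      exact this
    · rintro ⟨u, ⟨hu, h⟩, rfl⟩
      refine ⟨⟨u, hu, rfl⟩, ?_⟩
      rintro _ ⟨v, hv, rfl⟩
      have e1 := ha u hu v hv
      have e2 := hb u hu v hv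
      have := h v hv
      rw [← e1, ← e2] at this
      exact this
  have hm : ∀ θ, eigMult H₂ a₂ b₂ θ = eigMult H₁ a₁ b₁ θ := by
    intro θ
    rw [eigMult, eigMult, key]
    have := LinearEquiv.lift_rank_eq (Φ.submoduleMap (eigenspace H₁ a₁ b₁ θ))
    have h2 := congrArg Cardinal.toENat this
    simpa using h2.symm
  simp only [negativeCount, hm]

/-- Restricting to a subspace: the problem in `H ≤ E` is the problem in `H` itself. -/
lemma negativeCount_subtype {E : Type*} [AddCommGroup E] [Module ℝ E] (H : Submodule ℝ E)
    (a b : E → E → ℝ) :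
    negativeCount H a b = negativeCount (⊤ : Submodule ℝ H) (fun u v => a u v)
      (fun u v => b u v) := by
  have key : ∀ θ, eigenspace H a b θ = (eigenspace (⊤ : Submodule ℝ H) (fun u v => a u v)
      (fun u v => b u v) θ).map H.subtype := by
    intro θ
    rw [eigenspace, eigenspace, Submodule.map_span]
    congr 1
    ext y
    constructor
    · rintro ⟨hy, h⟩
      exact ⟨⟨y, hy⟩, ⟨trivial, fun v _ => h v v.2⟩, rfl⟩
    · rintro ⟨u, ⟨-, h⟩, rfl⟩
      exact ⟨u.2, fun v hv => h ⟨v, hv⟩ trivial⟩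
  have hm : ∀ θ, eigMult H a b θ = eigMult (⊤ : Submodule ℝ H) (fun u v => a u v)
      (fun u v => b u v) θ := by
    intro θ
    rw [eigMult, eigMult, key]
    have := LinearEquiv.lift_rank_eq (Submodule.equivMapOfInjective H.subtype
      H.subtype_injective (eigenspace (⊤ : Submodule ℝ H) (fun u v => a u v)
      (fun u v => b u v) θ))
    have h2 := congrArg Cardinal.toENat this
    simpa using h2.symm
  simp only [negativeCount, hm]

end abstract

/-! ### Bounded operators and forms on `L²` -/

section LTwo

open scoped NNReal ENNReal

variable {α β : Type*} [MeasurableSpace α] [MeasurableSpace β] {μ : Measure α} {ν : Measure β}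

/-- Domination of the push-forward by a multiple of μ gives absolute continuity, so null sets pull
back to null sets and composition with S makes sense on L² classes. -/
lemma ae_comp_of_map_le {S : β → α} (hS : AEMeasurable S ν) {C : ℝ≥0}
    (hC : ν.map S ≤ C • μ) {p : α → Prop} (hp : ∀ᵐ x ∂μ, p x) : ∀ᵐ y ∂ν, p (S y) := by
  apply ae_of_ae_map hS
  have hac : ν.map S ≪ μ := (Measure.absolutelyContinuous_of_le hC).trans
    (Measure.smul_absolutelyContinuous (c := (C : ℝ≥0∞)))
  exact hac.ae_le hp

lemma memLp_mul_comp {S : β → α} (hS : AEMeasurable S ν) {C : ℝ≥0}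
    (hC : ν.map S ≤ C • μ) {c : β → ℝ} (hc : AEStronglyMeasurable c ν) {K : ℝ}
    (hK : ∀ᵐ y ∂ν, |c y| ≤ K) {f : α → ℝ} (hf : MemLp f 2 μ) :
    MemLp (fun y => c y * f (S y)) 2 ν ∧
      eLpNorm (fun y => c y * f (S y)) 2 ν
        ≤ ENNReal.ofReal K * ((C : ℝ≥0∞) ^ ((1 : ℝ) / 2) * eLpNorm f 2 μ) := by
  have h1 : MemLp f 2 (ν.map S) := hf.of_measure_le_smul (c := (C : ℝ≥0∞)) (by simp) hC
  have h2 : MemLp (f ∘ S) 2 ν := (memLp_map_measure_iff h1.1 hS).1 h1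
  have hb : ∀ᵐ y ∂ν, ‖c y * f (S y)‖ ≤ K * ‖(f ∘ S) y‖ := by
    filter_upwards [hK] with y hy
    rw [norm_mul]
    exact mul_le_mul_of_nonneg_right hy (norm_nonneg _)
  refine ⟨h2.of_le_mul (hc.mul h2.1) hb, ?_⟩
  refine (eLpNorm_le_mul_eLpNorm_of_ae_le_mul hb 2).trans ?_
  gcongr
  rw [← eLpNorm_map_measure h1.1 hS]
  refine (eLpNorm_mono_measure f hC).trans ?_
  have := eLpNorm_smul_measure_of_ne_top (p := 2) (μ := μ) (f := f) (by simp) (C : ℝ≥0∞)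
  rw [show (C • μ) = (C : ℝ≥0∞) • μ from rfl, this]
  simp

/-- The operator `f ↦ c · (f ∘ S)` on `L²`. -/
lemma exists_weightedComp {S : β → α} (hS : AEMeasurable S ν) {C : ℝ≥0}
    (hC : ν.map S ≤ C • μ) {c : β → ℝ} (hc : AEStronglyMeasurable c ν) {K : ℝ}
    (hK : ∀ᵐ y ∂ν, |c y| ≤ K) :
    ∃ W : Lp ℝ 2 μ →L[ℝ] Lp ℝ 2 ν, ∀ f, W f =ᵐ[ν] fun y => c y * f (S y) := by
  have hmem : ∀ f : Lp ℝ 2 μ, MemLp (fun y => c y * f (S y)) 2 ν := fun f =>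
    (memLp_mul_comp hS hC hc hK (Lp.memLp f)).1
  let W₀ : Lp ℝ 2 μ →ₗ[ℝ] Lp ℝ 2 ν :=
    { toFun := fun f => (hmem f).toLp _
      map_add' := fun f g => by
        rw [← MemLp.toLp_add]
        refine MemLp.toLp_congr _ _ ?_
        filter_upwards [ae_comp_of_map_le hS hC (Lp.coeFn_add f g)] with y hy
        simp only [Pi.add_apply] at hy ⊢
        rw [hy]; ring
      map_smul' := fun r f => by
        rw [RingHom.id_apply, ← MemLp.toLp_const_smul]
        refine MemLp.toLp_congr _ _ ?_
        filter_upwards [ae_comp_of_map_le hS hC (Lp.coeFn_smul r f)] with y hy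
        simp only [Pi.smul_apply, smul_eq_mul] at hy ⊢
        rw [hy]; ring }
  refine ⟨W₀.mkContinuous ((ENNReal.ofReal K * (C : ℝ≥0∞) ^ ((1 : ℝ) / 2)).toReal) ?_,
    fun f => (hmem f).coeFn_toLp⟩
  intro f
  change ‖(hmem f).toLp _‖ ≤ _
  rw [Lp.norm_toLp, Lp.norm_def, ← ENNReal.toReal_mul]
  refine ENNReal.toReal_mono ?_ ?_
  · refine ENNReal.mul_ne_top (ENNReal.mul_ne_top (by simp) ?_) (Lp.eLpNorm_ne_top f)
    exact ENNReal.rpow_ne_top_of_nonneg (by norm_num) (by simp)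
  · rw [mul_assoc]
    exact (memLp_mul_comp hS hC hc hK (Lp.memLp f)).2

lemma exists_weightedMul {c : α → ℝ} (hc : AEStronglyMeasurable c μ) {K : ℝ}
    (hK : ∀ᵐ y ∂μ, |c y| ≤ K) :
    ∃ W : Lp ℝ 2 μ →L[ℝ] Lp ℝ 2 μ, ∀ f, W f =ᵐ[μ] fun y => c y * f y :=
  exists_weightedComp (S := id) aemeasurable_id (C := 1) (by simp) hc hK

/-- The form `∫ c f g` on `L²`. -/
lemma exists_weightedForm {c : α → ℝ} (hc : AEStronglyMeasurable c μ) {K : ℝ}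
    (hK : ∀ᵐ y ∂μ, |c y| ≤ K) :
    ∃ B : Lp ℝ 2 μ →L[ℝ] Lp ℝ 2 μ →L[ℝ] ℝ, ∀ f g, B f g = ∫ y, c y * f y * g y ∂μ := by
  obtain ⟨W, hW⟩ := exists_weightedMul hc hK
  refine ⟨(innerSL ℝ).comp W, fun f g => ?_⟩
  rw [ContinuousLinearMap.comp_apply, innerSL_apply_apply, L2.inner_def]
  refine integral_congr_ae ?_
  filter_upwards [hW f] with y hy
  rw [hy]
  simp [mul_comm]

lemma integrable_weighted {c : α → ℝ} (hc : AEStronglyMeasurable c μ) {K : ℝ}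
    (hK : ∀ᵐ y ∂μ, |c y| ≤ K) (f g : Lp ℝ 2 μ) : Integrable (fun y => c y * f y * g y) μ := by
  obtain ⟨W, hW⟩ := exists_weightedMul hc hK
  have := L2.integrable_inner (𝕜 := ℝ) (W f) g
  refine this.congr ?_
  filter_upwards [hW f] with y hy
  rw [hy]
  simp [mul_comm]

end LTwo

/-! ### Calculus on the flat strip -/

section flat

open Filter Topology

lemma mem_flat {z : ℝ × ℝ} : z ∈ closedStrip flat ↔ z.2 ∈ Icc (0 : ℝ) 1 := Iff.rfl

lemma flat_eq_prod : closedStrip flat = univ ×ˢ Icc (0 : ℝ) 1 := by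
  ext z; simp [mem_flat]

lemma uniqueDiffOn_flat : UniqueDiffOn ℝ (closedStrip flat) := by
  rw [flat_eq_prod]
  exact uniqueDiffOn_univ.prod (uniqueDiffOn_Icc zero_lt_one)

lemma flat_subset_closure_interior : closedStrip flat ⊆ closure (interior (closedStrip flat)) := by
  rw [flat_eq_prod, interior_prod_eq, closure_prod_eq, interior_univ, closure_univ, interior_Icc,
    closure_Ioo zero_ne_one]

variable {f g : ℝ × ℝ → ℝ}

/-- Horizontal lines stay inside the strip, so the derivative in q is two-sided even on p = 0 and p
= 1, whereas the one in p is one-sided there. -/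
lemma hasDerivAt_pd1 {q p : ℝ} (hp : p ∈ Icc (0 : ℝ) 1)
    (hf : DifferentiableWithinAt ℝ f (closedStrip flat) (q, p)) :
    HasDerivAt (fun q => f (q, p)) (pd1 flat f (q, p)) q := by
  rw [← hasDerivWithinAt_univ]
  have h1 : HasDerivWithinAt (fun q : ℝ => ((q, p) : ℝ × ℝ)) (1, 0) univ q :=
    ((hasDerivAt_id q).prodMk (hasDerivAt_const q p)).hasDerivWithinAt
  exact hf.hasFDerivWithinAt.comp_hasDerivWithinAt q h1 fun _ _ => hp

lemma hasDerivWithinAt_pd2 {q p : ℝ}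
    (hf : DifferentiableWithinAt ℝ f (closedStrip flat) (q, p)) :
    HasDerivWithinAt (fun p => f (q, p)) (pd2 flat f (q, p)) (Icc 0 1) p := by
  have h1 : HasDerivWithinAt (fun p : ℝ => ((q, p) : ℝ × ℝ)) (0, 1) (Icc 0 1) p :=
    ((hasDerivAt_const p q).prodMk (hasDerivAt_id p)).hasDerivWithinAt
  exact hf.hasFDerivWithinAt.comp_hasDerivWithinAt p h1 fun _ hx => hx

lemma hasDerivAt_pd2 {q p : ℝ} (hp : p ∈ Ioo (0 : ℝ) 1)
    (hf : DifferentiableWithinAt ℝ f (closedStrip flat) (q, p)) :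
    HasDerivAt (fun p => f (q, p)) (pd2 flat f (q, p)) p :=
  (hasDerivWithinAt_pd2 hf).hasDerivAt (Icc_mem_nhds hp.1 hp.2)

lemma pd1_eq_of_hasDerivAt {q p d : ℝ} (hp : p ∈ Icc (0 : ℝ) 1)
    (hf : DifferentiableWithinAt ℝ f (closedStrip flat) (q, p))
    (h : HasDerivAt (fun q => f (q, p)) d q) : pd1 flat f (q, p) = d :=
  (hasDerivAt_pd1 hp hf).unique h

lemma pd2_eq_of_hasDerivWithinAt {q p d : ℝ} (hp : p ∈ Icc (0 : ℝ) 1)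
    (hf : DifferentiableWithinAt ℝ f (closedStrip flat) (q, p))
    (h : HasDerivWithinAt (fun p => f (q, p)) d (Icc 0 1) p) : pd2 flat f (q, p) = d :=
  (uniqueDiffOn_Icc zero_lt_one p hp).eq_deriv _ (hasDerivWithinAt_pd2 hf) h

/-- `L`-periodicity in the first variable on the closed flat strip. -/
def IsPer (L : ℝ) (f : ℝ × ℝ → ℝ) : Prop :=
  ∀ q, ∀ p ∈ Icc (0 : ℝ) 1, f (q + L, p) = f (q, p)

/-- Evenness in the first variable on the closed flat strip. -/
def IsEvn (f : ℝ × ℝ → ℝ) : Prop := ∀ q, ∀ p ∈ Icc (0 : ℝ) 1, f (-q, p) = f (q, p)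

variable {L : ℝ}

lemma IsPer.pd1 (hf : DifferentiableOn ℝ f (closedStrip flat)) (h : IsPer L f) :
    IsPer L (pd1 flat f) := by
  intro q p hp
  have h1 := (hasDerivAt_pd1 hp (hf (q + L, p) hp)).comp_add_const q L
  refine (pd1_eq_of_hasDerivAt hp (hf (q, p) hp) ?_).symm
  refine h1.congr_of_eventuallyEq (Eventually.of_forall fun x => ?_)
  exact (h x p hp).symm

lemma IsPer.pd2 (hf : DifferentiableOn ℝ f (closedStrip flat)) (h : IsPer L f) :
    IsPer L (pd2 flat f) := by
  intro q p hp
  have h1 := hasDerivWithinAt_pd2 (hf (q + L, p) hp)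
  refine (pd2_eq_of_hasDerivWithinAt hp (hf (q, p) hp) ?_).symm
  exact h1.congr (fun x hx => (h q x hx).symm) (h q p hp).symm

lemma IsEvn.pd2 (hf : DifferentiableOn ℝ f (closedStrip flat)) (h : IsEvn f) :
    IsEvn (pd2 flat f) := by
  intro q p hp
  have h1 := hasDerivWithinAt_pd2 (hf (-q, p) hp)
  refine (pd2_eq_of_hasDerivWithinAt hp (hf (q, p) hp) ?_).symm
  exact h1.congr (fun x hx => (h q x hx).symm) (h q p hp).symm

lemma IsPer.exists_reduce (hL : 0 < L) (h : IsPer L f) (q : ℝ) {p : ℝ} (hp : p ∈ Icc (0 : ℝ) 1) :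
    ∃ q' ∈ Icc 0 L, f (q, p) = f (q', p) := by
  have hper : Function.Periodic (fun q => f (q, p)) L := fun q => h q p hp
  obtain ⟨q', hq', h'⟩ := hper.exists_mem_Ico₀ hL q
  exact ⟨q', Ico_subset_Icc_self hq', h'⟩

/-- A continuous periodic function on the closed strip is bounded. -/
lemma IsPer.exists_bound (hL : 0 < L) (hf : ContinuousOn f (closedStrip flat)) (h : IsPer L f) :
    ∃ K > 0, ∀ z ∈ closedStrip flat, |f z| ≤ K := by
  have hc : IsCompact (Icc 0 L ×ˢ Icc (0 : ℝ) 1) := isCompact_Icc.prod isCompact_Icc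
  obtain ⟨K, hK⟩ := hc.exists_bound_of_continuousOn
    (hf.mono (fun z hz => hz.2 : Icc 0 L ×ˢ Icc (0 : ℝ) 1 ⊆ closedStrip flat))
  refine ⟨max K 1, by positivity, fun z hz => ?_⟩
  obtain ⟨q', hq', h'⟩ := h.exists_reduce hL z.1 (p := z.2) hz
  rw [show z = (z.1, z.2) from rfl, h']
  exact (hK (q', z.2) ⟨hq', hz⟩).trans (le_max_left _ _)

/-- A positive continuous periodic function on the closed strip is bounded below. -/
lemma IsPer.exists_pos_lower (hL : 0 < L) (hf : ContinuousOn f (closedStrip flat))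
    (h : IsPer L f) (hpos : ∀ z ∈ closedStrip flat, 0 < f z) :
    ∃ m > 0, ∀ z ∈ closedStrip flat, m ≤ f z := by
  have hc : IsCompact (Icc 0 L ×ˢ Icc (0 : ℝ) 1) := isCompact_Icc.prod isCompact_Icc
  obtain ⟨z₀, hz₀, hmin⟩ := hc.exists_isMinOn ⟨(0, 0), ⟨⟨le_rfl, hL.le⟩, ⟨le_rfl, zero_le_one⟩⟩⟩
    (hf.mono (fun z hz => hz.2 : Icc 0 L ×ˢ Icc (0 : ℝ) 1 ⊆ closedStrip flat))
  refine ⟨f z₀, hpos z₀ hz₀.2, fun z hz => ?_⟩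
  obtain ⟨q', hq', h'⟩ := h.exists_reduce hL z.1 (p := z.2) hz
  rw [show z = (z.1, z.2) from rfl, h']
  exact hmin (show (q', z.2) ∈ Icc 0 L ×ˢ Icc (0 : ℝ) 1 from ⟨hq', hz⟩)

lemma contDiffOn_pd1 {η : ℝ → ℝ} {n : WithTop ℕ∞} (hu : UniqueDiffOn ℝ (closedStrip η))
    (hf : ContDiffOn ℝ (n + 1) f (closedStrip η)) : ContDiffOn ℝ n (pd1 η f) (closedStrip η) :=
  (hf.fderivWithin hu le_rfl).clm_apply contDiffOn_const

lemma contDiffOn_pd2 {η : ℝ → ℝ} {n : WithTop ℕ∞} (hu : UniqueDiffOn ℝ (closedStrip η))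
    (hf : ContDiffOn ℝ (n + 1) f (closedStrip η)) : ContDiffOn ℝ n (pd2 η f) (closedStrip η) :=
  (hf.fderivWithin hu le_rfl).clm_apply contDiffOn_const

lemma continuousOn_pd1 {η : ℝ → ℝ} (hu : UniqueDiffOn ℝ (closedStrip η))
    (hf : ContDiffOn ℝ 1 f (closedStrip η)) : ContinuousOn (pd1 η f) (closedStrip η) :=
  (contDiffOn_pd1 (n := 0) hu (by simpa using hf)).continuousOn

lemma continuousOn_pd2 {η : ℝ → ℝ} (hu : UniqueDiffOn ℝ (closedStrip η))
    (hf : ContDiffOn ℝ 1 f (closedStrip η)) : ContinuousOn (pd2 η f) (closedStrip η) :=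
  (contDiffOn_pd2 (n := 0) hu (by simpa using hf)).continuousOn

/-- The gradient as a linear functional, in terms of the partial derivatives. -/
lemma fderivWithin_eq_pd (η : ℝ → ℝ) (f : ℝ × ℝ → ℝ) (z v : ℝ × ℝ) :
    fderivWithin ℝ f (closedStrip η) z v = v.1 * pd1 η f z + v.2 * pd2 η f z := by
  have : v = v.1 • ((1, 0) : ℝ × ℝ) + v.2 • ((0, 1) : ℝ × ℝ) := by ext <;> simp
  conv_lhs => rw [this]
  rw [map_add, map_smul, map_smul]
  rfl

section algebra

variable {η : ℝ → ℝ} {z : ℝ × ℝ}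

lemma pd_mul (hu : UniqueDiffWithinAt ℝ (closedStrip η) z)
    (hf : DifferentiableWithinAt ℝ f (closedStrip η) z)
    (hg : DifferentiableWithinAt ℝ g (closedStrip η) z) :
    pd1 η (fun z => f z * g z) z = f z * pd1 η g z + g z * pd1 η f z ∧
    pd2 η (fun z => f z * g z) z = f z * pd2 η g z + g z * pd2 η f z := by
  rw [pd1, pd2, fderivWithin_fun_mul hu hf hg]
  simp [pd1, pd2]

lemma pd_add (hu : UniqueDiffWithinAt ℝ (closedStrip η) z)
    (hf : DifferentiableWithinAt ℝ f (closedStrip η) z)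
    (hg : DifferentiableWithinAt ℝ g (closedStrip η) z) :
    pd1 η (fun z => f z + g z) z = pd1 η f z + pd1 η g z ∧
    pd2 η (fun z => f z + g z) z = pd2 η f z + pd2 η g z := by
  rw [pd1, pd2, fderivWithin_fun_add hu hf hg]
  simp [pd1, pd2]

lemma pd_const_mul (hu : UniqueDiffWithinAt ℝ (closedStrip η) z) (c : ℝ)
    (hf : DifferentiableWithinAt ℝ f (closedStrip η) z) :
    pd1 η (fun z => c * f z) z = c * pd1 η f z ∧
    pd2 η (fun z => c * f z) z = c * pd2 η f z := by
  rw [pd1, pd2, fderivWithin_const_mul hu hf]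
  simp [pd1, pd2]

end algebra

/-! ### Integrals over boxes -/

lemma integral_Ioo_eq {f : ℝ → ℝ} {a b : ℝ} (hab : a ≤ b) :
    ∫ x in Ioo a b, f x = ∫ x in a..b, f x := by
  rw [intervalIntegral.integral_of_le hab, integral_Ioc_eq_integral_Ioo]

lemma integrableOn_box {g : ℝ × ℝ → ℝ} {a b c d : ℝ} (hg : ContinuousOn g (Icc a b ×ˢ Icc c d)) :
    IntegrableOn g (Ioo a b ×ˢ Ioo c d) :=
  (hg.integrableOn_compact (isCompact_Icc.prod isCompact_Icc)).mono_set
    (prod_mono Ioo_subset_Icc_self Ioo_subset_Icc_self)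

lemma integral_box {g : ℝ × ℝ → ℝ} {a b c d : ℝ} (hab : a ≤ b) (hcd : c ≤ d)
    (hg : ContinuousOn g (Icc a b ×ˢ Icc c d)) :
    ∫ z in Ioo a b ×ˢ Ioo c d, g z = ∫ x in a..b, ∫ y in c..d, g (x, y) := by
  have h := integrableOn_box hg
  rw [Measure.volume_eq_prod] at h ⊢
  rw [setIntegral_prod _ h, integral_Ioo_eq hab]
  simp only [integral_Ioo_eq hcd]

/-- Continuous extension of a function on a box, constant along the outward normals. -/
def boxExtend (a b c d : ℝ) (g : ℝ × ℝ → ℝ) (z : ℝ × ℝ) : ℝ :=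
  g (max a (min b z.1), max c (min d z.2))

lemma continuous_boxExtend {g : ℝ × ℝ → ℝ} {a b c d : ℝ} (hab : a ≤ b) (hcd : c ≤ d)
    (hg : ContinuousOn g (Icc a b ×ˢ Icc c d)) : Continuous (boxExtend a b c d g) := by
  refine hg.comp_continuous (by fun_prop) fun z => ?_
  exact ⟨⟨le_max_left _ _, max_le hab (min_le_left _ _)⟩,
    ⟨le_max_left _ _, max_le hcd (min_le_left _ _)⟩⟩

lemma boxExtend_eq {g : ℝ × ℝ → ℝ} {a b c d : ℝ} {z : ℝ × ℝ} (h1 : z.1 ∈ Icc a b)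
    (h2 : z.2 ∈ Icc c d) : boxExtend a b c d g z = g z := by
  rw [boxExtend, min_eq_right h1.2, max_eq_right h1.1, min_eq_right h2.2, max_eq_right h2.1]

/-- The continuous extension of the integrand to the plane reduces this to parameter integrals of
globally continuous functions. -/
lemma continuousOn_integral_right {g : ℝ × ℝ → ℝ} {a b c d : ℝ} (hab : a ≤ b) (hcd : c ≤ d)
    (hg : ContinuousOn g (Icc a b ×ˢ Icc c d)) :
    ContinuousOn (fun x => ∫ y in c..d, g (x, y)) (Icc a b) := by
  have h1 := intervalIntegral.continuous_parametric_intervalIntegral_of_continuous' (μ := volume)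
    (f := fun x y => boxExtend a b c d g (x, y)) (continuous_boxExtend hab hcd hg) c d
  refine h1.continuousOn.congr fun x hx => ?_
  refine intervalIntegral.integral_congr fun y hy => ?_
  rw [uIcc_of_le hcd] at hy
  exact (boxExtend_eq (z := (x, y)) hx hy).symm

lemma integral_swap_box {g : ℝ × ℝ → ℝ} {a b c d : ℝ} (hab : a ≤ b) (hcd : c ≤ d)
    (hg : ContinuousOn g (Icc a b ×ˢ Icc c d)) :
    ∫ x in a..b, ∫ y in c..d, g (x, y) = ∫ y in c..d, ∫ x in a..b, g (x, y) := by
  have hg' : ContinuousOn (fun z => g z.swap) (Icc c d ×ˢ Icc a b) :=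
    hg.comp continuous_swap.continuousOn fun z hz => ⟨hz.2, hz.1⟩
  have h := integrableOn_box hg
  have h' := integrableOn_box hg'
  have e := integral_box hcd hab hg'
  rw [← integral_box hab hcd hg]
  simp only [Prod.swap_prod_mk] at e
  rw [← e, Measure.volume_eq_prod]
  exact (setIntegral_prod_swap (μ := volume) (ν := volume) _ _ g).symm

end flat

/-! ### Poincaré and trace inequalities -/

section poincare

open Filter Topology

variable {f f' : ℝ → ℝ} {a b : ℝ}

lemma integral_sub_const_sq (hab : a ≤ b) (hf : ContinuousOn f (Icc a b)) (c : ℝ) :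
    ∫ x in a..b, (f x - c) ^ 2 = (∫ x in a..b, f x ^ 2) - 2 * c * (∫ x in a..b, f x)
      + c ^ 2 * (b - a) := by
  have hi : IntervalIntegrable f volume a b := hf.intervalIntegrable_of_Icc hab
  have hi2 : IntervalIntegrable (fun x => f x ^ 2) volume a b :=
    (hf.pow 2).intervalIntegrable_of_Icc hab
  have : ∀ x, (f x - c) ^ 2 = f x ^ 2 - 2 * c * f x + c ^ 2 := fun x => by ring
  simp only [this]
  rw [intervalIntegral.integral_add (hi2.sub (hi.const_mul _)) intervalIntegrable_const,
    intervalIntegral.integral_sub hi2 (hi.const_mul _), intervalIntegral.integral_const_mul,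
    intervalIntegral.integral_const, smul_eq_mul]
  ring

/-- Cauchy–Schwarz against the constant 1, read off from the nonnegativity of the variance. -/
lemma sq_integral_le (hab : a ≤ b) (hf : ContinuousOn f (Icc a b)) :
    (∫ x in a..b, f x) ^ 2 ≤ (b - a) * ∫ x in a..b, f x ^ 2 := by
  rcases hab.eq_or_lt with rfl | hlt
  · simp
  have hpos : 0 < b - a := sub_pos.2 hlt
  have h0 : 0 ≤ ∫ x in a..b, (f x - (∫ x in a..b, f x) / (b - a)) ^ 2 :=
    intervalIntegral.integral_nonneg hab fun x _ => sq_nonneg _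
  rw [integral_sub_const_sq hab hf] at h0
  have h1 : (b - a) * ((∫ x in a..b, f x ^ 2) - 2 * ((∫ x in a..b, f x) / (b - a))
      * (∫ x in a..b, f x) + ((∫ x in a..b, f x) / (b - a)) ^ 2 * (b - a))
      = (b - a) * (∫ x in a..b, f x ^ 2) - (∫ x in a..b, f x) ^ 2 := by
    field_simp; ring
  have := mul_nonneg hpos.le h0
  linarith

/-- A function of small oscillation is close to its mean in `L²`. -/
lemma integral_sq_le_of_osc (hab : a < b) (hf : ContinuousOn f (Icc a b)) {M : ℝ}
    (hM : ∀ x ∈ Icc a b, ∀ y ∈ Icc a b, (f x - f y) ^ 2 ≤ M) :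
    ∫ x in a..b, f x ^ 2 ≤ (∫ x in a..b, f x) ^ 2 / (b - a) + (b - a) * M := by
  have hpos : 0 < b - a := sub_pos.2 hab
  -- A point where f equals its mean, so that the oscillation bound applies to f - mean.
  obtain ⟨ξ, hξ, hmean⟩ := exists_eq_interval_average hab.ne (by rwa [uIcc_of_le hab.le])
  rw [uIoo_of_le hab.le] at hξ
  rw [interval_average_eq_div] at hmean
  have h1 := integral_sub_const_sq hab.le hf (f ξ)
  have h2 : ∫ x in a..b, (f x - f ξ) ^ 2 ≤ (b - a) * M := by
    have := intervalIntegral.integral_mono_on hab.le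
      (((hf.sub continuousOn_const).pow 2).intervalIntegrable_of_Icc (μ := volume) hab.le)
      (intervalIntegrable_const (c := M)) (fun x hx => hM x hx ξ (Ioo_subset_Icc_self hξ))
    simpa using this
  have h3 : 2 * f ξ * (∫ x in a..b, f x) - f ξ ^ 2 * (b - a)
      = (∫ x in a..b, f x) ^ 2 / (b - a) := by
    rw [hmean]; field_simp; ring
  linarith

/-- The fundamental theorem of calculus between x and y, followed by Cauchy–Schwarz. -/
lemma sub_sq_le_integral (hf : ContinuousOn f (Icc a b))
    (hf' : ContinuousOn f' (Icc a b)) (hd : ∀ x ∈ Ioo a b, HasDerivAt f (f' x) x) {x y : ℝ}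
    (hx : x ∈ Icc a b) (hy : y ∈ Icc a b) :
    (f x - f y) ^ 2 ≤ (b - a) * ∫ x in a..b, f' x ^ 2 := by
  wlog hxy : x ≤ y generalizing x y
  · have := this hy hx (le_of_not_ge hxy)
    rwa [← neg_sub, neg_sq]
  have hab : a ≤ b := hx.1.trans hx.2
  have hsub : Icc x y ⊆ Icc a b := Icc_subset_Icc hx.1 hy.2
  have hftc : ∫ t in x..y, f' t = f y - f x :=
    intervalIntegral.integral_eq_sub_of_hasDerivAt_of_le hxy (hf.mono hsub)
      (fun t ht => hd t ⟨hx.1.trans_lt ht.1, ht.2.trans_le hy.2⟩)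
      ((hf'.mono hsub).intervalIntegrable_of_Icc hxy)
  have h1 := sq_integral_le hxy (hf'.mono hsub)
  rw [hftc] at h1
  have h2 : ∫ t in x..y, f' t ^ 2 ≤ ∫ t in a..b, f' t ^ 2 :=
    intervalIntegral.integral_mono_interval hx.1 hxy hy.2
      (Filter.Eventually.of_forall fun t => sq_nonneg _)
      ((hf'.pow 2).intervalIntegrable_of_Icc hab)
  have h3 : 0 ≤ ∫ t in x..y, f' t ^ 2 := intervalIntegral.integral_nonneg hxy fun t _ => sq_nonneg _
  calc (f x - f y) ^ 2 = (f y - f x) ^ 2 := by ring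
    _ ≤ (y - x) * ∫ t in x..y, f' t ^ 2 := h1
    _ ≤ (b - a) * ∫ t in a..b, f' t ^ 2 := by
      apply mul_le_mul _ h2 h3 (by linarith)
      linarith [hx.1, hy.2]

variable {u : ℝ × ℝ → ℝ} {c d : ℝ}

lemma box_subset_flat (hc : 0 ≤ c) (hd : d ≤ 1) :
    Icc a b ×ˢ Icc c d ⊆ closedStrip flat := fun _ hz =>
  ⟨hc.trans hz.2.1, hz.2.2.trans hd⟩

lemma _root_.ContinuousOn.slice_left (hg : ContinuousOn u (Icc a b ×ˢ Icc c d)) {p : ℝ}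
    (hp : p ∈ Icc c d) : ContinuousOn (fun q => u (q, p)) (Icc a b) :=
  hg.comp (by fun_prop) fun _ hq => ⟨hq, hp⟩

lemma _root_.ContinuousOn.slice_right (hg : ContinuousOn u (Icc a b ×ˢ Icc c d)) {q : ℝ}
    (hq : q ∈ Icc a b) : ContinuousOn (fun p => u (q, p)) (Icc c d) :=
  hg.comp (by fun_prop) fun _ hp => ⟨hq, hp⟩

lemma continuousOn_integral_left (hab : a ≤ b) (hcd : c ≤ d)
    (hg : ContinuousOn u (Icc a b ×ˢ Icc c d)) :
    ContinuousOn (fun p => ∫ q in a..b, u (q, p)) (Icc c d) := by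
  have hg' : ContinuousOn (fun z => u z.swap) (Icc c d ×ˢ Icc a b) :=
    hg.comp continuous_swap.continuousOn fun z hz => ⟨hz.2, hz.1⟩
  exact continuousOn_integral_right hcd hab hg'

/-- Poincaré inequality on a box. -/
lemma poincare_box (hu : ContDiffOn ℝ 1 u (closedStrip flat)) (hab : a < b) (hcd : c < d)
    (hc : 0 ≤ c) (hd : d ≤ 1) :
    ∫ q in a..b, ∫ p in c..d, u (q, p) ^ 2
      ≤ (∫ q in a..b, ∫ p in c..d, u (q, p)) ^ 2 / ((b - a) * (d - c))
        + (b - a) ^ 2 * (∫ q in a..b, ∫ p in c..d, pd1 flat u (q, p) ^ 2)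
        + (d - c) ^ 2 * (∫ q in a..b, ∫ p in c..d, pd2 flat u (q, p) ^ 2) := by
  have hsub : Icc a b ×ˢ Icc c d ⊆ closedStrip flat := box_subset_flat hc hd
  have hcu := hu.continuousOn.mono hsub
  have hc1 := (continuousOn_pd1 uniqueDiffOn_flat hu).mono hsub
  have hc2 := (continuousOn_pd2 uniqueDiffOn_flat hu).mono hsub
  have hdiff := hu.differentiableOn one_ne_zero
  have hp01 : ∀ p ∈ Icc c d, p ∈ Icc (0 : ℝ) 1 := fun p hp => ⟨hc.trans hp.1, hp.2.trans hd⟩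
  have hs : 0 < b - a := sub_pos.2 hab
  have ht : 0 < d - c := sub_pos.2 hcd
  -- the mean over `q`
  set m : ℝ → ℝ := fun p => ∫ q in a..b, u (q, p) with hm
  have hmc : ContinuousOn m (Icc c d) := continuousOn_integral_left hab.le hcd.le hcu
  -- The one-dimensional Poincaré inequality in q on each horizontal line; `h3` is the same
  -- inequality in p for the integrals m.
  have h1 : ∀ p ∈ Icc c d, ∫ q in a..b, u (q, p) ^ 2
      ≤ m p ^ 2 / (b - a) + (b - a) * ((b - a) * ∫ q in a..b, pd1 flat u (q, p) ^ 2) := by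
    intro p hp
    refine integral_sq_le_of_osc hab (hcu.slice_left hp) fun x hx y hy => ?_
    exact sub_sq_le_integral (hcu.slice_left hp) (hc1.slice_left hp)
      (fun q _ => hasDerivAt_pd1 (hp01 p hp) (hdiff _ (hp01 p hp))) hx hy
  have hI1 : ContinuousOn (fun p => ∫ q in a..b, u (q, p) ^ 2) (Icc c d) :=
    continuousOn_integral_left hab.le hcd.le (hcu.pow 2)
  have hI2 : ContinuousOn (fun p => ∫ q in a..b, pd1 flat u (q, p) ^ 2) (Icc c d) :=
    continuousOn_integral_left hab.le hcd.le (hc1.pow 2)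
  have hI3 : ContinuousOn (fun q => ∫ p in c..d, pd2 flat u (q, p) ^ 2) (Icc a b) :=
    continuousOn_integral_right hab.le hcd.le (hc2.pow 2)
  have h2 : ∫ p in c..d, ∫ q in a..b, u (q, p) ^ 2 ≤ (∫ p in c..d, m p ^ 2) / (b - a)
      + (b - a) ^ 2 * ∫ p in c..d, ∫ q in a..b, pd1 flat u (q, p) ^ 2 := by
    have hmi : IntervalIntegrable (fun p => m p ^ 2) volume c d :=
      (hmc.pow 2).intervalIntegrable_of_Icc hcd.le
    have h2i := hI2.intervalIntegrable_of_Icc (μ := volume) hcd.le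
    refine (intervalIntegral.integral_mono_on hcd.le (hI1.intervalIntegrable_of_Icc hcd.le)
      ((hmi.div_const _).add ((h2i.const_mul _).const_mul _)) h1).trans (le_of_eq ?_)
    rw [intervalIntegral.integral_add (hmi.div_const _) ((h2i.const_mul _).const_mul _),
      intervalIntegral.integral_div, intervalIntegral.integral_const_mul,
      intervalIntegral.integral_const_mul]
    ring
  have h3 : ∫ p in c..d, m p ^ 2 ≤ (∫ p in c..d, m p) ^ 2 / (d - c)
      + (d - c) * ((b - a) * ((d - c) * ∫ q in a..b, ∫ p in c..d, pd2 flat u (q, p) ^ 2)) := by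
    refine integral_sq_le_of_osc hcd hmc fun x hx y hy => ?_
    have hxi := (hcu.slice_left hx).intervalIntegrable_of_Icc (μ := volume) hab.le
    have hyi := (hcu.slice_left hy).intervalIntegrable_of_Icc (μ := volume) hab.le
    rw [hm]
    simp only
    rw [← intervalIntegral.integral_sub hxi hyi]
    refine (sq_integral_le hab.le ((hcu.slice_left hx).sub (hcu.slice_left hy))).trans ?_
    refine mul_le_mul_of_nonneg_left ?_ hs.le
    rw [← intervalIntegral.integral_const_mul]
    refine intervalIntegral.integral_mono_on hab.le
      ((((hcu.slice_left hx).sub (hcu.slice_left hy)).pow 2).intervalIntegrable_of_Icc hab.le)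
      ((hI3.const_mul _).intervalIntegrable_of_Icc hab.le) fun q hq => ?_
    refine sub_sq_le_integral (f := fun p => u (q, p)) (f' := fun p => pd2 flat u (q, p))
      (hcu.slice_right hq) (hc2.slice_right hq) (fun p hp => ?_) hx hy
    have hp' : p ∈ Ioo (0 : ℝ) 1 := ⟨hc.trans_lt hp.1, hp.2.trans_le hd⟩
    exact hasDerivAt_pd2 hp' (hdiff _ (Ioo_subset_Icc_self hp'))
  rw [integral_swap_box (g := fun z => u z ^ 2) hab.le hcd.le (hcu.pow 2), integral_swap_box hab.le hcd.le hcu,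
    integral_swap_box (g := fun z => pd1 flat u z ^ 2) hab.le hcd.le (hc1.pow 2)]
  refine h2.trans ?_
  have h4 := div_le_div_of_nonneg_right h3 hs.le
  have e : ((∫ p in c..d, m p) ^ 2 / (d - c)
      + (d - c) * ((b - a) * ((d - c) * ∫ q in a..b, ∫ p in c..d, pd2 flat u (q, p) ^ 2))) / (b - a)
      = (∫ p in c..d, m p) ^ 2 / ((b - a) * (d - c))
      + (d - c) ^ 2 * ∫ q in a..b, ∫ p in c..d, pd2 flat u (q, p) ^ 2 := by
    field_simp
  rw [e] at h4
  linarith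

/-- Pointwise bound for functions vanishing on the bottom. -/
lemma sq_le_integral (hu : ContDiffOn ℝ 1 u (closedStrip flat)) (hbot : ∀ q, u (q, 0) = 0)
    {δ : ℝ} (hδ : 0 < δ) (q : ℝ) {p : ℝ} (hp : p ∈ Icc (0 : ℝ) 1) :
    u (q, p) ^ 2 ≤ ∫ s in (0 : ℝ)..1, (δ * pd2 flat u (q, s) ^ 2 + δ⁻¹ * u (q, s) ^ 2) := by
  have hsub : Icc q q ×ˢ Icc (0 : ℝ) 1 ⊆ closedStrip flat := box_subset_flat le_rfl le_rfl
  have hq : q ∈ Icc q q := ⟨le_rfl, le_rfl⟩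
  have hcu : ContinuousOn (fun p => u (q, p)) (Icc 0 1) :=
    (hu.continuousOn.mono hsub).slice_right hq
  have hc2 : ContinuousOn (fun p => pd2 flat u (q, p)) (Icc 0 1) :=
    ((continuousOn_pd2 uniqueDiffOn_flat hu).mono hsub).slice_right hq
  have hp0 : Icc 0 p ⊆ Icc (0 : ℝ) 1 := Icc_subset_Icc le_rfl hp.2
  have hftc : ∫ s in (0 : ℝ)..p, 2 * u (q, s) * pd2 flat u (q, s) = u (q, p) ^ 2 - u (q, 0) ^ 2 := by
    refine intervalIntegral.integral_eq_sub_of_hasDerivAt_of_le hp.1 ((hcu.pow 2).mono hp0)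
      (fun s hs => ?_) ?_
    · have hs' : s ∈ Ioo (0 : ℝ) 1 := ⟨hs.1, hs.2.trans_le hp.2⟩
      have := (hasDerivAt_pd2 hs' (hu.differentiableOn one_ne_zero _
        (Ioo_subset_Icc_self hs' : ((q, s) : ℝ × ℝ).2 ∈ _))).pow 2
      simpa using this
    · exact (((continuousOn_const.mul hcu).mul hc2).mono hp0).intervalIntegrable_of_Icc hp.1
  have hgc : ContinuousOn (fun s => δ * pd2 flat u (q, s) ^ 2 + δ⁻¹ * u (q, s) ^ 2) (Icc 0 1) :=
    (continuousOn_const.mul (hc2.pow 2)).add (continuousOn_const.mul (hcu.pow 2))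
  have h1 : u (q, p) ^ 2 = ∫ s in (0 : ℝ)..p, 2 * u (q, s) * pd2 flat u (q, s) := by
    rw [hftc, hbot]; ring
  rw [h1]
  refine (intervalIntegral.integral_mono_on hp.1
    ((((continuousOn_const.mul hcu).mul hc2).mono hp0).intervalIntegrable_of_Icc hp.1)
    ((hgc.mono hp0).intervalIntegrable_of_Icc hp.1) (fun s _ => ?_)).trans
    (intervalIntegral.integral_mono_interval le_rfl hp.1 hp.2
      (Filter.Eventually.of_forall fun s => ?_) (hgc.intervalIntegrable_of_Icc zero_le_one))
  · have h2 : δ * pd2 flat u (q, s) ^ 2 + δ⁻¹ * u (q, s) ^ 2 - 2 * u (q, s) * pd2 flat u (q, s)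
        = δ⁻¹ * (δ * pd2 flat u (q, s) - u (q, s)) ^ 2 := by field_simp; ring
    have h3 : 0 ≤ δ⁻¹ * (δ * pd2 flat u (q, s) - u (q, s)) ^ 2 := by positivity
    simp only [Pi.mul_apply]
    linarith
  · simp only [Pi.zero_apply]; positivity

end poincare

/-! ### Inequalities in the Sobolev space on the flat strip -/

section sobolev

open Filter Topology

variable {L : ℝ}

lemma cell_flat (L : ℝ) : cell L flat = Ioo (-L / 2) (L / 2) ×ˢ Ioo (0 : ℝ) 1 := by
  ext z; simp [cell, flat]

lemma cell_subset_closedStrip (L : ℝ) (η : ℝ → ℝ) : cell L η ⊆ closedStrip η := fun _ hz =>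
  ⟨hz.2.1.le, hz.2.2.le⟩

lemma measurableSet_cell_flat (L : ℝ) : MeasurableSet (cell L flat) := by
  rw [cell_flat]; exact measurableSet_Ioo.prod measurableSet_Ioo

/-- `U` is represented by the `C¹` function `u`. -/
structure IsCoreQuad (L : ℝ) (η : ℝ → ℝ) (U : Quad L η) (u : ℝ × ℝ → ℝ) : Prop where
  core : IsCore L η u
  fn_eq : fn U =ᵐ[volume.restrict (cell L η)] u
  d1_eq : d1 U =ᵐ[volume.restrict (cell L η)] pd1 η u
  d2_eq : d2 U =ᵐ[volume.restrict (cell L η)] pd2 η u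
  tr_eq : tr U =ᵐ[volume.restrict (Ioo (-L / 2) (L / 2))] fun x => u (x, η x)

lemma H1pe_eq (L : ℝ) (η : ℝ → ℝ) :
    H1pe L η = (Submodule.span ℝ {U : Quad L η | ∃ u, IsCoreQuad L η U u}).topologicalClosure := by
  rw [H1pe]
  congr 2
  ext U
  constructor
  · rintro ⟨u, h, h1, h2, h3, h4⟩
    exact ⟨u, h, h1, h2, h3, h4⟩
  · rintro ⟨u, h, h1, h2, h3, h4⟩
    exact ⟨u, h, h1, h2, h3, h4⟩

lemma IsCoreQuad.mem_H1pe {η : ℝ → ℝ} {U : Quad L η} {u : ℝ × ℝ → ℝ} (h : IsCoreQuad L η U u) :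
    U ∈ H1pe L η := by
  rw [H1pe_eq]
  exact Submodule.le_topologicalClosure _ (Submodule.subset_span ⟨u, h⟩)

/-- Together with `IsCoreQuad.smul` this shows that the quadruples of C¹ functions already form a
subspace, so in `H1pe` only the closure matters. -/
lemma IsCoreQuad.add {U V : Quad L flat} {u v : ℝ × ℝ → ℝ} (hU : IsCoreQuad L flat U u)
    (hV : IsCoreQuad L flat V v) : IsCoreQuad L flat (U + V) (fun z => u z + v z) := by
  have hpd : ∀ z ∈ closedStrip flat, _ := fun z hz => pd_add (uniqueDiffOn_flat z hz)
    (hU.core.smooth.differentiableOn one_ne_zero z hz)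
    (hV.core.smooth.differentiableOn one_ne_zero z hz)
  refine ⟨⟨hU.core.smooth.add hV.core.smooth, fun z hz => ?_, fun z hz => ?_, fun x => ?_⟩,
    ?_, ?_, ?_, ?_⟩
  · simp only [hU.core.periodic z hz, hV.core.periodic z hz]
  · simp only [hU.core.even z hz, hV.core.even z hz]
  · simp only [hU.core.bottom x, hV.core.bottom x, add_zero]
  · filter_upwards [Lp.coeFn_add U.1 V.1, hU.fn_eq, hV.fn_eq] with z h1 h2 h3
    rw [fn] at h2 h3 ⊢
    rw [Prod.fst_add, h1, Pi.add_apply, h2, h3]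
  · filter_upwards [Lp.coeFn_add U.2.1 V.2.1, hU.d1_eq, hV.d1_eq,
      ae_restrict_mem (measurableSet_cell_flat L)] with z h1 h2 h3 hz
    rw [d1] at h2 h3 ⊢
    rw [Prod.snd_add, Prod.fst_add, h1, Pi.add_apply, h2, h3,
      (hpd z (cell_subset_closedStrip _ _ hz)).1]
  · filter_upwards [Lp.coeFn_add U.2.2.1 V.2.2.1, hU.d2_eq, hV.d2_eq,
      ae_restrict_mem (measurableSet_cell_flat L)] with z h1 h2 h3 hz
    rw [d2] at h2 h3 ⊢
    rw [Prod.snd_add, Prod.snd_add, Prod.fst_add, h1, Pi.add_apply, h2, h3,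
      (hpd z (cell_subset_closedStrip _ _ hz)).2]
  · filter_upwards [Lp.coeFn_add U.2.2.2 V.2.2.2, hU.tr_eq, hV.tr_eq] with z h1 h2 h3
    rw [tr] at h2 h3 ⊢
    rw [Prod.snd_add, Prod.snd_add, Prod.snd_add, h1, Pi.add_apply, h2, h3]

lemma IsCoreQuad.smul {U : Quad L flat} {u : ℝ × ℝ → ℝ} (c : ℝ) (hU : IsCoreQuad L flat U u) :
    IsCoreQuad L flat (c • U) (fun z => c * u z) := by
  have hpd : ∀ z ∈ closedStrip flat, _ := fun z hz => pd_const_mul (uniqueDiffOn_flat z hz) c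
    (hU.core.smooth.differentiableOn one_ne_zero z hz)
  refine ⟨⟨contDiffOn_const.mul hU.core.smooth, fun z hz => ?_, fun z hz => ?_, fun x => ?_⟩,
    ?_, ?_, ?_, ?_⟩
  · simp only [hU.core.periodic z hz]
  · simp only [hU.core.even z hz]
  · simp only [hU.core.bottom x, mul_zero]
  · filter_upwards [Lp.coeFn_smul c U.1, hU.fn_eq] with z h1 h2
    rw [fn] at h2 ⊢
    rw [Prod.smul_fst, h1, Pi.smul_apply, h2, smul_eq_mul]
  · filter_upwards [Lp.coeFn_smul c U.2.1, hU.d1_eq,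
      ae_restrict_mem (measurableSet_cell_flat L)] with z h1 h2 hz
    rw [d1] at h2 ⊢
    rw [Prod.smul_snd, Prod.smul_fst, h1, Pi.smul_apply, h2, smul_eq_mul,
      (hpd z (cell_subset_closedStrip _ _ hz)).1]
  · filter_upwards [Lp.coeFn_smul c U.2.2.1, hU.d2_eq,
      ae_restrict_mem (measurableSet_cell_flat L)] with z h1 h2 hz
    rw [d2] at h2 ⊢
    rw [Prod.smul_snd, Prod.smul_snd, Prod.smul_fst, h1, Pi.smul_apply, h2, smul_eq_mul,
      (hpd z (cell_subset_closedStrip _ _ hz)).2]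
  · filter_upwards [Lp.coeFn_smul c U.2.2.2, hU.tr_eq] with z h1 h2
    rw [tr] at h2 ⊢
    rw [Prod.smul_snd, Prod.smul_snd, Prod.smul_snd, h1, Pi.smul_apply, h2, smul_eq_mul]

/-- A closed condition satisfied by the `C¹` functions holds on the Sobolev space. -/
lemma H1pe_flat_induction {P : Quad L flat → Prop} (hP : IsClosed {U | P U})
    (hcore : ∀ U u, IsCoreQuad L flat U u → P U) : ∀ U ∈ H1pe L flat, P U := by
  have hne : ∃ u, IsCoreQuad L flat (0 : Quad L flat) u := by
    refine ⟨fun _ => 0, ⟨contDiffOn_const, by simp, by simp, by simp⟩, ?_, ?_, ?_, ?_⟩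
    · exact Lp.coeFn_zero _ _ _
    · have : pd1 flat (fun _ => (0 : ℝ)) = fun _ => 0 := by ext z; simp [pd1]
      rw [this]; exact Lp.coeFn_zero _ _ _
    · have : pd2 flat (fun _ => (0 : ℝ)) = fun _ => 0 := by ext z; simp [pd2]
      rw [this]; exact Lp.coeFn_zero _ _ _
    · exact Lp.coeFn_zero _ _ _
  let S : Submodule ℝ (Quad L flat) :=
    { carrier := {U | ∃ u, IsCoreQuad L flat U u}
      add_mem' := fun ⟨_, hu⟩ ⟨_, hv⟩ => ⟨_, hu.add hv⟩
      zero_mem' := hne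
      smul_mem' := fun c _ ⟨_, hu⟩ => ⟨_, hu.smul c⟩ }
  intro U hU
  rw [H1pe_eq, show {U : Quad L flat | ∃ u, IsCoreQuad L flat U u} = (S : Set (Quad L flat))
    from rfl, Submodule.span_eq] at hU
  have hsub : (S : Set (Quad L flat)) ⊆ {U | P U} := fun U ⟨u, hu⟩ => hcore U u hu
  exact hP.closure_subset_iff.2 hsub hU

lemma norm_sq_eq_integral {α : Type*} [MeasurableSpace α] {μ : Measure α} (f : Lp ℝ 2 μ)
    {g : α → ℝ} (h : f =ᵐ[μ] g) : ‖f‖ ^ 2 = ∫ x, g x ^ 2 ∂μ := by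
  rw [← real_inner_self_eq_norm_sq, L2.inner_def]
  refine integral_congr_ae ?_
  filter_upwards [h] with x hx
  rw [hx]; simp [sq]

lemma continuousOn_box {g : ℝ × ℝ → ℝ} (hg : ContinuousOn g (closedStrip flat)) (a b : ℝ) :
    ContinuousOn g (Icc a b ×ˢ Icc (0 : ℝ) 1) := hg.mono (box_subset_flat le_rfl le_rfl)

lemma integral_cell {g : ℝ × ℝ → ℝ} (hL : 0 < L) (hg : ContinuousOn g (closedStrip flat)) :
    ∫ z in cell L flat, g z = ∫ q in (-L / 2)..(L / 2), ∫ p in (0 : ℝ)..1, g (q, p) := by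
  rw [cell_flat]
  exact integral_box (by linarith) zero_le_one (continuousOn_box hg _ _)

/-- The pointwise bound `sq_le_integral` at p = 1, integrated in q. The free δ lets the derivative
enter with an arbitrarily small factor. -/
lemma trace_le (hL : 0 < L) {δ : ℝ} (hδ : 0 < δ) : ∀ U ∈ H1pe L flat,
    ‖U.2.2.2‖ ^ 2 ≤ δ * ‖U.2.2.1‖ ^ 2 + δ⁻¹ * ‖U.1‖ ^ 2 := by
  refine H1pe_flat_induction (isClosed_le (by fun_prop) (by fun_prop)) fun U u hU => ?_
  have hs := hU.core.smooth
  have hc0 := hs.continuousOn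
  have hc2 := continuousOn_pd2 uniqueDiffOn_flat hs
  have hLL : -L / 2 ≤ L / 2 := by linarith
  have i1 := integral_cell hL (hc0.pow 2)
  have i2 := integral_cell hL (hc2.pow 2)
  simp only [Pi.pow_apply] at i1 i2
  rw [norm_sq_eq_integral _ hU.tr_eq, norm_sq_eq_integral _ hU.d2_eq, norm_sq_eq_integral _ hU.fn_eq,
    i1, i2, integral_Ioo_eq hLL]
  have hA := continuousOn_integral_right hLL zero_le_one (continuousOn_box (hc2.pow 2) (-L / 2) (L / 2))
  have hB := continuousOn_integral_right hLL zero_le_one (continuousOn_box (hc0.pow 2) (-L / 2) (L / 2))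
  have hA' := hA.intervalIntegrable_of_Icc (μ := volume) hLL
  have hB' := hB.intervalIntegrable_of_Icc (μ := volume) hLL
  simp only [Pi.pow_apply] at hA' hB'
  rw [← intervalIntegral.integral_const_mul, ← intervalIntegral.integral_const_mul,
    ← intervalIntegral.integral_add (hA'.const_mul _) (hB'.const_mul _)]
  refine intervalIntegral.integral_mono_on hLL ?_ ((hA'.const_mul _).add (hB'.const_mul _)) ?_
  · have := (continuousOn_box (hc0.pow 2) (-L / 2) (L / 2)).slice_left (p := 1) ⟨zero_le_one, le_rfl⟩
    exact this.intervalIntegrable_of_Icc hLL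
  · intro q hq
    refine (sq_le_integral hs hU.core.bottom hδ q (p := 1) ⟨zero_le_one, le_rfl⟩).trans (le_of_eq ?_)
    have e1 := ((continuousOn_box (hc2.pow 2) (-L / 2) (L / 2)).slice_right hq).intervalIntegrable_of_Icc
      (μ := volume) zero_le_one
    have e2 := ((continuousOn_box (hc0.pow 2) (-L / 2) (L / 2)).slice_right hq).intervalIntegrable_of_Icc
      (μ := volume) zero_le_one
    simp only [Pi.pow_apply] at e1 e2
    rw [intervalIntegral.integral_add (e1.const_mul _) (e2.const_mul _),
      intervalIntegral.integral_const_mul, intervalIntegral.integral_const_mul]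

/-- With δ = 2 the bound `sq_le_integral`, integrated over p and q, reads ∫u² ≤ 2∫u_p² + ½∫u²;
absorbing the last term gives the factor 4. -/
lemma poincare (hL : 0 < L) : ∀ U ∈ H1pe L flat, ‖U.1‖ ^ 2 ≤ 4 * ‖U.2.2.1‖ ^ 2 := by
  refine H1pe_flat_induction (isClosed_le (by fun_prop) (by fun_prop)) fun U u hU => ?_
  have hs := hU.core.smooth
  have hc0 := hs.continuousOn
  have hc2 := continuousOn_pd2 uniqueDiffOn_flat hs
  have hLL : -L / 2 ≤ L / 2 := by linarith
  have i1 := integral_cell hL (hc0.pow 2)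
  have i2 := integral_cell hL (hc2.pow 2)
  simp only [Pi.pow_apply] at i1 i2
  rw [norm_sq_eq_integral _ hU.d2_eq, norm_sq_eq_integral _ hU.fn_eq, i1, i2]
  have hA := continuousOn_integral_right hLL zero_le_one (continuousOn_box (hc2.pow 2) (-L / 2) (L / 2))
  have hB := continuousOn_integral_right hLL zero_le_one (continuousOn_box (hc0.pow 2) (-L / 2) (L / 2))
  have hA' := hA.intervalIntegrable_of_Icc (μ := volume) hLL
  have hB' := hB.intervalIntegrable_of_Icc (μ := volume) hLL
  simp only [Pi.pow_apply] at hA' hB'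
  have key : ∫ q in (-L / 2)..(L / 2), ∫ p in (0 : ℝ)..1, u (q, p) ^ 2
      ≤ ∫ q in (-L / 2)..(L / 2), (2 * (∫ p in (0 : ℝ)..1, pd2 flat u (q, p) ^ 2)
        + 2⁻¹ * ∫ p in (0 : ℝ)..1, u (q, p) ^ 2) := by
    refine intervalIntegral.integral_mono_on hLL hB' ((hA'.const_mul _).add (hB'.const_mul _)) ?_
    intro q hq
    have e1 := ((continuousOn_box (hc2.pow 2) (-L / 2) (L / 2)).slice_right hq).intervalIntegrable_of_Icc
      (μ := volume) zero_le_one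
    have e2 := ((continuousOn_box (hc0.pow 2) (-L / 2) (L / 2)).slice_right hq).intervalIntegrable_of_Icc
      (μ := volume) zero_le_one
    simp only [Pi.pow_apply] at e1 e2
    rw [← intervalIntegral.integral_const_mul, ← intervalIntegral.integral_const_mul,
      ← intervalIntegral.integral_add (e1.const_mul _) (e2.const_mul _)]
    have := intervalIntegral.integral_mono_on zero_le_one e2
      (intervalIntegrable_const (c := ∫ s in (0 : ℝ)..1,
        (2 * pd2 flat u (q, s) ^ 2 + 2⁻¹ * u (q, s) ^ 2)))
      (fun p hp => sq_le_integral hs hU.core.bottom two_pos q hp)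
    simpa using this
  rw [intervalIntegral.integral_add (hA'.const_mul _) (hB'.const_mul _),
    intervalIntegral.integral_const_mul, intervalIntegral.integral_const_mul] at key
  linarith

/-- The integral over a measurable set as a functional. -/
lemma exists_setIntegral_functional {α : Type*} [MeasurableSpace α] {μ : Measure α}
    [IsFiniteMeasure μ] {s : Set α} (hs : MeasurableSet s) :
    ∃ l : Lp ℝ 2 μ →L[ℝ] ℝ, ∀ f, l f = ∫ x in s, f x ∂μ :=
  ⟨innerSL ℝ (indicatorConstLp 2 hs (measure_ne_top μ s) (1 : ℝ)), fun f => by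
    rw [innerSL_apply_apply, L2.inner_indicatorConstLp_one]⟩

/-- Compactness of the embedding `H¹ → L²`, by the Poincaré inequality on a grid. -/
lemma exists_functionals_fn (hL : 0 < L) {N : ℕ} (hN : 0 < N) :
    ∃ l : Fin N × Fin N → Quad L flat →L[ℝ] ℝ, ∀ U ∈ H1pe L flat,
      ‖U.1‖ ^ 2 ≤ ∑ i, l i U ^ 2 + (L / N) ^ 2 * ‖U.2.1‖ ^ 2 + (1 / N) ^ 2 * ‖U.2.2.1‖ ^ 2 := by
  have hN' : (0 : ℝ) < N := by exact_mod_cast hN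
  set a : ℕ → ℝ := fun i => -L / 2 + i * (L / N) with ha
  set c : ℕ → ℝ := fun j => j * (1 / N) with hc
  have ha1 : ∀ i, a (i + 1) - a i = L / N := fun i => by simp only [ha]; push_cast; ring
  have hc1 : ∀ i, c (i + 1) - c i = 1 / N := fun i => by simp only [hc]; push_cast; ring
  have hLN : 0 < L / N := by positivity
  have h1N : (0 : ℝ) < 1 / N := by positivity
  have ha0 : a 0 = -L / 2 := by simp [ha]
  have haN : a N = L / 2 := by simp only [ha]; field_simp; ring
  have hc0 : c 0 = 0 := by simp [hc]
  have hcN : c N = 1 := by simp only [hc]; field_simp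
  have hamono : Monotone a := monotone_nat_of_le_succ fun i => by linarith [ha1 i]
  have hcmono : Monotone c := monotone_nat_of_le_succ fun i => by linarith [hc1 i]
  set box : Fin N × Fin N → Set (ℝ × ℝ) := fun i =>
    Ioo (a i.1) (a (i.1 + 1)) ×ˢ Ioo (c i.2) (c (i.2 + 1)) with hbox
  have hboxm : ∀ i, MeasurableSet (box i) := fun i => measurableSet_Ioo.prod measurableSet_Ioo
  have hboxsub : ∀ i, box i ⊆ cell L flat := by
    intro i
    rw [cell_flat]
    refine prod_mono (Ioo_subset_Ioo ?_ ?_) (Ioo_subset_Ioo ?_ ?_)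
    · rw [← ha0]; exact hamono (Nat.zero_le _)
    · rw [← haN]; exact hamono i.1.2
    · rw [← hc0]; exact hcmono (Nat.zero_le _)
    · rw [← hcN]; exact hcmono i.2.2
  have hfin : IsFiniteMeasure ((volume : Measure (ℝ × ℝ)).restrict (cell L flat)) := by
    refine ⟨?_⟩
    rw [Measure.restrict_apply_univ, cell_flat, Measure.volume_eq_prod, Measure.prod_prod]
    simp
  choose l hl using fun i => exists_setIntegral_functional
    (μ := (volume : Measure (ℝ × ℝ)).restrict (cell L flat)) (hboxm i)
  -- The square root of the area of a grid box: the integral over the box divided by κ has as its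
  -- square the mean term of `poincare_box`.
  set κ : ℝ := √(L / N * (1 / N)) with hκ
  have hκ2 : κ ^ 2 = L / N * (1 / N) := Real.sq_sqrt (by positivity)
  have hκ0 : 0 < κ := by positivity
  refine ⟨fun i => κ⁻¹ • (l i).comp (ContinuousLinearMap.fst ℝ _ _), ?_⟩
  refine H1pe_flat_induction (isClosed_le (by fun_prop) (by fun_prop)) fun U u hU => ?_
  have hs := hU.core.smooth
  have hcu := hs.continuousOn
  have hcd1 := continuousOn_pd1 uniqueDiffOn_flat hs
  have hcd2 := continuousOn_pd2 uniqueDiffOn_flat hs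
  have hLL : -L / 2 ≤ L / 2 := by linarith
  -- splitting integrals over the grid
  have hsplit : ∀ g : ℝ × ℝ → ℝ, ContinuousOn g (closedStrip flat) →
      ∫ q in (-L / 2)..(L / 2), ∫ p in (0 : ℝ)..1, g (q, p) = ∑ i : Fin N × Fin N,
        ∫ q in (a i.1)..(a (i.1 + 1)), ∫ p in (c i.2)..(c (i.2 + 1)), g (q, p) := by
    intro g hg
    have hgsub : ∀ (x y : ℝ) (j : ℕ), j < N →
        ContinuousOn g (Icc x y ×ˢ Icc (c j) (c (j + 1))) := by
      intro x y j hj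
      refine hg.mono (box_subset_flat ?_ ?_)
      · rw [← hc0]; exact hcmono (Nat.zero_le _)
      · rw [← hcN]; exact hcmono hj
    rw [Fintype.sum_prod_type]
    have hout : ∫ q in (-L / 2)..(L / 2), ∫ p in (0 : ℝ)..1, g (q, p)
        = ∑ i ∈ Finset.range N, ∫ q in (a i)..(a (i + 1)), ∫ p in (0 : ℝ)..1, g (q, p) := by
      rw [intervalIntegral.sum_integral_adjacent_intervals, ha0, haN]
      intro i _
      have hle : a i ≤ a (i + 1) := hamono (Nat.le_succ i)
      exact (continuousOn_integral_right hle zero_le_one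
        (continuousOn_box hg _ _)).intervalIntegrable_of_Icc hle
    rw [hout, Finset.sum_range]
    refine Finset.sum_congr rfl fun i _ => ?_
    have hle : a i ≤ a (i + 1) := hamono (Nat.le_succ _)
    have hinner : ∀ q ∈ uIcc (a i) (a (i + 1)), ∫ p in (0 : ℝ)..1, g (q, p)
        = ∑ j ∈ Finset.range N, ∫ p in (c j)..(c (j + 1)), g (q, p) := by
      intro q hq
      rw [intervalIntegral.sum_integral_adjacent_intervals, hc0, hcN]
      intro j hj
      rw [uIcc_of_le hle] at hq
      exact ((hgsub _ _ j hj).slice_right hq).intervalIntegrable_of_Icc (hcmono (Nat.le_succ j))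
    rw [intervalIntegral.integral_congr hinner, intervalIntegral.integral_finsetSum, Finset.sum_range]
    intro j hj
    exact (continuousOn_integral_right hle (hcmono (Nat.le_succ j))
      (hgsub _ _ j (Finset.mem_range.1 hj))).intervalIntegrable_of_Icc hle
  have i0 := integral_cell hL (hcu.pow 2)
  have i1 := integral_cell hL (hcd1.pow 2)
  have i2 := integral_cell hL (hcd2.pow 2)
  have s0 := hsplit _ (hcu.pow 2)
  have s1 := hsplit _ (hcd1.pow 2)
  have s2 := hsplit _ (hcd2.pow 2)
  simp only [Pi.pow_apply] at i0 i1 i2 s0 s1 s2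
  rw [norm_sq_eq_integral _ hU.d1_eq, norm_sq_eq_integral _ hU.d2_eq,
    norm_sq_eq_integral _ hU.fn_eq, i0, i1, i2, s0, s1, s2, Finset.mul_sum, Finset.mul_sum,
    ← Finset.sum_add_distrib, ← Finset.sum_add_distrib]
  refine Finset.sum_le_sum fun i _ => ?_
  have hli : l i U.1 = ∫ q in (a i.1)..(a (i.1 + 1)), ∫ p in (c i.2)..(c (i.2 + 1)), u (q, p) := by
    rw [hl, Measure.restrict_restrict (hboxm i), inter_eq_left.2 (hboxsub i)]
    have hae : (U.1 : ℝ × ℝ → ℝ) =ᵐ[volume.restrict (box i)] u :=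
      ae_restrict_of_ae_restrict_of_subset (hboxsub i) hU.fn_eq
    rw [integral_congr_ae hae]
    refine integral_box (hamono (Nat.le_succ _)) (hcmono (Nat.le_succ _)) (hcu.mono ?_)
    refine box_subset_flat ?_ ?_
    · rw [← hc0]; exact hcmono (Nat.zero_le _)
    · rw [← hcN]; exact hcmono i.2.2
  have hp := poincare_box hs (a := a i.1) (b := a (i.1 + 1)) (c := c i.2) (d := c (i.2 + 1))
    (by linarith [ha1 i.1]) (by linarith [hc1 i.2])
    (by rw [← hc0]; exact hcmono (Nat.zero_le _)) (by rw [← hcN]; exact hcmono i.2.2)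
  rw [ha1, hc1, ← hli, ← hκ2] at hp
  refine hp.trans (le_of_eq ?_)
  simp only [_root_.smul_apply, ContinuousLinearMap.comp_apply, ContinuousLinearMap.coe_fst',
    smul_eq_mul]
  rw [mul_pow, inv_pow]
  ring

end sobolev

/-! ### Compactness and coercivity of the forms on the flat strip -/

section pairs

variable {L : ℝ}

lemma norm_sq_le_sum {η : ℝ → ℝ} (U : Quad L η) :
    ‖U‖ ^ 2 ≤ ‖U.1‖ ^ 2 + ‖U.2.1‖ ^ 2 + ‖U.2.2.1‖ ^ 2 + ‖U.2.2.2‖ ^ 2 := by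
  rw [Prod.norm_def, Prod.norm_def, Prod.norm_def]
  have h1 := sq_nonneg ‖U.1‖
  have h2 := sq_nonneg ‖U.2.1‖
  have h3 := sq_nonneg ‖U.2.2.1‖
  have h4 := sq_nonneg ‖U.2.2.2‖
  rcases max_choice ‖U.1‖ (max ‖U.2.1‖ (max ‖U.2.2.1‖ ‖U.2.2.2‖)) with h | h <;> rw [h]
  · linarith
  rcases max_choice ‖U.2.1‖ (max ‖U.2.2.1‖ ‖U.2.2.2‖) with h | h <;> rw [h]
  · linarith
  rcases max_choice ‖U.2.2.1‖ ‖U.2.2.2‖ with h | h <;> rw [h] <;> linarith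

lemma exists_functionals_mass (hL : 0 < L) {ε : ℝ} (hε : 0 < ε) :
    ∃ (m : ℕ) (l : Fin m → Quad L flat →L[ℝ] ℝ), ∀ U ∈ H1pe L flat,
      ‖U.1‖ ^ 2 ≤ ε * ‖U‖ ^ 2 + ∑ i, l i U ^ 2 := by
  -- The gradient terms have total factor (L² + 1) / N²; the + 1 ensures N > 1, so that N ≤ N².
  obtain ⟨N, hN⟩ := exists_nat_gt ((L ^ 2 + 1) / ε + 1)
  have h0 : 0 ≤ (L ^ 2 + 1) / ε := by positivity
  have hN1 : (1 : ℝ) < N := by linarith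
  have hN0 : 0 < N := by
    have : (0 : ℝ) < N := by linarith
    exact_mod_cast this
  obtain ⟨l, hl⟩ := exists_functionals_fn hL hN0
  refine ⟨N * N, fun i => l (finProdFinEquiv.symm i), fun U hU => ?_⟩
  rw [Equiv.sum_comp finProdFinEquiv.symm fun i => l i U ^ 2]
  have h1 : ‖U.2.1‖ ^ 2 ≤ ‖U‖ ^ 2 := by
    gcongr; exact (norm_fst_le U.2).trans (norm_snd_le U)
  have h2 : ‖U.2.2.1‖ ^ 2 ≤ ‖U‖ ^ 2 := by
    gcongr; exact (norm_fst_le U.2.2).trans ((norm_snd_le U.2).trans (norm_snd_le U))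
  have h3 : (L / N) ^ 2 + (1 / N : ℝ) ^ 2 ≤ ε := by
    have : (L / N) ^ 2 + (1 / N : ℝ) ^ 2 = (L ^ 2 + 1) / N ^ 2 := by
      rw [div_pow, div_pow, one_pow, add_div]
    rw [this, div_le_iff₀ (by positivity)]
    have h4 : (L ^ 2 + 1) / ε ≤ N := by linarith
    rw [div_le_iff₀ hε] at h4
    nlinarith
  have h4 := hl U hU
  have h5 : (L / N) ^ 2 * ‖U.2.1‖ ^ 2 ≤ (L / N) ^ 2 * ‖U‖ ^ 2 := by gcongr
  have h6 : (1 / N : ℝ) ^ 2 * ‖U.2.2.1‖ ^ 2 ≤ (1 / N : ℝ) ^ 2 * ‖U‖ ^ 2 := by gcongr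
  have h7 : ((L / N) ^ 2 + (1 / N : ℝ) ^ 2) * ‖U‖ ^ 2 ≤ ε * ‖U‖ ^ 2 := by gcongr
  linarith

/-- The trace inequality with δ = ε/2 leaves (ε/2)⁻¹‖u‖², which the L² estimate at level (ε/2)²
makes small: compactness of the trace follows from that of the embedding in L². -/
lemma exists_functionals_top (hL : 0 < L) {ε : ℝ} (hε : 0 < ε) :
    ∃ (m : ℕ) (l : Fin m → Quad L flat →L[ℝ] ℝ), ∀ U ∈ H1pe L flat,
      ‖U.2.2.2‖ ^ 2 ≤ ε * ‖U‖ ^ 2 + ∑ i, l i U ^ 2 := by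
  obtain ⟨m, l, hl⟩ := exists_functionals_mass hL (ε := ε / 2 * (ε / 2)) (by positivity)
  refine ⟨m, fun i => √((ε / 2)⁻¹) • l i, fun U hU => ?_⟩
  have h1 := trace_le hL (half_pos hε) U hU
  have h2 : ‖U.2.2.1‖ ^ 2 ≤ ‖U‖ ^ 2 := by
    gcongr; exact (norm_fst_le U.2.2).trans ((norm_snd_le U.2).trans (norm_snd_le U))
  have h3 := mul_le_mul_of_nonneg_left (hl U hU) (inv_nonneg.2 (half_pos hε).le)
  have h4 : ε / 2 * ‖U.2.2.1‖ ^ 2 ≤ ε / 2 * ‖U‖ ^ 2 := by gcongr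
  have h5 : ∑ i, (√((ε / 2)⁻¹) • l i) U ^ 2 = (ε / 2)⁻¹ * ∑ i, l i U ^ 2 := by
    rw [Finset.mul_sum]
    refine Finset.sum_congr rfl fun i _ => ?_
    rw [_root_.smul_apply, smul_eq_mul, mul_pow, Real.sq_sqrt (by positivity)]
  have h6 : (ε / 2)⁻¹ * (ε / 2 * (ε / 2) * ‖U‖ ^ 2 + ∑ i, l i U ^ 2)
      = ε / 2 * ‖U‖ ^ 2 + (ε / 2)⁻¹ * ∑ i, l i U ^ 2 := by field_simp
  rw [h5]
  linarith

/-- The restriction of a form on quadruples to the Sobolev space. -/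
abbrev onH1 (a : Quad L flat →L[ℝ] Quad L flat →L[ℝ] ℝ) :
    H1pe L flat →L[ℝ] H1pe L flat →L[ℝ] ℝ :=
  a.bilinearComp (H1pe L flat).subtypeL (H1pe L flat).subtypeL

instance : CompleteSpace (H1pe L flat) :=
  (Submodule.isClosed_topologicalClosure _).completeSpace_coe

variable {a b : Quad L flat →L[ℝ] Quad L flat →L[ℝ] ℝ}

lemma isCompactForm_mass (hL : 0 < L) (hmass : ∀ U, b U U = ‖U.1‖ ^ 2) :
    IsCompactForm (onH1 b) := by
  intro ε hε
  obtain ⟨m, l, h⟩ := exists_functionals_mass hL hε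
  refine ⟨m, fun i => (l i).comp (H1pe L flat).subtypeL, fun U => ?_⟩
  have h1 := h U U.2
  rw [← hmass] at h1
  exact h1

lemma isCompactForm_top (hL : 0 < L) {w₁ : ℝ} (hw₁ : 0 < w₁)
    (hup : ∀ U, b U U ≤ w₁ * ‖U.2.2.2‖ ^ 2) : IsCompactForm (onH1 b) := by
  intro ε hε
  obtain ⟨m, l, h⟩ := exists_functionals_top hL (ε := ε / w₁) (by positivity)
  refine ⟨m, fun i => √w₁ • (l i).comp (H1pe L flat).subtypeL, fun U => ?_⟩
  refine le_trans (hup (U : Quad L flat)) ?_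
  have h1 := mul_le_mul_of_nonneg_left (h U U.2) hw₁.le
  have e : w₁ * (ε / w₁ * ‖(U : Quad L flat)‖ ^ 2 + ∑ i, l i (U : Quad L flat) ^ 2)
      = ε * ‖(U : Quad L flat)‖ ^ 2 + ∑ i, w₁ * l i (U : Quad L flat) ^ 2 := by
    rw [mul_add, Finset.mul_sum]; field_simp
  rw [e] at h1
  refine h1.trans (le_of_eq ?_)
  congr 1
  refine Finset.sum_congr rfl fun i _ => ?_
  simp only [_root_.smul_apply, ContinuousLinearMap.comp_apply, Submodule.subtypeL_apply,
    smul_eq_mul]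
  rw [mul_pow, Real.sq_sqrt hw₁.le]

lemma isSpectralPair_mass (hL : 0 < L) (ha : ∀ U V, a U V = a V U) (hb : ∀ U V, b U V = b V U)
    {c : ℝ} (hc : 0 < c)
    (hcoer : ∀ U, c * (‖U.2.1‖ ^ 2 + ‖U.2.2.1‖ ^ 2) - ‖U.2.2.2‖ ^ 2 ≤ a U U)
    (hmass : ∀ U, b U U = ‖U.1‖ ^ 2) : IsSpectralPair (onH1 a) (onH1 b) where
  symm_left U V := ha U V
  symm_right U V := hb U V
  nonneg U := by
    change 0 ≤ b U U
    rw [hmass]; positivity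
  coercive := by
    -- The trace inequality with δ = c/2 costs half of the p-gradient and (c/2)⁻¹‖u‖²; the + 1
    -- leaves a full ‖u‖² over. With δ = 1 it bounds the trace component of the norm.
    refine ⟨min (c / 2) 1 / 2, by positivity, (c / 2)⁻¹ + 1, fun U => ?_⟩
    change min (c / 2) 1 / 2 * ‖(U : Quad L flat)‖ ^ 2 ≤ a U U + ((c / 2)⁻¹ + 1) * b U U
    rw [hmass]
    have h1 := norm_sq_le_sum (U : Quad L flat)
    have h2 := trace_le hL (half_pos hc) U U.2
    have h3 := trace_le hL one_pos U U.2
    have h4 := hcoer U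
    have hm1 : min (c / 2) 1 ≤ c / 2 := min_le_left _ _
    have hm2 : min (c / 2) 1 ≤ 1 := min_le_right _ _
    have hm0 : 0 < min (c / 2) 1 := by positivity
    set A := ‖(U : Quad L flat).1‖ ^ 2
    set B := ‖(U : Quad L flat).2.1‖ ^ 2
    set C := ‖(U : Quad L flat).2.2.1‖ ^ 2
    have hA : 0 ≤ A := sq_nonneg _
    have hB : 0 ≤ B := sq_nonneg _
    have hC : 0 ≤ C := sq_nonneg _
    rw [inv_one] at h3
    have h5 : ‖(U : Quad L flat)‖ ^ 2 ≤ 2 * (A + B + C) := by linarith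
    have h6 : min (c / 2) 1 / 2 * ‖(U : Quad L flat)‖ ^ 2
        ≤ min (c / 2) 1 / 2 * (2 * (A + B + C)) := by gcongr
    have h7 : min (c / 2) 1 * A ≤ 1 * A := by gcongr
    have h8 : min (c / 2) 1 * B ≤ c / 2 * B := by gcongr
    have h9 : min (c / 2) 1 * C ≤ c / 2 * C := by gcongr
    have h10 : 0 ≤ c / 2 * B := by positivity
    linarith
  compact := isCompactForm_mass hL hmass

lemma isSpectralPair_top (hL : 0 < L) (ha : ∀ U V, a U V = a V U) (hb : ∀ U V, b U V = b V U)
    {c : ℝ} (hc : 0 < c)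
    (hcoer : ∀ U, c * (‖U.2.1‖ ^ 2 + ‖U.2.2.1‖ ^ 2) - ‖U.2.2.2‖ ^ 2 ≤ a U U)
    {w₀ w₁ : ℝ} (hw₀ : 0 < w₀) (hw₁ : 0 < w₁) (hlow : ∀ U, w₀ * ‖U.2.2.2‖ ^ 2 ≤ b U U)
    (hup : ∀ U, b U U ≤ w₁ * ‖U.2.2.2‖ ^ 2) : IsSpectralPair (onH1 a) (onH1 b) where
  symm_left U V := ha U V
  symm_right U V := hb U V
  nonneg U := by
    refine le_trans ?_ (hlow U)
    positivity
  coercive := by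
    -- Now b controls only the trace, and `poincare` supplies ‖u‖² ≤ 4‖u_p‖², whence the 5. The
    -- multiple 2 / w₀ of b yields the trace norm squared twice: once against the negative term in
    -- a, once for the norm of U.
    refine ⟨min (c / 5) 1, by positivity, 2 / w₀, fun U => ?_⟩
    change min (c / 5) 1 * ‖(U : Quad L flat)‖ ^ 2 ≤ a U U + 2 / w₀ * b U U
    have h1 := norm_sq_le_sum (U : Quad L flat)
    have h2 := poincare hL U U.2
    have h4 := hcoer U
    have h5 := mul_le_mul_of_nonneg_left (hlow U) (by positivity : 0 ≤ 2 / w₀)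
    have hm1 : min (c / 5) 1 ≤ c / 5 := min_le_left _ _
    have hm2 : min (c / 5) 1 ≤ 1 := min_le_right _ _
    have hm0 : 0 < min (c / 5) 1 := by positivity
    set B := ‖(U : Quad L flat).2.1‖ ^ 2
    set C := ‖(U : Quad L flat).2.2.1‖ ^ 2
    set D := ‖(U : Quad L flat).2.2.2‖ ^ 2
    have hB : 0 ≤ B := sq_nonneg _
    have hC : 0 ≤ C := sq_nonneg _
    have hD : 0 ≤ D := sq_nonneg _
    have e : 2 / w₀ * (w₀ * D) = 2 * D := by field_simp
    rw [e] at h5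
    have h6 : min (c / 5) 1 * ‖(U : Quad L flat)‖ ^ 2 ≤ min (c / 5) 1 * (B + 5 * C + D) := by
      gcongr; linarith
    have h7 : min (c / 5) 1 * D ≤ 1 * D := by gcongr
    have h8 : min (c / 5) 1 * B ≤ c / 5 * B := by gcongr
    have h9 : min (c / 5) 1 * C ≤ c / 5 * C := by gcongr
    have h10 : 0 ≤ c * B := by positivity
    linarith
  compact := isCompactForm_top hL hw₁ hup

end pairs

/-! ### The partial hodograph transformation -/

section hodograph

open Filter Topology

variable {ω : ℝ → ℝ} {L lam R : ℝ} {h : ℝ × ℝ → ℝ}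

/-- `(q,p) ↦ (q, h(q,p))`. -/
def toPhys (h : ℝ × ℝ → ℝ) (z : ℝ × ℝ) : ℝ × ℝ := (z.1, h z)

/-- `(x,y) ↦ (x, ψ(x,y))`. -/
def toFlat (h : ℝ × ℝ → ℝ) (w : ℝ × ℝ) : ℝ × ℝ := (w.1, stream h w)

/-- `k = 1 / h_p`, that is `ψ_y` in the `(q,p)` variables. -/
def kCoef (h : ℝ × ℝ → ℝ) (z : ℝ × ℝ) : ℝ := (pd2 flat h z)⁻¹

/-- `F = - h_q / h_p`, that is `ψ_x` in the `(q,p)` variables. -/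
def fCoef (h : ℝ × ℝ → ℝ) (z : ℝ × ℝ) : ℝ := -(pd1 flat h z * kCoef h z)

/-- Two functions on the closed strip that agree there have the same partial derivatives. -/
lemma pd_congr {η : ℝ → ℝ} {f g : ℝ × ℝ → ℝ} {w : ℝ × ℝ} (hw : w ∈ closedStrip η)
    (hfg : ∀ w ∈ closedStrip η, f w = g w) : pd1 η f w = pd1 η g w ∧ pd2 η f w = pd2 η g w := by
  rw [pd1, pd2, fderivWithin_congr hfg (hfg w hw)]
  exact ⟨rfl, rfl⟩

namespace IsWave

variable (hh : IsWave ω L lam R h)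
include hh

lemma isPer : IsPer L h := hh.periodic

lemma isEvn : IsEvn h := hh.even

lemma differentiableOn : DifferentiableOn ℝ h (closedStrip flat) :=
  hh.smooth.differentiableOn two_ne_zero

lemma contDiffOn_one : ContDiffOn ℝ 1 h (closedStrip flat) := hh.smooth.of_le one_le_two

lemma contDiffOn_hq : ContDiffOn ℝ 1 (pd1 flat h) (closedStrip flat) :=
  contDiffOn_pd1 uniqueDiffOn_flat (by simpa [one_add_one_eq_two] using hh.smooth)

lemma contDiffOn_hp : ContDiffOn ℝ 1 (pd2 flat h) (closedStrip flat) :=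
  contDiffOn_pd2 uniqueDiffOn_flat (by simpa [one_add_one_eq_two] using hh.smooth)

lemma hp_ne {z : ℝ × ℝ} (hz : z ∈ closedStrip flat) : pd2 flat h z ≠ 0 := (hh.deriv_pos z hz).ne'

lemma contDiffOn_kCoef : ContDiffOn ℝ 1 (kCoef h) (closedStrip flat) :=
  hh.contDiffOn_hp.inv fun _ hz => hh.hp_ne hz

lemma contDiffOn_fCoef : ContDiffOn ℝ 1 (fCoef h) (closedStrip flat) :=
  (hh.contDiffOn_hq.mul hh.contDiffOn_kCoef).neg

lemma kCoef_pos {z : ℝ × ℝ} (hz : z ∈ closedStrip flat) : 0 < kCoef h z :=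
  inv_pos.2 (hh.deriv_pos z hz)

lemma isPer_kCoef : IsPer L (kCoef h) := fun q p hp => by
  rw [kCoef, kCoef, hh.isPer.pd2 hh.differentiableOn q p hp]

lemma isPer_fCoef : IsPer L (fCoef h) := fun q p hp => by
  rw [fCoef, fCoef, hh.isPer_kCoef q p hp, hh.isPer.pd1 hh.differentiableOn q p hp]

lemma isEvn_kCoef : IsEvn (kCoef h) := fun q p hp => by
  rw [kCoef, kCoef, hh.isEvn.pd2 hh.differentiableOn q p hp]

lemma strictMonoOn (q : ℝ) : StrictMonoOn (fun p => h (q, p)) (Icc 0 1) := by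
  refine strictMonoOn_of_deriv_pos (convex_Icc 0 1) ?_ fun p hp => ?_
  · exact fun p hp => (hasDerivWithinAt_pd2 (hh.differentiableOn (q, p) hp)).continuousWithinAt
  · rw [interior_Icc] at hp
    have hp' : ((q, p) : ℝ × ℝ) ∈ closedStrip flat := Ioo_subset_Icc_self hp
    rw [(hasDerivAt_pd2 hp (hh.differentiableOn _ hp')).deriv]
    exact hh.deriv_pos _ hp'

lemma continuousOn_slice (q : ℝ) : ContinuousOn (fun p => h (q, p)) (Icc 0 1) :=
  fun p hp => (hasDerivWithinAt_pd2 (hh.differentiableOn (q, p) hp)).continuousWithinAt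

lemma stream_toPhys {z : ℝ × ℝ} (hz : z ∈ closedStrip flat) : stream h (toPhys h z) = z.2 :=
  (hh.strictMonoOn z.1).injOn.leftInvOn_invFunOn hz

lemma toFlat_toPhys {z : ℝ × ℝ} (hz : z ∈ closedStrip flat) : toFlat h (toPhys h z) = z :=
  Prod.ext rfl (hh.stream_toPhys hz)

lemma toPhys_mem {z : ℝ × ℝ} (hz : z ∈ closedStrip flat) :
    toPhys h z ∈ closedStrip (profile h) := by
  have h0 : (0 : ℝ) ∈ Icc (0 : ℝ) 1 := ⟨le_rfl, zero_le_one⟩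
  have h1 : (1 : ℝ) ∈ Icc (0 : ℝ) 1 := ⟨zero_le_one, le_rfl⟩
  constructor
  · have := (hh.strictMonoOn z.1).monotoneOn h0 hz hz.1
    simp only [hh.bottom] at this
    exact this
  · exact (hh.strictMonoOn z.1).monotoneOn hz h1 hz.2

lemma exists_toPhys {w : ℝ × ℝ} (hw : w ∈ closedStrip (profile h)) :
    ∃ z ∈ closedStrip flat, toPhys h z = w := by
  have := intermediate_value_Icc zero_le_one (hh.continuousOn_slice w.1)
  obtain ⟨p, hp, hpw⟩ := this (show w.2 ∈ Icc (h (w.1, 0)) (h (w.1, 1)) by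
    rw [hh.bottom]; exact hw)
  exact ⟨(w.1, p), hp, Prod.ext rfl hpw⟩

lemma toFlat_mem {w : ℝ × ℝ} (hw : w ∈ closedStrip (profile h)) :
    toFlat h w ∈ closedStrip flat := by
  obtain ⟨z, hz, rfl⟩ := hh.exists_toPhys hw
  rwa [hh.toFlat_toPhys hz]

lemma toPhys_toFlat {w : ℝ × ℝ} (hw : w ∈ closedStrip (profile h)) :
    toPhys h (toFlat h w) = w := by
  obtain ⟨z, hz, rfl⟩ := hh.exists_toPhys hw
  rw [hh.toFlat_toPhys hz]

lemma image_toPhys : toPhys h '' closedStrip flat = closedStrip (profile h) := by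
  ext w
  exact ⟨fun ⟨z, hz, e⟩ => e ▸ hh.toPhys_mem hz, fun hw => hh.exists_toPhys hw⟩

lemma injOn_toPhys : InjOn (toPhys h) (closedStrip flat) :=
  fun z hz z' hz' e => by rw [← hh.toFlat_toPhys hz, e, hh.toFlat_toPhys hz']

lemma image_cell : toPhys h '' cell L flat = cell L (profile h) := by
  have h0 : (0 : ℝ) ∈ Icc (0 : ℝ) 1 := ⟨le_rfl, zero_le_one⟩
  have h1 : (1 : ℝ) ∈ Icc (0 : ℝ) 1 := ⟨zero_le_one, le_rfl⟩
  ext w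
  constructor
  · rintro ⟨z, hz, rfl⟩
    have hz' := cell_subset_closedStrip _ _ hz
    refine ⟨hz.1, ?_, ?_⟩
    · have := (hh.strictMonoOn z.1) h0 hz' hz.2.1
      simp only [hh.bottom] at this
      exact this
    · exact (hh.strictMonoOn z.1) hz' h1 hz.2.2
  · intro hw
    obtain ⟨z, hz, rfl⟩ := hh.exists_toPhys (cell_subset_closedStrip _ _ hw)
    refine ⟨z, ⟨hw.1, ?_, ?_⟩, rfl⟩
    · refine lt_of_le_of_ne hz.1 fun h0 => ?_
      have := hw.2.1
      rw [toPhys, show z = (z.1, 0) from Prod.ext rfl h0.symm, hh.bottom] at this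
      exact lt_irrefl _ this
    · refine lt_of_le_of_ne hz.2 fun h0 => ?_
      have := hw.2.2
      rw [toPhys, show z = (z.1, 1) from Prod.ext rfl h0, profile] at this
      exact lt_irrefl _ this

/-- The derivative of the hodograph transformation, as an equivalence. -/
def derivEquiv {z : ℝ × ℝ} (hz : z ∈ closedStrip flat) : (ℝ × ℝ) ≃L[ℝ] (ℝ × ℝ) :=
  ContinuousLinearEquiv.equivOfInverse
    ((ContinuousLinearMap.fst ℝ ℝ ℝ).prod (fderivWithin ℝ h (closedStrip flat) z))
    ((ContinuousLinearMap.fst ℝ ℝ ℝ).prod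
      (fCoef h z • ContinuousLinearMap.fst ℝ ℝ ℝ + kCoef h z • ContinuousLinearMap.snd ℝ ℝ ℝ))
    (fun v => by
      have := hh.hp_ne hz
      ext
      · simp
      · simp only [ContinuousLinearMap.prod_apply, ContinuousLinearMap.coe_fst', _root_.add_apply,
          _root_.smul_apply, ContinuousLinearMap.coe_snd', smul_eq_mul, fderivWithin_eq_pd, fCoef,
          kCoef]
        field_simp; ring)
    (fun v => by
      have := hh.hp_ne hz
      ext
      · simp
      · simp only [ContinuousLinearMap.prod_apply, ContinuousLinearMap.coe_fst', _root_.add_apply,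
          _root_.smul_apply, ContinuousLinearMap.coe_snd', smul_eq_mul, fderivWithin_eq_pd, fCoef,
          kCoef]
        field_simp; ring)

lemma hasFDerivWithinAt_toPhys {z : ℝ × ℝ} (hz : z ∈ closedStrip flat) :
    HasFDerivWithinAt (toPhys h) (hh.derivEquiv hz : (ℝ × ℝ) →L[ℝ] (ℝ × ℝ))
      (closedStrip flat) z :=
  (hasFDerivWithinAt_fst).prodMk (hh.differentiableOn z hz).hasFDerivWithinAt

/-- Unique differentiability passes to the image under a map with surjective derivative, so
derivatives within the curved strip are determined up to its boundary. -/
lemma uniqueDiffOn : UniqueDiffOn ℝ (closedStrip (profile h)) := by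
  rw [← hh.image_toPhys]
  rintro _ ⟨z, hz, rfl⟩
  refine (hh.hasFDerivWithinAt_toPhys hz).uniqueDiffWithinAt (uniqueDiffOn_flat z hz) ?_
  exact (hh.derivEquiv hz).surjective.denseRange

/-- The stream function is Lipschitz. -/
lemma exists_lipschitz_stream (hL : 0 < L) : ∃ C > 0, ∀ w ∈ closedStrip (profile h),
    ∀ w' ∈ closedStrip (profile h), |stream h w - stream h w'| ≤ C * (|w.1 - w'.1| + |w.2 - w'.2|) := by
  obtain ⟨m, hm, hml⟩ := (hh.isPer.pd2 hh.differentiableOn).exists_pos_lower hL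
    hh.contDiffOn_hp.continuousOn hh.deriv_pos
  obtain ⟨K, hK, hKb⟩ := (hh.isPer.pd1 hh.differentiableOn).exists_bound hL
    hh.contDiffOn_hq.continuousOn
  -- Along vertical lines h stretches distances at least by m, and along horizontal lines it is
  -- K-Lipschitz. Moving one point horizontally at its own value of p compares both on a single
  -- vertical line.
  have hlow : ∀ q, ∀ p ∈ Icc (0 : ℝ) 1, ∀ p' ∈ Icc (0 : ℝ) 1,
      m * |p - p'| ≤ |h (q, p) - h (q, p')| := by
    intro q p hp p' hp'
    wlog hle : p' ≤ p generalizing p p'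
    · rw [abs_sub_comm p, abs_sub_comm (h (q, p))]
      exact this p' hp' p hp (le_of_not_ge hle)
    have h1 := (convex_Icc (0 : ℝ) 1).mul_sub_le_image_sub_of_le_deriv (hh.continuousOn_slice q)
      (fun x hx => by
        rw [interior_Icc] at hx ⊢
        exact (hasDerivAt_pd2 hx (hh.differentiableOn _
          (Ioo_subset_Icc_self hx : ((q, x) : ℝ × ℝ).2 ∈ _))).differentiableAt.differentiableWithinAt)
      (C := m) (fun x hx => by
        rw [interior_Icc] at hx
        have hx' : ((q, x) : ℝ × ℝ) ∈ closedStrip flat := Ioo_subset_Icc_self hx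
        rw [(hasDerivAt_pd2 hx (hh.differentiableOn _ hx')).deriv]
        exact hml _ hx') p' hp' p hp hle
    rw [abs_of_nonneg (sub_nonneg.2 hle)]
    exact h1.trans (le_abs_self _)
  have hup : ∀ q q', ∀ p ∈ Icc (0 : ℝ) 1, |h (q, p) - h (q', p)| ≤ K * |q - q'| := by
    intro q q' p hp
    have := convex_univ.norm_image_sub_le_of_norm_hasDerivWithin_le (f := fun q => h (q, p))
      (f' := fun q => pd1 flat h (q, p)) (C := K) (x := q') (y := q)
      (fun x _ => (hasDerivAt_pd1 hp (hh.differentiableOn (x, p) hp)).hasDerivWithinAt)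
      (fun x _ => hKb (x, p) hp) trivial trivial
    simpa using this
  refine ⟨(K + 1) / m, by positivity, ?_⟩
  intro w hw w' hw'
  have e1 : h (w.1, stream h w) = w.2 := congrArg Prod.snd (hh.toPhys_toFlat hw)
  have e2 : h (w'.1, stream h w') = w'.2 := congrArg Prod.snd (hh.toPhys_toFlat hw')
  have hp := hh.toFlat_mem hw
  have hp' := hh.toFlat_mem hw'
  have h1 := hlow w.1 _ hp _ hp'
  have h2 := hup w.1 w'.1 _ hp'
  simp only [toFlat] at h1 h2
  rw [e1] at h1
  rw [e2] at h2
  have h3 := abs_sub_le w.2 w'.2 (h (w.1, stream h w'))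
  rw [abs_sub_comm w'.2] at h3
  rw [div_mul_eq_mul_div, le_div_iff₀ hm]
  have h4 := abs_nonneg (w.1 - w'.1)
  have h5 := mul_nonneg hK.le (abs_nonneg (w.2 - w'.2))
  nlinarith

lemma continuousOn_stream (hL : 0 < L) : ContinuousOn (stream h) (closedStrip (profile h)) := by
  obtain ⟨C, hC, hlip⟩ := hh.exists_lipschitz_stream hL
  intro w hw
  rw [ContinuousWithinAt, tendsto_iff_dist_tendsto_zero]
  have hlim : Tendsto (fun v : ℝ × ℝ => C * (|v.1 - w.1| + |v.2 - w.2|))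
      (𝓝[closedStrip (profile h)] w) (𝓝 0) := by
    have : Continuous fun v : ℝ × ℝ => C * (|v.1 - w.1| + |v.2 - w.2|) := by fun_prop
    have h1 := this.tendsto w
    simp only [sub_self, abs_zero, add_zero, mul_zero] at h1
    exact h1.mono_left nhdsWithin_le_nhds
  refine squeeze_zero' (Eventually.of_forall fun _ => dist_nonneg) ?_ hlim
  filter_upwards [self_mem_nhdsWithin] with v hv
  exact hlip v hv w hw

lemma continuousOn_toFlat (hL : 0 < L) : ContinuousOn (toFlat h) (closedStrip (profile h)) :=
  continuousOn_fst.prodMk (hh.continuousOn_stream hL)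

/-- The inverse of a differentiable map with invertible derivative is differentiable once it is
continuous, and continuity is the Lipschitz bound. The argument works up to the boundary. -/
lemma hasFDerivWithinAt_toFlat (hL : 0 < L) {z : ℝ × ℝ} (hz : z ∈ closedStrip flat) :
    HasFDerivWithinAt (toFlat h) ((hh.derivEquiv hz).symm : (ℝ × ℝ) →L[ℝ] (ℝ × ℝ))
      (closedStrip (profile h)) (toPhys h z) := by
  have hT := hh.hasFDerivWithinAt_toPhys hz
  have hw := hh.toPhys_mem hz
  refine HasFDerivWithinAt.of_local_left_inverse (f := toPhys h) (t := closedStrip flat)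
    ?_ ?_ hw ?_
  · exact (hh.continuousOn_toFlat hL _ hw).tendsto_nhdsWithin fun w hw => hh.toFlat_mem hw
  · rwa [hh.toFlat_toPhys hz]
  · filter_upwards [self_mem_nhdsWithin] with w hw
    exact hh.toPhys_toFlat hw

lemma hasFDerivWithinAt_stream (hL : 0 < L) {z : ℝ × ℝ} (hz : z ∈ closedStrip flat) :
    HasFDerivWithinAt (stream h)
      (fCoef h z • ContinuousLinearMap.fst ℝ ℝ ℝ + kCoef h z • ContinuousLinearMap.snd ℝ ℝ ℝ)
      (closedStrip (profile h)) (toPhys h z) :=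
  (hh.hasFDerivWithinAt_toFlat hL hz).snd

lemma streamX_toPhys (hL : 0 < L) {z : ℝ × ℝ} (hz : z ∈ closedStrip flat) :
    streamX h (toPhys h z) = fCoef h z := by
  rw [streamX, pd1, (hh.hasFDerivWithinAt_stream hL hz).fderivWithin
    (hh.uniqueDiffOn _ (hh.toPhys_mem hz))]
  simp

lemma streamY_toPhys (hL : 0 < L) {z : ℝ × ℝ} (hz : z ∈ closedStrip flat) :
    streamY h (toPhys h z) = kCoef h z := by
  rw [streamY, pd2, (hh.hasFDerivWithinAt_stream hL hz).fderivWithin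
    (hh.uniqueDiffOn _ (hh.toPhys_mem hz))]
  simp

/-- The gradient is (F, k) composed with the continuous map `toFlat`, hence continuous. -/
lemma contDiffOn_stream (hL : 0 < L) : ContDiffOn ℝ 1 (stream h) (closedStrip (profile h)) := by
  rw [← zero_add (1 : WithTop ℕ∞), contDiffOn_succ_iff_fderivWithin hh.uniqueDiffOn]
  refine ⟨?_, by simp, ?_⟩
  · intro w hw
    obtain ⟨z, hz, rfl⟩ := hh.exists_toPhys hw
    exact (hh.hasFDerivWithinAt_stream hL hz).differentiableWithinAt
  · rw [contDiffOn_zero]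
    have hm : MapsTo (toFlat h) (closedStrip (profile h)) (closedStrip flat) :=
      fun w hw => hh.toFlat_mem hw
    have hF := hh.contDiffOn_fCoef.continuousOn.comp (hh.continuousOn_toFlat hL) hm
    have hk := hh.contDiffOn_kCoef.continuousOn.comp (hh.continuousOn_toFlat hL) hm
    have hc : ContinuousOn (fun w => fCoef h (toFlat h w) • ContinuousLinearMap.fst ℝ ℝ ℝ
        + kCoef h (toFlat h w) • ContinuousLinearMap.snd ℝ ℝ ℝ) (closedStrip (profile h)) :=
      (hF.smul continuousOn_const).add (hk.smul continuousOn_const)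
    refine hc.congr fun w hw => ?_
    obtain ⟨z, hz, rfl⟩ := hh.exists_toPhys hw
    rw [(hh.hasFDerivWithinAt_stream hL hz).fderivWithin (hh.uniqueDiffOn _ hw)]
    simp only [hh.toFlat_toPhys hz]

lemma contDiffOn_toFlat (hL : 0 < L) : ContDiffOn ℝ 1 (toFlat h) (closedStrip (profile h)) :=
  contDiffOn_fst.prodMk (hh.contDiffOn_stream hL)

lemma contDiffOn_toPhys : ContDiffOn ℝ 1 (toPhys h) (closedStrip flat) :=
  contDiffOn_fst.prodMk hh.contDiffOn_one

/-- Partial derivatives of a function pulled back to the physical variables. -/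
lemma pd_comp_toFlat (hL : 0 < L) {f : ℝ × ℝ → ℝ} {z : ℝ × ℝ} (hz : z ∈ closedStrip flat)
    (hf : DifferentiableWithinAt ℝ f (closedStrip flat) z) :
    pd1 (profile h) (fun w => f (toFlat h w)) (toPhys h z)
        = pd1 flat f z + fCoef h z * pd2 flat f z ∧
    pd2 (profile h) (fun w => f (toFlat h w)) (toPhys h z) = kCoef h z * pd2 flat f z := by
  have hw := hh.toPhys_mem hz
  have hf' : HasFDerivWithinAt f (fderivWithin ℝ f (closedStrip flat) z) (closedStrip flat)
      (toFlat h (toPhys h z)) := by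
    rw [hh.toFlat_toPhys hz]; exact hf.hasFDerivWithinAt
  have h1 := hf'.comp (toPhys h z) (hh.hasFDerivWithinAt_toFlat hL hz)
    (fun w hw => hh.toFlat_mem hw)
  have hsymm : ∀ v, (hh.derivEquiv hz).symm v = (v.1, fCoef h z * v.1 + kCoef h z * v.2) :=
    fun v => rfl
  constructor
  · rw [pd1, show (fun w => f (toFlat h w)) = f ∘ toFlat h from rfl,
      h1.fderivWithin (hh.uniqueDiffOn _ hw)]
    simp [fderivWithin_eq_pd, hsymm]
  · rw [pd2, show (fun w => f (toFlat h w)) = f ∘ toFlat h from rfl,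
      h1.fderivWithin (hh.uniqueDiffOn _ hw)]
    simp [fderivWithin_eq_pd, hsymm]

end IsWave

end hodograph

/-! ### Change of variables -/

section change

open Filter Topology
open scoped NNReal ENNReal

lemma det_prod (f : (ℝ × ℝ) →L[ℝ] (ℝ × ℝ)) :
    f.det = (f (1, 0)).1 * (f (0, 1)).2 - (f (0, 1)).1 * (f (1, 0)).2 := by
  rw [ContinuousLinearMap.det, ← LinearMap.det_toMatrix (Module.Basis.finTwoProd ℝ),
    Matrix.det_fin_two]
  simp [LinearMap.toMatrix_apply]

variable {ω : ℝ → ℝ} {L lam R : ℝ} {h : ℝ × ℝ → ℝ}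

namespace IsWave

variable (hh : IsWave ω L lam R h)
include hh

lemma det_derivEquiv {z : ℝ × ℝ} (hz : z ∈ closedStrip flat) :
    (hh.derivEquiv hz : (ℝ × ℝ) →L[ℝ] (ℝ × ℝ)).det = pd2 flat h z := by
  rw [det_prod]
  have : ∀ v, hh.derivEquiv hz v = (v.1, fderivWithin ℝ h (closedStrip flat) z v) := fun v => rfl
  simp [this, pd2]

lemma hasDerivAt_profile (x : ℝ) : HasDerivAt (profile h) (pd1 flat h (x, 1)) x :=
  hasDerivAt_pd1 ⟨zero_le_one, le_rfl⟩ (hh.differentiableOn (x, 1) ⟨zero_le_one, le_rfl⟩)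

lemma continuous_profile : Continuous (profile h) :=
  continuous_iff_continuousAt.2 fun x => (hh.hasDerivAt_profile x).continuousAt

lemma isOpen_cell : IsOpen (cell L (profile h)) := by
  have hc := hh.continuous_profile
  have : cell L (profile h) = {z | z.1 ∈ Ioo (-L / 2) (L / 2)} ∩ ({z | 0 < z.2} ∩
      {z | z.2 < profile h z.1}) := rfl
  rw [this]
  refine (isOpen_Ioo.preimage continuous_fst).inter ((isOpen_lt continuous_const continuous_snd).inter
    (isOpen_lt continuous_snd (hc.comp continuous_fst)))

/-- The derivative of the hodograph transformation, as a total expression. -/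
lemma hasFDerivWithinAt_toPhys' : ∀ z ∈ cell L flat, HasFDerivWithinAt (toPhys h)
    ((ContinuousLinearMap.fst ℝ ℝ ℝ).prod (fderivWithin ℝ h (closedStrip flat) z))
      (cell L flat) z := fun _ hz =>
  (hh.hasFDerivWithinAt_toPhys (cell_subset_closedStrip _ _ hz)).mono (cell_subset_closedStrip _ _)

lemma abs_det {z : ℝ × ℝ} (hz : z ∈ closedStrip flat) :
    |((ContinuousLinearMap.fst ℝ ℝ ℝ).prod (fderivWithin ℝ h (closedStrip flat) z)).det|
      = pd2 flat h z := by
  have := hh.det_derivEquiv hz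
  rw [show ((ContinuousLinearMap.fst ℝ ℝ ℝ).prod (fderivWithin ℝ h (closedStrip flat) z))
    = (hh.derivEquiv hz : (ℝ × ℝ) →L[ℝ] (ℝ × ℝ)) from rfl, this, abs_of_pos (hh.deriv_pos z hz)]

lemma integral_cell_profile (g : ℝ × ℝ → ℝ) :
    ∫ w in cell L (profile h), g w = ∫ z in cell L flat, pd2 flat h z * g (toPhys h z) := by
  rw [← hh.image_cell, integral_image_eq_integral_abs_det_fderiv_smul volume
    (measurableSet_cell_flat L) hh.hasFDerivWithinAt_toPhys'
    (hh.injOn_toPhys.mono (cell_subset_closedStrip _ _))]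
  refine setIntegral_congr_fun (measurableSet_cell_flat L) fun z hz => ?_
  simp only [smul_eq_mul]
  rw [hh.abs_det (cell_subset_closedStrip _ _ hz)]

lemma map_toPhys_withDensity :
    Measure.map (toPhys h) ((volume.restrict (cell L flat)).withDensity
      fun z => ENNReal.ofReal (pd2 flat h z)) = volume.restrict (cell L (profile h)) := by
  rw [← hh.image_cell, ← map_withDensity_abs_det_fderiv_eq_addHaar volume
    (measurableSet_cell_flat L).nullMeasurableSet hh.hasFDerivWithinAt_toPhys'
    (hh.injOn_toPhys.mono (cell_subset_closedStrip _ _))]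
  congr 1
  refine withDensity_congr_ae ?_
  filter_upwards [ae_restrict_mem (measurableSet_cell_flat L)] with z hz
  rw [hh.abs_det (cell_subset_closedStrip _ _ hz)]

lemma aemeasurable_toPhys : AEMeasurable (toPhys h) (volume.restrict (cell L flat)) :=
  (hh.contDiffOn_toPhys.continuousOn.mono (cell_subset_closedStrip _ _)).aemeasurable
    (measurableSet_cell_flat L)

lemma aemeasurable_toFlat (hL : 0 < L) :
    AEMeasurable (toFlat h) (volume.restrict (cell L (profile h))) :=
  ((hh.continuousOn_toFlat hL).mono (cell_subset_closedStrip _ _)).aemeasurable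
    hh.isOpen_cell.measurableSet

/-- The push-forward of h_p dq dp is Lebesgue measure on the physical cell, and h_p is bounded below
by a positive constant. -/
lemma exists_map_toPhys_le (hL : 0 < L) : ∃ C : ℝ≥0,
    (volume.restrict (cell L flat)).map (toPhys h) ≤ C • volume.restrict (cell L (profile h)) := by
  obtain ⟨m, hm, hml⟩ := (hh.isPer.pd2 hh.differentiableOn).exists_pos_lower hL
    hh.contDiffOn_hp.continuousOn hh.deriv_pos
  refine ⟨(Real.toNNReal m)⁻¹, ?_⟩
  have h1 : (volume.restrict (cell L flat) : Measure (ℝ × ℝ)) ≤ (Real.toNNReal m)⁻¹ •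
      ((volume.restrict (cell L flat)).withDensity fun z => ENNReal.ofReal (pd2 flat h z)) := by
    have h2 : ENNReal.ofReal m • (volume.restrict (cell L flat) : Measure (ℝ × ℝ)) ≤
        (volume.restrict (cell L flat)).withDensity fun z => ENNReal.ofReal (pd2 flat h z) := by
      rw [← withDensity_const]
      refine withDensity_mono ?_
      filter_upwards [ae_restrict_mem (measurableSet_cell_flat L)] with z hz
      exact ENNReal.ofReal_le_ofReal (hml z (cell_subset_closedStrip _ _ hz))
    have hm' : Real.toNNReal m ≠ 0 := by simpa using hm
    calc (volume.restrict (cell L flat) : Measure (ℝ × ℝ))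
        = (Real.toNNReal m)⁻¹ • (Real.toNNReal m • volume.restrict (cell L flat)) := by
          rw [smul_smul, inv_mul_cancel₀ hm', one_smul]
      _ ≤ _ := by
          intro s
          simp only [Measure.smul_apply]
          gcongr
          exact h2 s
  have hae : AEMeasurable (toPhys h) ((Real.toNNReal m)⁻¹ •
      ((volume.restrict (cell L flat)).withDensity fun z => ENNReal.ofReal (pd2 flat h z))) :=
    (hh.aemeasurable_toPhys.mono_ac (withDensity_absolutelyContinuous _ _)).smul_measure _
  rw [← hh.map_toPhys_withDensity, ← Measure.map_smul]
  exact Measure.map_mono_of_aemeasurable h1 hae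

/-- Pulled back to the flat cell, Lebesgue measure on the physical cell is h_p dq dp, and h_p is
bounded above. -/
lemma exists_map_toFlat_le (hL : 0 < L) : ∃ C : ℝ≥0,
    (volume.restrict (cell L (profile h))).map (toFlat h) ≤ C • volume.restrict (cell L flat) := by
  obtain ⟨K, hK, hKb⟩ := (hh.isPer.pd2 hh.differentiableOn).exists_bound hL
    hh.contDiffOn_hp.continuousOn
  refine ⟨Real.toNNReal K, ?_⟩
  set ν := (volume.restrict (cell L flat)).withDensity fun z => ENNReal.ofReal (pd2 flat h z) with hν
  have hae : AEMeasurable (toPhys h) ν :=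
    hh.aemeasurable_toPhys.mono_ac (withDensity_absolutelyContinuous _ _)
  have hS := hh.aemeasurable_toFlat hL
  rw [← hh.map_toPhys_withDensity] at hS ⊢
  rw [AEMeasurable.map_map_of_aemeasurable hS hae]
  have hid : toFlat h ∘ toPhys h =ᵐ[ν] id := by
    have h1 : ∀ᵐ z ∂(volume.restrict (cell L flat)), (toFlat h ∘ toPhys h) z = id z := by
      filter_upwards [ae_restrict_mem (measurableSet_cell_flat L)] with z hz
      exact hh.toFlat_toPhys (cell_subset_closedStrip _ _ hz)
    exact (withDensity_absolutelyContinuous _ _).ae_le h1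
  rw [Measure.map_congr hid, Measure.map_id]
  have h2 : ν ≤ ENNReal.ofReal K • volume.restrict (cell L flat) := by
    rw [← withDensity_const]
    refine withDensity_mono ?_
    filter_upwards [ae_restrict_mem (measurableSet_cell_flat L)] with z hz
    exact ENNReal.ofReal_le_ofReal ((le_abs_self _).trans (hKb z (cell_subset_closedStrip _ _ hz)))
  exact h2

end IsWave

/-! ### Transport of quadruples -/

/-- Boundedness and measurability of a coefficient. -/
def IsCoef {α : Type*} [MeasurableSpace α] (μ : Measure α) (c : α → ℝ) : Prop :=
  AEStronglyMeasurable c μ ∧ ∃ K, ∀ᵐ y ∂μ, |c y| ≤ K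

/-- Lower triangular transport of quadruples along a map `S` of the cells. -/
lemma exists_transport {η η' : ℝ → ℝ} {S : ℝ × ℝ → ℝ × ℝ}
    (hS : AEMeasurable S (volume.restrict (cell L η'))) {C : ℝ≥0}
    (hC : (volume.restrict (cell L η')).map S ≤ C • volume.restrict (cell L η))
    {c₀₀ c₁₀ c₁₁ c₁₂ c₂₀ c₂₂ : ℝ × ℝ → ℝ} {e : ℝ → ℝ}
    (h₀₀ : IsCoef (volume.restrict (cell L η')) c₀₀)
    (h₁₀ : IsCoef (volume.restrict (cell L η')) c₁₀)
    (h₁₁ : IsCoef (volume.restrict (cell L η')) c₁₁)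
    (h₁₂ : IsCoef (volume.restrict (cell L η')) c₁₂)
    (h₂₀ : IsCoef (volume.restrict (cell L η')) c₂₀)
    (h₂₂ : IsCoef (volume.restrict (cell L η')) c₂₂)
    (he : IsCoef (volume.restrict (Ioo (-L / 2) (L / 2))) e) :
    ∃ M : Quad L η →L[ℝ] Quad L η', ∀ U,
      (fn (M U) =ᵐ[volume.restrict (cell L η')] fun w => c₀₀ w * fn U (S w)) ∧
      (d1 (M U) =ᵐ[volume.restrict (cell L η')] fun w =>
        c₁₀ w * fn U (S w) + c₁₁ w * d1 U (S w) + c₁₂ w * d2 U (S w)) ∧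
      (d2 (M U) =ᵐ[volume.restrict (cell L η')] fun w =>
        c₂₀ w * fn U (S w) + c₂₂ w * d2 U (S w)) ∧
      (tr (M U) =ᵐ[volume.restrict (Ioo (-L / 2) (L / 2))] fun x => e x * tr U x) := by
  obtain ⟨m₀₀, _, k₀₀⟩ := h₀₀
  obtain ⟨W₀₀, w₀₀⟩ := exists_weightedComp hS hC m₀₀ k₀₀
  obtain ⟨m₁₀, _, k₁₀⟩ := h₁₀
  obtain ⟨W₁₀, w₁₀⟩ := exists_weightedComp hS hC m₁₀ k₁₀
  obtain ⟨m₁₁, _, k₁₁⟩ := h₁₁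
  obtain ⟨W₁₁, w₁₁⟩ := exists_weightedComp hS hC m₁₁ k₁₁
  obtain ⟨m₁₂, _, k₁₂⟩ := h₁₂
  obtain ⟨W₁₂, w₁₂⟩ := exists_weightedComp hS hC m₁₂ k₁₂
  obtain ⟨m₂₀, _, k₂₀⟩ := h₂₀
  obtain ⟨W₂₀, w₂₀⟩ := exists_weightedComp hS hC m₂₀ k₂₀
  obtain ⟨m₂₂, _, k₂₂⟩ := h₂₂
  obtain ⟨W₂₂, w₂₂⟩ := exists_weightedComp hS hC m₂₂ k₂₂
  obtain ⟨me, _, ke⟩ := he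
  obtain ⟨We, we⟩ := exists_weightedMul me ke
  let p₀ : Quad L η →L[ℝ] _ := ContinuousLinearMap.fst ℝ _ _
  let p₁ : Quad L η →L[ℝ] _ := (ContinuousLinearMap.fst ℝ _ _).comp (ContinuousLinearMap.snd ℝ _ _)
  let p₂ : Quad L η →L[ℝ] _ := (ContinuousLinearMap.fst ℝ _ _).comp
    ((ContinuousLinearMap.snd ℝ _ _).comp (ContinuousLinearMap.snd ℝ _ _))
  let p₃ : Quad L η →L[ℝ] _ := (ContinuousLinearMap.snd ℝ _ _).comp
    ((ContinuousLinearMap.snd ℝ _ _).comp (ContinuousLinearMap.snd ℝ _ _))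
  refine ⟨(W₀₀.comp p₀).prod ((W₁₀.comp p₀ + W₁₁.comp p₁ + W₁₂.comp p₂).prod
    ((W₂₀.comp p₀ + W₂₂.comp p₂).prod (We.comp p₃))), fun U => ⟨w₀₀ U.1, ?_, ?_, we U.2.2.2⟩⟩
  · filter_upwards [Lp.coeFn_add (W₁₀ U.1 + W₁₁ U.2.1) (W₁₂ U.2.2.1),
      Lp.coeFn_add (W₁₀ U.1) (W₁₁ U.2.1), w₁₀ U.1, w₁₁ U.2.1, w₁₂ U.2.2.1] with w e1 e2 e3 e4 e5
    refine e1.trans ?_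
    rw [Pi.add_apply, e2, Pi.add_apply, e3, e4, e5]
    rfl
  · filter_upwards [Lp.coeFn_add (W₂₀ U.1) (W₂₂ U.2.2.1), w₂₀ U.1, w₂₂ U.2.2.1] with w e1 e2 e3
    refine e1.trans ?_
    rw [Pi.add_apply, e2, e3]
    rfl

end change

/-! ### Transport of the Sobolev space by Γ = ψ_y u -/

section transport

open Filter Topology
open scoped NNReal ENNReal

variable {ω : ℝ → ℝ} {L lam R : ℝ} {h : ℝ × ℝ → ℝ}

lemma IsPer.mul {f g : ℝ × ℝ → ℝ} (hf : IsPer L f) (hg : IsPer L g) :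
    IsPer L (fun z => f z * g z) := fun q p hp => by
  simp only [hf q p hp, hg q p hp]

lemma IsPer.add {f g : ℝ × ℝ → ℝ} (hf : IsPer L f) (hg : IsPer L g) :
    IsPer L (fun z => f z + g z) := fun q p hp => by
  simp only [hf q p hp, hg q p hp]

lemma IsPer.neg {f : ℝ × ℝ → ℝ} (hf : IsPer L f) :
    IsPer L (fun z => -f z) := fun q p hp => by
  simp only [hf q p hp]

lemma isCoef_flat (hL : 0 < L) {c : ℝ × ℝ → ℝ} (hc : ContinuousOn c (closedStrip flat))
    (hp : IsPer L c) : IsCoef (volume.restrict (cell L flat)) c := by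
  obtain ⟨K, -, hK⟩ := hp.exists_bound hL hc
  refine ⟨(hc.mono (cell_subset_closedStrip _ _)).aestronglyMeasurable
    (measurableSet_cell_flat L), K, ?_⟩
  filter_upwards [ae_restrict_mem (measurableSet_cell_flat L)] with z hz
  exact hK z (cell_subset_closedStrip _ _ hz)

lemma isCoef_top (hL : 0 < L) {c : ℝ × ℝ → ℝ} (hc : ContinuousOn c (closedStrip flat))
    (hp : IsPer L c) : IsCoef (volume.restrict (Ioo (-L / 2) (L / 2))) (fun x => c (x, 1)) := by
  obtain ⟨K, -, hK⟩ := hp.exists_bound hL hc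
  have h1 : (1 : ℝ) ∈ Icc (0 : ℝ) 1 := ⟨zero_le_one, le_rfl⟩
  have : Continuous fun x : ℝ => c (x, 1) := hc.comp_continuous (by fun_prop) fun x => h1
  exact ⟨this.aestronglyMeasurable, K, ae_of_all _ fun x => hK (x, 1) h1⟩

/-- The preimage of a closed subspace under a continuous operator is a closed subspace, so it
suffices to test the generators. -/
lemma map_H1pe_le {η η' : ℝ → ℝ} (M : Quad L η →L[ℝ] Quad L η')
    (hM : ∀ U u, IsCoreQuad L η U u → M U ∈ H1pe L η') : ∀ U ∈ H1pe L η, M U ∈ H1pe L η' := by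
  have hle : H1pe L η ≤ (H1pe L η').comap M.toLinearMap := by
    rw [H1pe_eq L η]
    refine Submodule.topologicalClosure_minimal _ ?_ ?_
    · rw [Submodule.span_le]
      rintro U ⟨u, hu⟩
      exact hM U u hu
    · exact (Submodule.isClosed_topologicalClosure _).preimage M.continuous
  exact fun U hU => hle hU

lemma Quad.ext_ae {η : ℝ → ℝ} {U V : Quad L η}
    (h0 : fn U =ᵐ[volume.restrict (cell L η)] fn V)
    (h1 : d1 U =ᵐ[volume.restrict (cell L η)] d1 V)
    (h2 : d2 U =ᵐ[volume.restrict (cell L η)] d2 V)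
    (h3 : tr U =ᵐ[volume.restrict (Ioo (-L / 2) (L / 2))] tr V) : U = V :=
  Prod.ext (Lp.ext h0) (Prod.ext (Lp.ext h1) (Prod.ext (Lp.ext h2) (Lp.ext h3)))

/-- `∂_x k` in the `(q,p)` variables. -/
def kX (h : ℝ × ℝ → ℝ) (z : ℝ × ℝ) : ℝ :=
  pd1 flat (kCoef h) z + fCoef h z * pd2 flat (kCoef h) z

/-- `∂_y k` in the `(q,p)` variables. -/
def kY (h : ℝ × ℝ → ℝ) (z : ℝ × ℝ) : ℝ := kCoef h z * pd2 flat (kCoef h) z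

/-- `V` is `Γ`, where `U` is `u` and `Γ(x, h(x,p)) = k(x,p) u(x,p)`. -/
def IsPush (L : ℝ) (h : ℝ × ℝ → ℝ) (U : Quad L flat) (V : Quad L (profile h)) : Prop :=
  (fn V =ᵐ[volume.restrict (cell L (profile h))] fun w =>
      kCoef h (toFlat h w) * fn U (toFlat h w)) ∧
  (d1 V =ᵐ[volume.restrict (cell L (profile h))] fun w =>
      kX h (toFlat h w) * fn U (toFlat h w) + kCoef h (toFlat h w) * d1 U (toFlat h w)
        + kCoef h (toFlat h w) * fCoef h (toFlat h w) * d2 U (toFlat h w)) ∧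
  (d2 V =ᵐ[volume.restrict (cell L (profile h))] fun w =>
      kY h (toFlat h w) * fn U (toFlat h w)
        + kCoef h (toFlat h w) * kCoef h (toFlat h w) * d2 U (toFlat h w)) ∧
  (tr V =ᵐ[volume.restrict (Ioo (-L / 2) (L / 2))] fun x => kCoef h (x, 1) * tr U x)

/-- `U` is `u`, where `V` is `Γ` and `u(x,p) = h_p(x,p) Γ(x, h(x,p))`. -/
def IsPull (L : ℝ) (h : ℝ × ℝ → ℝ) (V : Quad L (profile h)) (U : Quad L flat) : Prop :=
  (fn U =ᵐ[volume.restrict (cell L flat)] fun z =>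
      pd2 flat h z * fn V (toPhys h z)) ∧
  (d1 U =ᵐ[volume.restrict (cell L flat)] fun z =>
      -(pd2 flat h z * pd2 flat h z * pd1 flat (kCoef h) z) * fn V (toPhys h z)
        + pd2 flat h z * d1 V (toPhys h z)
        + -(pd2 flat h z * pd2 flat h z * fCoef h z) * d2 V (toPhys h z)) ∧
  (d2 U =ᵐ[volume.restrict (cell L flat)] fun z =>
      -(pd2 flat h z * pd2 flat h z * pd2 flat (kCoef h) z) * fn V (toPhys h z)
        + pd2 flat h z * pd2 flat h z * d2 V (toPhys h z)) ∧
  (tr U =ᵐ[volume.restrict (Ioo (-L / 2) (L / 2))] fun x =>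
      pd2 flat h (x, 1) * tr V x)

lemma ae_mem_flat : ∀ᵐ z ∂(volume.restrict (cell L flat)), z ∈ closedStrip flat := by
  filter_upwards [ae_restrict_mem (measurableSet_cell_flat L)] with z hz
  exact cell_subset_closedStrip _ _ hz

namespace IsWave

variable (hh : IsWave ω L lam R h)
include hh

lemma isCoef_profile (hL : 0 < L) {c : ℝ × ℝ → ℝ} (hc : ContinuousOn c (closedStrip flat))
    (hp : IsPer L c) :
    IsCoef (volume.restrict (cell L (profile h))) (fun w => c (toFlat h w)) := by
  obtain ⟨K, -, hK⟩ := hp.exists_bound hL hc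
  have h1 : ContinuousOn (fun w => c (toFlat h w)) (cell L (profile h)) :=
    hc.comp ((hh.continuousOn_toFlat hL).mono (cell_subset_closedStrip _ _))
      fun w hw => hh.toFlat_mem (cell_subset_closedStrip _ _ hw)
  refine ⟨h1.aestronglyMeasurable hh.isOpen_cell.measurableSet, K, ?_⟩
  filter_upwards [ae_restrict_mem hh.isOpen_cell.measurableSet] with w hw
  exact hK _ (hh.toFlat_mem (cell_subset_closedStrip _ _ hw))

lemma continuousOn_kX : ContinuousOn (kX h) (closedStrip flat) :=
  (continuousOn_pd1 uniqueDiffOn_flat hh.contDiffOn_kCoef).add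
    (hh.contDiffOn_fCoef.continuousOn.mul (continuousOn_pd2 uniqueDiffOn_flat hh.contDiffOn_kCoef))

lemma continuousOn_kY : ContinuousOn (kY h) (closedStrip flat) :=
  hh.contDiffOn_kCoef.continuousOn.mul (continuousOn_pd2 uniqueDiffOn_flat hh.contDiffOn_kCoef)

lemma differentiableOn_kCoef : DifferentiableOn ℝ (kCoef h) (closedStrip flat) :=
  hh.contDiffOn_kCoef.differentiableOn one_ne_zero

lemma isPer_kX : IsPer L (kX h) :=
  (hh.isPer_kCoef.pd1 hh.differentiableOn_kCoef).add
    (hh.isPer_fCoef.mul (hh.isPer_kCoef.pd2 hh.differentiableOn_kCoef))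

lemma isPer_kY : IsPer L (kY h) :=
  hh.isPer_kCoef.mul (hh.isPer_kCoef.pd2 hh.differentiableOn_kCoef)

lemma isPer_hp : IsPer L (pd2 flat h) := hh.isPer.pd2 hh.differentiableOn

lemma kCoef_mul_hp {z : ℝ × ℝ} (hz : z ∈ closedStrip flat) : kCoef h z * pd2 flat h z = 1 :=
  inv_mul_cancel₀ (hh.hp_ne hz)

/-- `U ↦ Γ`, `Γ(x, h(x,p)) = k(x,p) u(x,p)`. -/
lemma exists_toProfile (hL : 0 < L) : ∃ M : Quad L flat →L[ℝ] Quad L (profile h), ∀ U,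
    IsPush L h U (M U) := by
  obtain ⟨C, hC⟩ := hh.exists_map_toFlat_le hL
  have hk := hh.contDiffOn_kCoef.continuousOn
  have hF := hh.contDiffOn_fCoef.continuousOn
  have hkP := hh.isPer_kCoef
  exact exists_transport (hh.aemeasurable_toFlat hL) hC (hh.isCoef_profile hL hk hkP)
    (hh.isCoef_profile hL hh.continuousOn_kX hh.isPer_kX) (hh.isCoef_profile hL hk hkP)
    (hh.isCoef_profile hL (hk.mul hF) (hkP.mul hh.isPer_fCoef))
    (hh.isCoef_profile hL hh.continuousOn_kY hh.isPer_kY)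
    (hh.isCoef_profile hL (hk.mul hk) (hkP.mul hkP)) (isCoef_top hL hk hkP)

/-- The inverse transport. -/
lemma exists_ofProfile (hL : 0 < L) : ∃ N : Quad L (profile h) →L[ℝ] Quad L flat, ∀ V,
    IsPull L h V (N V) := by
  obtain ⟨C, hC⟩ := hh.exists_map_toPhys_le hL
  have hp := hh.contDiffOn_hp.continuousOn
  have hF := hh.contDiffOn_fCoef.continuousOn
  have hpP := hh.isPer_hp
  have k1 := continuousOn_pd1 uniqueDiffOn_flat hh.contDiffOn_kCoef
  have k2 := continuousOn_pd2 uniqueDiffOn_flat hh.contDiffOn_kCoef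
  have k1P := hh.isPer_kCoef.pd1 hh.differentiableOn_kCoef
  have k2P := hh.isPer_kCoef.pd2 hh.differentiableOn_kCoef
  exact exists_transport hh.aemeasurable_toPhys hC (isCoef_flat hL hp hpP)
    (isCoef_flat hL ((hp.mul hp).mul k1).neg ((hpP.mul hpP).mul k1P).neg) (isCoef_flat hL hp hpP)
    (isCoef_flat hL ((hp.mul hp).mul hF).neg ((hpP.mul hpP).mul hh.isPer_fCoef).neg)
    (isCoef_flat hL ((hp.mul hp).mul k2).neg ((hpP.mul hpP).mul k2P).neg)
    (isCoef_flat hL (hp.mul hp) (hpP.mul hpP)) (isCoef_top hL hp hpP)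

/-- The transport operator. -/
def toProfile (hL : 0 < L) : Quad L flat →L[ℝ] Quad L (profile h) := (hh.exists_toProfile hL).choose

/-- The inverse of the transport operator. -/
def ofProfile (hL : 0 < L) : Quad L (profile h) →L[ℝ] Quad L flat := (hh.exists_ofProfile hL).choose

lemma toProfile_spec (hL : 0 < L) (U : Quad L flat) : IsPush L h U (hh.toProfile hL U) :=
  (hh.exists_toProfile hL).choose_spec U

lemma ofProfile_spec (hL : 0 < L) (V : Quad L (profile h)) :
    IsPull L h V (hh.ofProfile hL V) :=
  (hh.exists_ofProfile hL).choose_spec V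

lemma ae_comp_toPhys (hL : 0 < L) {P : ℝ × ℝ → Prop}
    (hP : ∀ᵐ w ∂(volume.restrict (cell L (profile h))), P w) :
    ∀ᵐ z ∂(volume.restrict (cell L flat)), P (toPhys h z) := by
  obtain ⟨C, hC⟩ := hh.exists_map_toPhys_le hL
  exact ae_comp_of_map_le hh.aemeasurable_toPhys hC hP

lemma ae_comp_toFlat (hL : 0 < L) {P : ℝ × ℝ → Prop}
    (hP : ∀ᵐ z ∂(volume.restrict (cell L flat)), P z) :
    ∀ᵐ w ∂(volume.restrict (cell L (profile h))), P (toFlat h w) := by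
  obtain ⟨C, hC⟩ := hh.exists_map_toFlat_le hL
  exact ae_comp_of_map_le (hh.aemeasurable_toFlat hL) hC hP

lemma ae_mem_profile :
    ∀ᵐ w ∂(volume.restrict (cell L (profile h))), w ∈ closedStrip (profile h) := by
  filter_upwards [ae_restrict_mem hh.isOpen_cell.measurableSet] with z hz
  exact cell_subset_closedStrip _ _ hz

/-- The components of the transported quadruple in the `(q,p)` variables. -/
lemma toProfile_toPhys (hL : 0 < L) (U : Quad L flat) :
    (∀ᵐ z ∂(volume.restrict (cell L flat)),
      fn (hh.toProfile hL U) (toPhys h z) = kCoef h z * fn U z) ∧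
    (∀ᵐ z ∂(volume.restrict (cell L flat)), d1 (hh.toProfile hL U) (toPhys h z)
      = kX h z * fn U z + kCoef h z * d1 U z + kCoef h z * fCoef h z * d2 U z) ∧
    (∀ᵐ z ∂(volume.restrict (cell L flat)), d2 (hh.toProfile hL U) (toPhys h z)
      = kY h z * fn U z + kCoef h z * kCoef h z * d2 U z) := by
  obtain ⟨h0, h1, h2, -⟩ := hh.toProfile_spec hL U
  refine ⟨?_, ?_, ?_⟩
  · filter_upwards [hh.ae_comp_toPhys hL h0, ae_mem_flat] with z e hz
    rw [hh.toFlat_toPhys hz] at e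
    exact e
  · filter_upwards [hh.ae_comp_toPhys hL h1, ae_mem_flat] with z e hz
    rw [hh.toFlat_toPhys hz] at e
    exact e
  · filter_upwards [hh.ae_comp_toPhys hL h2, ae_mem_flat] with z e hz
    rw [hh.toFlat_toPhys hz] at e
    exact e

lemma ofProfile_toProfile (hL : 0 < L) (U : Quad L flat) :
    hh.ofProfile hL (hh.toProfile hL U) = U := by
  obtain ⟨h0, h1, h2⟩ := hh.toProfile_toPhys hL U
  obtain ⟨-, -, -, h3⟩ := hh.toProfile_spec hL U
  obtain ⟨g0, g1, g2, g3⟩ := hh.ofProfile_spec hL (hh.toProfile hL U)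
  refine Quad.ext_ae ?_ ?_ ?_ ?_
  · filter_upwards [g0, h0, ae_mem_flat] with z e1 e2 hz
    refine e1.trans ?_
    rw [e2]
    linear_combination (fn U z) * hh.kCoef_mul_hp hz
  · filter_upwards [g1, h0, h1, h2, ae_mem_flat] with z e1 e2 e3 e4 hz
    refine e1.trans ?_
    rw [e2, e3, e4, kX, kY]
    have := hh.kCoef_mul_hp hz
    have hk : kCoef h z = (pd2 flat h z)⁻¹ := rfl
    have hne := hh.hp_ne hz
    simp only [hk]
    field_simp
    ring
  · filter_upwards [g2, h0, h2, ae_mem_flat] with z e1 e2 e4 hz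
    refine e1.trans ?_
    rw [e2, e4, kY]
    have hk : kCoef h z = (pd2 flat h z)⁻¹ := rfl
    have hne := hh.hp_ne hz
    simp only [hk]
    field_simp
    ring
  · filter_upwards [g3, h3] with x e1 e2
    refine e1.trans ?_
    have h1 : ((x, 1) : ℝ × ℝ) ∈ closedStrip flat := ⟨zero_le_one, le_rfl⟩
    refine (congrArg (pd2 flat h (x, 1) * ·) e2).trans ?_
    linear_combination (tr U x) * hh.kCoef_mul_hp h1

lemma toProfile_ofProfile (hL : 0 < L) (V : Quad L (profile h)) :
    hh.toProfile hL (hh.ofProfile hL V) = V := by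
  obtain ⟨g0, g1, g2, g3⟩ := hh.ofProfile_spec hL V
  obtain ⟨h0, h1, h2, h3⟩ := hh.toProfile_spec hL (hh.ofProfile hL V)
  refine Quad.ext_ae ?_ ?_ ?_ ?_
  · filter_upwards [h0, hh.ae_comp_toFlat hL g0, hh.ae_mem_profile] with w e1 e2 hw
    refine e1.trans ((congrArg (kCoef h (toFlat h w) * ·) e2).trans ?_)
    rw [hh.toPhys_toFlat hw]
    linear_combination (fn V w) * hh.kCoef_mul_hp (hh.toFlat_mem hw)
  · filter_upwards [h1, hh.ae_comp_toFlat hL g0, hh.ae_comp_toFlat hL g1,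
      hh.ae_comp_toFlat hL g2, hh.ae_mem_profile] with w e1 e2 e3 e4 hw
    simp only [hh.toPhys_toFlat hw] at e2 e3 e4
    refine e1.trans ?_
    erw [e2, e3, e4]
    have hne := hh.hp_ne (hh.toFlat_mem hw)
    have hk : kCoef h (toFlat h w) = (pd2 flat h (toFlat h w))⁻¹ := rfl
    rw [kX]
    simp only [hk]
    field_simp
    ring
  · filter_upwards [h2, hh.ae_comp_toFlat hL g0,
      hh.ae_comp_toFlat hL g2, hh.ae_mem_profile] with w e1 e2 e4 hw
    simp only [hh.toPhys_toFlat hw] at e2 e4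
    refine e1.trans ?_
    erw [e2, e4]
    have hne := hh.hp_ne (hh.toFlat_mem hw)
    have hk : kCoef h (toFlat h w) = (pd2 flat h (toFlat h w))⁻¹ := rfl
    rw [kY]
    simp only [hk]
    field_simp
    ring
  · filter_upwards [h3, g3] with x e1 e2
    refine e1.trans ((congrArg (kCoef h (x, 1) * ·) e2).trans ?_)
    have h1 : ((x, 1) : ℝ × ℝ) ∈ closedStrip flat := ⟨zero_le_one, le_rfl⟩
    linear_combination (tr V x) * hh.kCoef_mul_hp h1

/-- The transport of quadruples as a linear equivalence. -/
def quadEquiv (hL : 0 < L) : Quad L flat ≃ₗ[ℝ] Quad L (profile h) :=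
  LinearEquiv.ofLinearMap (hh.toProfile hL).toLinearMap (hh.ofProfile hL).toLinearMap
    (LinearMap.ext fun V => hh.toProfile_ofProfile hL V)
    (LinearMap.ext fun U => hh.ofProfile_toProfile hL U)

lemma toFlat_add (w : ℝ × ℝ) (hw : w ∈ closedStrip (profile h)) :
    toFlat h (w.1 + L, w.2) = ((toFlat h w).1 + L, (toFlat h w).2) := by
  obtain ⟨z, hz, rfl⟩ := hh.exists_toPhys hw
  rw [hh.toFlat_toPhys hz]
  have hz' : ((z.1 + L, z.2) : ℝ × ℝ) ∈ closedStrip flat := hz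
  have : toPhys h (z.1 + L, z.2) = ((toPhys h z).1 + L, (toPhys h z).2) :=
    Prod.ext rfl (hh.isPer z.1 z.2 hz)
  rw [← this, hh.toFlat_toPhys hz']

lemma toFlat_neg (w : ℝ × ℝ) (hw : w ∈ closedStrip (profile h)) :
    toFlat h (-w.1, w.2) = (-(toFlat h w).1, (toFlat h w).2) := by
  obtain ⟨z, hz, rfl⟩ := hh.exists_toPhys hw
  rw [hh.toFlat_toPhys hz]
  have hz' : ((-z.1, z.2) : ℝ × ℝ) ∈ closedStrip flat := hz
  have : toPhys h (-z.1, z.2) = (-(toPhys h z).1, (toPhys h z).2) :=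
    Prod.ext rfl (hh.isEvn z.1 z.2 hz)
  rw [← this, hh.toFlat_toPhys hz']

lemma toFlat_bottom (x : ℝ) : toFlat h (x, 0) = (x, 0) := by
  have hz : ((x, 0) : ℝ × ℝ) ∈ closedStrip flat := ⟨le_rfl, zero_le_one⟩
  have := hh.toFlat_toPhys hz
  rwa [toPhys, hh.bottom] at this

lemma isCore_toFlat (hL : 0 < L) {u : ℝ × ℝ → ℝ} (hu : IsCore L flat u) :
    IsCore L (profile h) (fun w => kCoef h (toFlat h w) * u (toFlat h w)) where
  smooth := (hh.contDiffOn_kCoef.mul hu.smooth).comp (hh.contDiffOn_toFlat hL)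
    fun w hw => hh.toFlat_mem hw
  periodic w hw := by
    have hz := hh.toFlat_mem hw
    simp only [hh.toFlat_add w hw]
    rw [hu.periodic _ hz, hh.isPer_kCoef _ _ hz]
  even w hw := by
    have hz := hh.toFlat_mem hw
    simp only [hh.toFlat_neg w hw]
    rw [hu.even _ hz, hh.isEvn_kCoef _ _ hz]
  bottom x := by rw [hh.toFlat_bottom, hu.bottom, mul_zero]

lemma pd_toFlat_mul (hL : 0 < L) {u : ℝ × ℝ → ℝ}
    (hu : DifferentiableOn ℝ u (closedStrip flat)) {z : ℝ × ℝ} (hz : z ∈ closedStrip flat) :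
    pd1 (profile h) (fun w => kCoef h (toFlat h w) * u (toFlat h w)) (toPhys h z)
      = kX h z * u z + kCoef h z * pd1 flat u z + kCoef h z * fCoef h z * pd2 flat u z ∧
    pd2 (profile h) (fun w => kCoef h (toFlat h w) * u (toFlat h w)) (toPhys h z)
      = kY h z * u z + kCoef h z * kCoef h z * pd2 flat u z := by
  have hk := hh.differentiableOn_kCoef z hz
  have hm := pd_mul (uniqueDiffOn_flat z hz) hk (hu z hz)
  have hc := hh.pd_comp_toFlat hL hz (hk.mul (hu z hz))
  simp only [Pi.mul_apply] at hc
  have hfun : (kCoef h * u) = fun z => kCoef h z * u z := rfl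
  rw [hfun] at hc
  rw [hc.1, hc.2, hm.1, hm.2, kX, kY]
  constructor <;> ring

lemma toProfile_core (hL : 0 < L) {U : Quad L flat} {u : ℝ × ℝ → ℝ} (hU : IsCoreQuad L flat U u) :
    IsCoreQuad L (profile h) (hh.toProfile hL U)
      (fun w => kCoef h (toFlat h w) * u (toFlat h w)) := by
  obtain ⟨h0, h1, h2, h3⟩ := hh.toProfile_spec hL U
  have hd := hU.core.smooth.differentiableOn one_ne_zero
  refine ⟨hh.isCore_toFlat hL hU.core, ?_, ?_, ?_, ?_⟩
  · filter_upwards [h0, hh.ae_comp_toFlat hL hU.fn_eq] with w e0 e1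
    rw [e1] at e0
    exact e0
  · filter_upwards [h1, hh.ae_comp_toFlat hL hU.fn_eq, hh.ae_comp_toFlat hL hU.d1_eq,
      hh.ae_comp_toFlat hL hU.d2_eq, hh.ae_mem_profile] with w e e0 e1 e2 hw
    rw [e0, e1, e2] at e
    have := (hh.pd_toFlat_mul hL hd (hh.toFlat_mem hw)).1
    rw [hh.toPhys_toFlat hw] at this
    rw [this]
    exact e
  · filter_upwards [h2, hh.ae_comp_toFlat hL hU.fn_eq,
      hh.ae_comp_toFlat hL hU.d2_eq, hh.ae_mem_profile] with w e e0 e2 hw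
    rw [e0, e2] at e
    have := (hh.pd_toFlat_mul hL hd (hh.toFlat_mem hw)).2
    rw [hh.toPhys_toFlat hw] at this
    rw [this]
    exact e
  · filter_upwards [h3, hU.tr_eq] with x e e0
    have h1 : ((x, 1) : ℝ × ℝ) ∈ closedStrip flat := ⟨zero_le_one, le_rfl⟩
    have : toFlat h (x, profile h x) = (x, 1) := hh.toFlat_toPhys h1
    rw [this]
    rw [e0] at e
    exact e

lemma ofProfile_core (hL : 0 < L) {V : Quad L (profile h)} {Γ : ℝ × ℝ → ℝ}
    (hV : IsCoreQuad L (profile h) V Γ) :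
    IsCoreQuad L flat (hh.ofProfile hL V) (fun z => pd2 flat h z * Γ (toPhys h z)) := by
  obtain ⟨h0, h1, h2, h3⟩ := hh.ofProfile_spec hL V
  have hcore : IsCore L flat (fun z => pd2 flat h z * Γ (toPhys h z)) := by
    refine ⟨hh.contDiffOn_hp.mul (hV.core.smooth.comp hh.contDiffOn_toPhys
      fun z hz => hh.toPhys_mem hz), fun z hz => ?_, fun z hz => ?_, fun x => ?_⟩
    · have e : toPhys h (z.1 + L, z.2) = ((toPhys h z).1 + L, (toPhys h z).2) :=
        Prod.ext rfl (hh.isPer z.1 z.2 hz)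
      simp only [e, hV.core.periodic _ (hh.toPhys_mem hz)]
      rw [hh.isPer_hp _ _ hz]
    · have e : toPhys h (-z.1, z.2) = (-(toPhys h z).1, (toPhys h z).2) :=
        Prod.ext rfl (hh.isEvn z.1 z.2 hz)
      simp only [e, hV.core.even _ (hh.toPhys_mem hz)]
      rw [hh.isEvn.pd2 hh.differentiableOn _ _ hz]
    · simp only [toPhys, hh.bottom, hV.core.bottom, mul_zero]
  have hd := hcore.smooth.differentiableOn one_ne_zero
  -- Writing Γ as the push-forward of its own pull-back gives its derivatives from `pd_toFlat_mul`;
  -- the resulting relations are then solved for the derivatives of the pull-back.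
  have hΓ : ∀ w ∈ closedStrip (profile h), Γ w = kCoef h (toFlat h w) *
      (pd2 flat h (toFlat h w) * Γ (toPhys h (toFlat h w))) := by
    intro w hw
    rw [← mul_assoc, hh.kCoef_mul_hp (hh.toFlat_mem hw), one_mul, hh.toPhys_toFlat hw]
  have hpd : ∀ z ∈ closedStrip flat, _ := fun z hz => pd_congr (hh.toPhys_mem hz) hΓ
  refine ⟨hcore, ?_, ?_, ?_, ?_⟩
  · filter_upwards [h0, hh.ae_comp_toPhys hL hV.fn_eq] with z e e0
    rw [e0] at e
    exact e
  · filter_upwards [h1, hh.ae_comp_toPhys hL hV.fn_eq, hh.ae_comp_toPhys hL hV.d1_eq,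
      hh.ae_comp_toPhys hL hV.d2_eq, ae_mem_flat] with z e e0 e1 e2 hz
    have hm := hh.pd_toFlat_mul hL hd hz
    rw [← (hpd z hz).1, ← (hpd z hz).2] at hm
    rw [e0, e1, e2, hm.1, hm.2] at e
    refine e.trans ?_
    have hne := hh.hp_ne hz
    have hk : kCoef h z = (pd2 flat h z)⁻¹ := rfl
    rw [kX, kY]
    simp only [hk]
    field_simp
    ring
  · filter_upwards [h2, hh.ae_comp_toPhys hL hV.fn_eq,
      hh.ae_comp_toPhys hL hV.d2_eq, ae_mem_flat] with z e e0 e2 hz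
    have hm := hh.pd_toFlat_mul hL hd hz
    rw [← (hpd z hz).2] at hm
    rw [e0, e2, hm.2] at e
    refine e.trans ?_
    have hne := hh.hp_ne hz
    have hk : kCoef h z = (pd2 flat h z)⁻¹ := rfl
    rw [kY]
    simp only [hk]
    field_simp
    ring
  · filter_upwards [h3, hV.tr_eq] with x e e0
    rw [e0] at e
    exact e

/-- The factors k and h_p are C¹ up to the boundary, even and periodic, because h is C², even and
periodic. Both transports therefore send C¹ representatives to C¹ representatives, and continuity
handles the closures. -/
lemma map_quadEquiv (hL : 0 < L) :
    (H1pe L flat).map (hh.quadEquiv hL).toLinearMap = H1pe L (profile h) := by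
  apply le_antisymm
  · rintro _ ⟨U, hU, rfl⟩
    exact map_H1pe_le (hh.toProfile hL) (fun U u hu => (hh.toProfile_core hL hu).mem_H1pe) U hU
  · intro V hV
    refine ⟨hh.ofProfile hL V, ?_, hh.toProfile_ofProfile hL V⟩
    exact map_H1pe_le (hh.ofProfile hL) (fun U u hu => (hh.ofProfile_core hL hu).mem_H1pe) V hV

end IsWave

end transport

/-! ### The equation and the Jacobian identity -/

section jacobian

open Filter Topology

variable {ω : ℝ → ℝ} {L lam R : ℝ} {h : ℝ × ℝ → ℝ}

/-- Differentiation under the integral sign along translations in the first variable. -/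
lemma hasDerivAt_integral_translate (hL : 0 < L) {α : Type*} [MeasurableSpace α] {μ : Measure α}
    [IsFiniteMeasure μ] {π : α → ℝ × ℝ} (hπ : ∀ᵐ x ∂μ, π x ∈ closedStrip flat)
    (hmeas : ∀ g : ℝ × ℝ → ℝ, ContinuousOn g (closedStrip flat) →
      AEStronglyMeasurable (fun x => g (π x)) μ)
    {W G : ℝ × ℝ → ℝ} (hW : ContinuousOn W (closedStrip flat)) (hWP : IsPer L W)
    (hG : ContDiffOn ℝ 1 G (closedStrip flat)) (hGP : IsPer L G) :
    HasDerivAt (fun a : ℝ => ∫ x, W (π x) * G ((π x).1 + a, (π x).2) ∂μ)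
      (∫ x, W (π x) * pd1 flat G (π x) ∂μ) 0 := by
  obtain ⟨K₁, hK₁, hb₁⟩ := hWP.exists_bound hL hW
  have hd := hG.differentiableOn one_ne_zero
  have hG1 := continuousOn_pd1 uniqueDiffOn_flat hG
  obtain ⟨K₂, hK₂, hb₂⟩ := (hGP.pd1 hd).exists_bound hL hG1
  obtain ⟨K₃, hK₃, hb₃⟩ := hGP.exists_bound hL hG.continuousOn
  have hsh : ∀ (g : ℝ × ℝ → ℝ) (a : ℝ), ContinuousOn g (closedStrip flat) →
      ContinuousOn (fun z : ℝ × ℝ => g (z.1 + a, z.2)) (closedStrip flat) := fun g a hg =>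
    hg.comp (by fun_prop) fun z hz => hz
  have hm : ∀ (g : ℝ × ℝ → ℝ) (a : ℝ), ContinuousOn g (closedStrip flat) →
      AEStronglyMeasurable (fun x => W (π x) * g ((π x).1 + a, (π x).2)) μ := fun g a hg =>
    hmeas _ (hW.mul (hsh g a hg))
  -- Continuous periodic functions on the strip are bounded, so a constant dominates the derivative
  -- for all translations a.
  have key := hasDerivAt_integral_of_dominated_loc_of_deriv_le (μ := μ) (𝕜 := ℝ)
    (F := fun a x => W (π x) * G ((π x).1 + a, (π x).2))
    (F' := fun a x => W (π x) * pd1 flat G ((π x).1 + a, (π x).2))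
    (x₀ := 0) (s := univ) (bound := fun _ => K₁ * K₂) univ_mem
    (Eventually.of_forall fun a => hm G a hG.continuousOn) ?_ (hm _ 0 hG1) ?_
    (integrable_const _) ?_
  · simpa using key.2
  · refine Integrable.mono' (integrable_const (K₁ * K₃)) (hm G 0 hG.continuousOn) ?_
    filter_upwards [hπ] with x hx
    rw [norm_mul]
    exact mul_le_mul (hb₁ _ hx) (hb₃ _ hx) (norm_nonneg _) hK₁.le
  · filter_upwards [hπ] with x hx a _
    rw [norm_mul]
    exact mul_le_mul (hb₁ _ hx) (hb₂ _ hx) (norm_nonneg _) hK₁.le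
  · filter_upwards [hπ] with x hx a _
    have h1 := hasDerivAt_pd1 (q := (π x).1 + a) hx (hd ((π x).1 + a, (π x).2) hx)
    exact (h1.comp_const_add (π x).1 a).const_mul _

lemma integral_shift {g : ℝ → ℝ} (hg : Function.Periodic g L) (a : ℝ) :
    ∫ q in (-L / 2)..(L / 2), g (q + a) = ∫ q in (-L / 2)..(L / 2), g q := by
  rw [intervalIntegral.integral_comp_add_right]
  have := hg.intervalIntegral_add_eq (-L / 2 + a) (-L / 2)
  rw [show -L / 2 + a + L = L / 2 + a by ring, show -L / 2 + L = L / 2 by ring] at this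
  exact this

/-- The integral of the Jacobian of two periodic functions is a boundary integral. -/
lemma integral_jacobian (hL : 0 < L) {F X : ℝ × ℝ → ℝ} (hF : ContDiffOn ℝ 1 F (closedStrip flat))
    (hX : ContDiffOn ℝ 1 X (closedStrip flat)) (hFP : IsPer L F) (hXP : IsPer L X)
    (hX0 : ∀ q, X (q, 0) = 0) :
    ∫ z in cell L flat, (pd2 flat F z * pd1 flat X z - pd1 flat F z * pd2 flat X z)
      = - ∫ q in Ioo (-L / 2) (L / 2), pd1 flat F (q, 1) * X (q, 1) := by
  -- F and X are only C¹, so the mixed second derivatives that cancel when the Jacobian is written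
  -- as a divergence need not exist. Instead X is translated by a in q, integration by parts is done
  -- in p only, and the result is differentiated in a.
  have hFd := hF.differentiableOn one_ne_zero
  have hXd := hX.differentiableOn one_ne_zero
  have hF1 := continuousOn_pd1 uniqueDiffOn_flat hF
  have hF2 := continuousOn_pd2 uniqueDiffOn_flat hF
  have hX1 := continuousOn_pd1 uniqueDiffOn_flat hX
  have hX2 := continuousOn_pd2 uniqueDiffOn_flat hX
  have h1 : (1 : ℝ) ∈ Icc (0 : ℝ) 1 := ⟨zero_le_one, le_rfl⟩
  have hLL : -L / 2 ≤ L / 2 := by linarith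
  have hfin : IsFiniteMeasure ((volume : Measure (ℝ × ℝ)).restrict (cell L flat)) := by
    refine ⟨?_⟩
    rw [Measure.restrict_apply_univ, cell_flat, Measure.volume_eq_prod, Measure.prod_prod]
    simp
  have hint : ∀ g : ℝ × ℝ → ℝ, ContinuousOn g (closedStrip flat) →
      IntegrableOn g (cell L flat) := fun g hg => by
    rw [cell_flat]; exact integrableOn_box (continuousOn_box hg _ _)
  have hmeas : ∀ g : ℝ × ℝ → ℝ, ContinuousOn g (closedStrip flat) →
      AEStronglyMeasurable (fun x => g (id x)) (volume.restrict (cell L flat)) :=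
    fun g hg => (hint g hg).1
  have hmeasT : ∀ g : ℝ × ℝ → ℝ, ContinuousOn g (closedStrip flat) →
      AEStronglyMeasurable (fun q : ℝ => g (q, 1)) (volume.restrict (Ioo (-L / 2) (L / 2))) :=
    fun g hg => (hg.comp_continuous (by fun_prop) fun x => h1).aestronglyMeasurable
  have hsh : ∀ (g : ℝ × ℝ → ℝ) (a : ℝ), ContinuousOn g (closedStrip flat) →
      ContinuousOn (fun z : ℝ × ℝ => g (z.1 + a, z.2)) (closedStrip flat) := fun g a hg =>
    hg.comp (by fun_prop) fun z hz => hz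
  -- three differentiations under the integral sign
  have D1 := hasDerivAt_integral_translate hL (π := id) ae_mem_flat hmeas hF2
    (hFP.pd2 hFd) hX hXP
  have D2 := hasDerivAt_integral_translate hL (π := id) ae_mem_flat hmeas hX2
    (hXP.pd2 hXd) hF hFP
  have D3 := hasDerivAt_integral_translate hL (μ := volume.restrict (Ioo (-L / 2) (L / 2)))
    (π := fun q => (q, 1)) (ae_of_all _ fun q => h1) hmeasT hX.continuousOn hXP hF hFP
  simp only [id] at D1 D2
  -- integration by parts in `p` and a shift in `q`
  have hparts : ∀ a : ℝ, ∫ z in cell L flat, pd2 flat F z * X (z.1 + a, z.2)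
      = (∫ q in Ioo (-L / 2) (L / 2), X (q, 1) * F (q + -a, 1))
        - ∫ z in cell L flat, pd2 flat X z * F (z.1 + -a, z.2) := by
    intro a
    have c1 := hF2.mul (hsh X a hX.continuousOn)
    have c2 := hF.continuousOn.mul (hsh _ a hX2)
    have c3 := hX2.mul (hsh F (-a) hF.continuousOn)
    have e1 := integral_cell hL c1
    have e3 := integral_cell hL c3
    simp only [Pi.mul_apply] at e1 e3
    rw [e1, e3, integral_Ioo_eq hLL]
    have hin : ∀ q, ∫ p in (0 : ℝ)..1, pd2 flat F (q, p) * X (q + a, p)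
        = F (q, 1) * X (q + a, 1) - ∫ p in (0 : ℝ)..1, F (q, p) * pd2 flat X (q + a, p) := by
      intro q
      have hq : q ∈ Icc q q := ⟨le_rfl, le_rfl⟩
      have i1 := ((continuousOn_box c1 q q).slice_right hq).intervalIntegrable_of_Icc (μ := volume)
        zero_le_one
      have i2 := ((continuousOn_box c2 q q).slice_right hq).intervalIntegrable_of_Icc (μ := volume)
        zero_le_one
      simp only [Pi.mul_apply] at i1 i2
      have hprod := (continuousOn_box (hF.continuousOn.mul (hsh X a hX.continuousOn)) q q).slice_right hq
      simp only [Pi.mul_apply] at hprod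
      rw [eq_sub_iff_add_eq, ← intervalIntegral.integral_add i1 i2,
        intervalIntegral.integral_eq_sub_of_hasDerivAt_of_le zero_le_one hprod (fun p hp => ?_)
        (i1.add i2), hX0, mul_zero, sub_zero]
      have hp' := Ioo_subset_Icc_self hp
      exact (hasDerivAt_pd2 hp (hFd (q, p) hp')).mul (hasDerivAt_pd2 hp (hXd (q + a, p) hp'))
    simp only [hin]
    have i4 : IntervalIntegrable (fun q => F (q, 1) * X (q + a, 1)) volume (-L / 2) (L / 2) := by
      have := (continuousOn_box (hF.continuousOn.mul (hsh X a hX.continuousOn)) (-L / 2)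
        (L / 2)).slice_left h1
      exact this.intervalIntegrable_of_Icc hLL
    have i5 : IntervalIntegrable (fun q => ∫ p in (0 : ℝ)..1, F (q, p) * pd2 flat X (q + a, p))
        volume (-L / 2) (L / 2) :=
      (continuousOn_integral_right hLL zero_le_one
        (continuousOn_box c2 _ _)).intervalIntegrable_of_Icc hLL
    rw [intervalIntegral.integral_sub i4 i5]
    congr 1
    · have hper : Function.Periodic (fun q => X (q, 1) * F (q + -a, 1)) L := fun q => by
        simp only
        rw [hXP q 1 h1, show q + L + -a = q + -a + L by ring, hFP _ 1 h1]
      rw [← integral_shift hper a]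
      refine intervalIntegral.integral_congr fun q _ => ?_
      rw [show q + a + -a = q by ring]; ring
    · have hper : Function.Periodic
          (fun q => ∫ p in (0 : ℝ)..1, pd2 flat X (q, p) * F (q + -a, p)) L := fun q => by
        refine intervalIntegral.integral_congr fun p hp => ?_
        rw [uIcc_of_le zero_le_one] at hp
        rw [hXP.pd2 hXd q p hp, show q + L + -a = q + -a + L by ring, hFP _ p hp]
      rw [← integral_shift hper a]
      refine intervalIntegral.integral_congr fun q _ => ?_
      refine intervalIntegral.integral_congr fun p _ => ?_
      rw [show q + a + -a = q by ring]; ring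
  simp only [hparts] at D1
  have hneg : HasDerivAt (fun a : ℝ => -a) (-1) 0 := hasDerivAt_neg 0
  have D2' := HasDerivAt.comp (0 : ℝ) (by simpa using D2) hneg
  have D3' := HasDerivAt.comp (0 : ℝ) (by simpa using D3) hneg
  -- Two expressions for the derivative at a = 0 of one function: ∫ F_p X_q equals ∫ X_p F_q minus
  -- the top integral of X F_q. The signs come from the translation of F by -a.
  have := D1.unique (D3'.sub D2')
  have hI1 : IntegrableOn (fun z => pd2 flat F z * pd1 flat X z) (cell L flat) :=
    hint _ (hF2.mul hX1)
  have hI2 : IntegrableOn (fun z => pd1 flat F z * pd2 flat X z) (cell L flat) :=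
    hint _ (hF1.mul hX2)
  rw [integral_sub hI1 hI2, this]
  simp only [mul_neg, mul_one, sub_neg_eq_add]
  have e1 : ∫ z in cell L flat, pd1 flat F z * pd2 flat X z
      = ∫ z in cell L flat, pd2 flat X z * pd1 flat F z := by simp only [mul_comm]
  have e2 : ∫ q in Ioo (-L / 2) (L / 2), pd1 flat F (q, 1) * X (q, 1)
      = ∫ q in Ioo (-L / 2) (L / 2), X (q, 1) * pd1 flat F (q, 1) := by simp only [mul_comm]
  rw [e1, e2]
  ring

namespace IsWave

variable (hh : IsWave ω L lam R h)
include hh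

lemma differentiableOn_fCoef : DifferentiableOn ℝ (fCoef h) (closedStrip flat) :=
  hh.contDiffOn_fCoef.differentiableOn one_ne_zero

/-- The water wave equation in terms of `k` and `F`, up to the boundary. -/
lemma equation (hω : ContDiffOn ℝ 1 ω (Icc 0 1)) {z : ℝ × ℝ} (hz : z ∈ closedStrip flat) :
    kY h z + lam ^ 2 * (fCoef h z * pd2 flat (fCoef h) z + pd1 flat (fCoef h) z) + ω z.2 = 0 := by
  have hF1 := continuousOn_pd1 uniqueDiffOn_flat hh.contDiffOn_fCoef
  have hF2 := continuousOn_pd2 uniqueDiffOn_flat hh.contDiffOn_fCoef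
  have hc : ContinuousOn (fun z => kY h z
      + lam ^ 2 * (fCoef h z * pd2 flat (fCoef h) z + pd1 flat (fCoef h) z) + ω z.2)
      (closedStrip flat) :=
    (hh.continuousOn_kY.add (continuousOn_const.mul
      ((hh.contDiffOn_fCoef.continuousOn.mul hF2).add hF1))).add
      (hω.continuousOn.comp continuousOn_snd fun z hz => hz)
  have hin : ∀ z ∈ _root_.interior (closedStrip flat), kY h z
      + lam ^ 2 * (fCoef h z * pd2 flat (fCoef h) z + pd1 flat (fCoef h) z) + ω z.2 = 0 := by
    rintro ⟨q, p⟩ hz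
    rw [flat_eq_prod, interior_prod_eq, interior_univ, interior_Icc] at hz
    have hp : p ∈ Ioo (0 : ℝ) 1 := hz.2
    have hp' := Ioo_subset_Icc_self hp
    have hz' : ((q, p) : ℝ × ℝ) ∈ closedStrip flat := hp'
    have hu := uniqueDiffOn_flat _ hz'
    have heq := hh.interior q p hp
    -- In the variables k and F the quotient h_q / h_p is -F, and (1 + λ²h_q²) / (2h_p²) is k²/2 +
    -- λ²F²/2.
    have e1 : (fun z => pd1 flat h z / pd2 flat h z) = fun z => -1 * fCoef h z := by
      ext z; simp only [fCoef, kCoef]; ring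
    have e2 : (fun z : ℝ × ℝ => (1 + lam ^ 2 * pd1 flat h z ^ 2) / (2 * pd2 flat h z ^ 2)
        + ∫ τ in (0 : ℝ)..z.2, ω τ) = fun z => (1 / 2 * (kCoef h z * kCoef h z)
          + lam ^ 2 / 2 * (fCoef h z * fCoef h z)) + ∫ τ in (0 : ℝ)..z.2, ω τ := by
      ext z
      simp only [fCoef, kCoef]
      ring
    have hk := hh.differentiableOn_kCoef _ hz'
    have hF := hh.differentiableOn_fCoef _ hz'
    have hωi : HasDerivAt (fun p => ∫ τ in (0 : ℝ)..p, ω τ) (ω p) p := by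
      refine intervalIntegral.integral_hasDerivAt_right ?_ ?_ ?_
      · exact (hω.continuousOn.mono (Icc_subset_Icc le_rfl hp.2.le)).intervalIntegrable_of_Icc hp.1.le
      · exact (hω.continuousOn.mono Ioo_subset_Icc_self).stronglyMeasurableAtFilter isOpen_Ioo p hp
      · exact hω.continuousOn.continuousAt (Icc_mem_nhds hp.1 hp.2)
    have hωd : DifferentiableWithinAt ℝ (fun z : ℝ × ℝ => ∫ τ in (0 : ℝ)..z.2, ω τ)
        (closedStrip flat) (q, p) :=
      (DifferentiableAt.comp (q, p) (f := Prod.snd) (g := fun p => ∫ τ in (0 : ℝ)..p, ω τ)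
        hωi.differentiableAt differentiableAt_snd).differentiableWithinAt
    have hω2 : pd2 flat (fun z : ℝ × ℝ => ∫ τ in (0 : ℝ)..z.2, ω τ) (q, p) = ω p :=
      pd2_eq_of_hasDerivWithinAt hp' hωd hωi.hasDerivWithinAt
    have hkk : DifferentiableWithinAt ℝ (fun z => kCoef h z * kCoef h z) (closedStrip flat) (q, p) :=
      hk.mul hk
    have hFF : DifferentiableWithinAt ℝ (fun z => fCoef h z * fCoef h z) (closedStrip flat) (q, p) :=
      hF.mul hF
    have hkk' : DifferentiableWithinAt ℝ (fun z => 1 / 2 * (kCoef h z * kCoef h z))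
        (closedStrip flat) (q, p) := hkk.const_mul _
    have hFF' : DifferentiableWithinAt ℝ (fun z => lam ^ 2 / 2 * (fCoef h z * fCoef h z))
        (closedStrip flat) (q, p) := hFF.const_mul _
    have hsum : DifferentiableWithinAt ℝ (fun z => 1 / 2 * (kCoef h z * kCoef h z)
        + lam ^ 2 / 2 * (fCoef h z * fCoef h z)) (closedStrip flat) (q, p) := hkk'.add hFF'
    rw [e1, e2, (pd_const_mul hu (-1) hF).1, (pd_add hu hsum hωd).2,
      (pd_add hu hkk' hFF').2, (pd_const_mul hu (1 / 2) hkk).2,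
      (pd_const_mul hu (lam ^ 2 / 2) hFF).2, (pd_mul hu hk hk).2, (pd_mul hu hF hF).2, hω2] at heq
    rw [kY]
    linear_combination heq
  -- As h is C² up to the boundary, every term is continuous there and the equation extends from the
  -- interior; the surface terms need it at p = 1.
  exact Set.EqOn.of_subset_closure hin hc continuousOn_const interior_subset
    flat_subset_closure_interior hz

end IsWave

end jacobian

/-! ### Surface coefficients -/

section surface

open Filter Topology

variable {ω : ℝ → ℝ} {L lam R : ℝ} {h : ℝ × ℝ → ℝ}

lemma top_mem (x : ℝ) : ((x, 1) : ℝ × ℝ) ∈ closedStrip flat := ⟨zero_le_one, le_rfl⟩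

lemma arc_pos (h : ℝ × ℝ → ℝ) (x : ℝ) : 0 < arc h x := by
  rw [arc]; positivity

namespace IsWave

variable (hh : IsWave ω L lam R h)
include hh

/-- Symmetry of the second derivatives, up to the boundary. -/
lemma pd_comm {z : ℝ × ℝ} (hz : z ∈ closedStrip flat) :
    pd1 flat (pd2 flat h) z = pd2 flat (pd1 flat h) z := by
  have hsym := (hh.smooth z hz).isSymmSndFDerivWithinAt (n := 2)
    (by simp) uniqueDiffOn_flat (flat_subset_closure_interior hz) hz
  have hd : DifferentiableWithinAt ℝ (fderivWithin ℝ h (closedStrip flat)) (closedStrip flat) z :=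
    (hh.smooth.fderivWithin uniqueDiffOn_flat (m := 1)
      (by simp [one_add_one_eq_two])).differentiableOn one_ne_zero z hz
  have hu := uniqueDiffOn_flat z hz
  have e : ∀ v w : ℝ × ℝ, fderivWithin ℝ (fun z => fderivWithin ℝ h (closedStrip flat) z v)
      (closedStrip flat) z w
      = fderivWithin ℝ (fderivWithin ℝ h (closedStrip flat)) (closedStrip flat) z w v := by
    intro v w
    rw [fderivWithin_clm_apply hu hd (differentiableWithinAt_const v)]
    simp
  have h1 : pd1 flat (pd2 flat h) z = _ := e (0, 1) (1, 0)
  have h2 : pd2 flat (pd1 flat h) z = _ := e (1, 0) (0, 1)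
  rw [h1, h2]
  exact hsym.eq _ _

/-- `ψ_yx = ψ_xy` in the `(q,p)` variables. -/
lemma kX_eq {z : ℝ × ℝ} (hz : z ∈ closedStrip flat) :
    kX h z = kCoef h z * pd2 flat (fCoef h) z := by
  have hu := uniqueDiffOn_flat z hz
  have hk := hh.differentiableOn_kCoef z hz
  have hq := hh.contDiffOn_hq.differentiableOn one_ne_zero z hz
  have hp := hh.contDiffOn_hp.differentiableOn one_ne_zero z hz
  have hone : ∀ z ∈ closedStrip flat, kCoef h z * pd2 flat h z = 1 := fun z hz =>
    hh.kCoef_mul_hp hz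
  -- Differentiating k h_p = 1 in q expresses k_q through h_pq, which equals the h_qp occurring in
  -- F_p.
  have h1 : pd1 flat (fun z => kCoef h z * pd2 flat h z) z = 0 := by
    rw [(pd_congr hz hone).1]; simp [pd1]
  rw [(pd_mul hu hk hp).1] at h1
  have hqk : DifferentiableWithinAt ℝ (fun z => pd1 flat h z * kCoef h z) (closedStrip flat) z :=
    hq.mul hk
  have hF : fCoef h = fun z => -1 * (pd1 flat h z * kCoef h z) := by
    ext z; simp [fCoef]
  have h2 : pd2 flat (fCoef h) z
      = -1 * (pd1 flat h z * pd2 flat (kCoef h) z + kCoef h z * pd2 flat (pd1 flat h) z) := by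
    rw [hF, (pd_const_mul hu (-1) hqk).2, (pd_mul hu hq hk).2]
  rw [hh.pd_comm hz] at h1
  rw [kX, h2, fCoef]
  have hk1 := hone z hz
  linear_combination (kCoef h z) * h1 - (pd1 flat (kCoef h) z) * hk1

/-- On the surface ψ_x = -η' ψ_y, since ψ is constant along it; hence |∇ψ| = ψ_y √(1 + η'²). -/
lemma speed_eq (hL : 0 < L) (x : ℝ) : speed h x = kCoef h (x, 1) * arc h x := by
  have hz := top_mem x
  have e1 : streamX h (x, profile h x) = fCoef h (x, 1) := hh.streamX_toPhys hL hz
  have e2 : streamY h (x, profile h x) = kCoef h (x, 1) := hh.streamY_toPhys hL hz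
  rw [speed, arc, e1, e2, (hh.hasDerivAt_profile x).deriv, fCoef]
  rw [show (-(pd1 flat h (x, 1) * kCoef h (x, 1))) ^ 2 + kCoef h (x, 1) ^ 2
    = kCoef h (x, 1) ^ 2 * (1 + pd1 flat h (x, 1) ^ 2) by ring, Real.sqrt_mul (sq_nonneg _),
    Real.sqrt_sq (hh.kCoef_pos hz).le]

lemma pd_streamX (hL : 0 < L) {z : ℝ × ℝ} (hz : z ∈ closedStrip flat) :
    pd2 (profile h) (streamX h) (toPhys h z) = kCoef h z * pd2 flat (fCoef h) z := by
  have : ∀ w ∈ closedStrip (profile h), streamX h w = fCoef h (toFlat h w) := by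
    intro w hw
    have := hh.streamX_toPhys hL (hh.toFlat_mem hw)
    rwa [hh.toPhys_toFlat hw] at this
  rw [(pd_congr (hh.toPhys_mem hz) this).2]
  exact (hh.pd_comp_toFlat hL hz (hh.differentiableOn_fCoef z hz)).2

lemma pd_streamY (hL : 0 < L) {z : ℝ × ℝ} (hz : z ∈ closedStrip flat) :
    pd2 (profile h) (streamY h) (toPhys h z) = kY h z := by
  have : ∀ w ∈ closedStrip (profile h), streamY h w = kCoef h (toFlat h w) := by
    intro w hw
    have := hh.streamY_toPhys hL (hh.toFlat_mem hw)
    rwa [hh.toPhys_toFlat hw] at this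
  rw [(pd_congr (hh.toPhys_mem hz) this).2]
  exact (hh.pd_comp_toFlat hL hz (hh.differentiableOn_kCoef z hz)).2

/-- `ρ` times the arc length density, in the `(q,p)` variables. -/
lemma rho_mul_arc (hL : 0 < L) (x : ℝ) : rho lam h x * arc h x =
    (1 + lam ^ 2 * (fCoef h (x, 1) * (kCoef h (x, 1) * pd2 flat (fCoef h) (x, 1)))
      + kCoef h (x, 1) * kY h (x, 1)) * (pd2 flat h (x, 1) * pd2 flat h (x, 1)) := by
  have hz := top_mem x
  have e1 : streamX h (x, profile h x) = fCoef h (x, 1) := hh.streamX_toPhys hL hz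
  have e2 : streamY h (x, profile h x) = kCoef h (x, 1) := hh.streamY_toPhys hL hz
  have e3 : pd2 (profile h) (streamX h) (x, profile h x) = _ := hh.pd_streamX hL hz
  have e4 : pd2 (profile h) (streamY h) (x, profile h x) = _ := hh.pd_streamY hL hz
  rw [rho, e1, e2, e3, e4, hh.speed_eq hL]
  have hk : kCoef h (x, 1) = (pd2 flat h (x, 1))⁻¹ := rfl
  have hp := hh.hp_ne hz
  have ha := (arc_pos h x).ne'
  rw [hk]
  field_simp

/-- By `speed_eq` the arc length density cancels. As the traces satisfy Γ = k u, the two weights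
turn into k² and 1 on p = 1. -/
lemma weight_arc (hL : 0 < L) (x : ℝ) :
    streamY h (x, profile h x) / speed h x * arc h x = 1 ∧
    1 / (streamY h (x, profile h x) * speed h x) * arc h x
      = pd2 flat h (x, 1) * pd2 flat h (x, 1) := by
  have hz := top_mem x
  have e2 : streamY h (x, profile h x) = kCoef h (x, 1) := hh.streamY_toPhys hL hz
  have hk : kCoef h (x, 1) = (pd2 flat h (x, 1))⁻¹ := rfl
  have hp := hh.hp_ne hz
  have ha := (arc_pos h x).ne'
  rw [e2, hh.speed_eq hL, hk]
  constructor <;> field_simp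

/-- The Jacobian h_p and the weight 1/ψ_y = h_p cancel the factor k² in Γφ = k² u v. -/
lemma massD_toProfile (hL : 0 < L) (U V : Quad L flat) :
    massD L h (hh.toProfile hL U) (hh.toProfile hL V) = massQ L U V := by
  rw [massD, massQ, hh.integral_cell_profile]
  refine integral_congr_ae ?_
  filter_upwards [(hh.toProfile_toPhys hL U).1, (hh.toProfile_toPhys hL V).1, ae_mem_flat]
    with z e1 e2 hz
  rw [e1, e2, hh.streamY_toPhys hL hz]
  have hk : kCoef h z = (pd2 flat h z)⁻¹ := rfl
  have hp := hh.hp_ne hz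
  rw [hk]
  field_simp

lemma topD_toProfile (hL : 0 < L) (β : ℝ → ℝ) (U V : Quad L flat) :
    topD L h β (hh.toProfile hL U) (hh.toProfile hL V)
      = ∫ x in Ioo (-L / 2) (L / 2),
        (β x * arc h x) * (kCoef h (x, 1) * kCoef h (x, 1)) * tr U x * tr V x := by
  rw [topD]
  refine integral_congr_ae ?_
  obtain ⟨-, -, -, hU⟩ := hh.toProfile_spec hL U
  obtain ⟨-, -, -, hV⟩ := hh.toProfile_spec hL V
  filter_upwards [hU, hV] with x e1 e2
  rw [e1, e2]
  ring

end IsWave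

/-! ### Forms on quadruples -/

lemma IsCoef.exists_form {α E : Type*} [MeasurableSpace α] {μ : Measure α} {c : α → ℝ}
    [NormedAddCommGroup E] [NormedSpace ℝ E] (hc : IsCoef μ c) (p q : E →L[ℝ] Lp ℝ 2 μ) :
    ∃ B : E →L[ℝ] E →L[ℝ] ℝ, ∀ U V, B U V = ∫ y, c y * p U y * q V y ∂μ := by
  obtain ⟨m, K, hK⟩ := hc
  obtain ⟨B, hB⟩ := exists_weightedForm m hK
  exact ⟨B.bilinearComp p q, fun U V => hB (p U) (q V)⟩

lemma IsCoef.integrable {α : Type*} [MeasurableSpace α] {μ : Measure α} {c : α → ℝ}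
    (hc : IsCoef μ c) (f g : Lp ℝ 2 μ) : Integrable (fun y => c y * f y * g y) μ := by
  obtain ⟨m, K, hK⟩ := hc
  exact integrable_weighted m hK f g

/-- First order forms with bounded coefficients are continuous. -/
lemma exists_quadForm {η : ℝ → ℝ} {c₀₀ c₁₁ c₁₂ c₂₁ c₂₂ : ℝ × ℝ → ℝ} {e : ℝ → ℝ}
    (h₀₀ : IsCoef (volume.restrict (cell L η)) c₀₀)
    (h₁₁ : IsCoef (volume.restrict (cell L η)) c₁₁)
    (h₁₂ : IsCoef (volume.restrict (cell L η)) c₁₂)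
    (h₂₁ : IsCoef (volume.restrict (cell L η)) c₂₁)
    (h₂₂ : IsCoef (volume.restrict (cell L η)) c₂₂)
    (he : IsCoef (volume.restrict (Ioo (-L / 2) (L / 2))) e) :
    ∃ B : Quad L η →L[ℝ] Quad L η →L[ℝ] ℝ, ∀ U V, B U V =
      (∫ z in cell L η, (c₀₀ z * fn U z * fn V z + c₁₁ z * d1 U z * d1 V z
        + c₁₂ z * d1 U z * d2 V z + c₂₁ z * d2 U z * d1 V z + c₂₂ z * d2 U z * d2 V z))
      + ∫ x in Ioo (-L / 2) (L / 2), e x * tr U x * tr V x := by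
  let p₀ : Quad L η →L[ℝ] Lp ℝ 2 (volume.restrict (cell L η)) := ContinuousLinearMap.fst ℝ _ _
  let p₁ : Quad L η →L[ℝ] Lp ℝ 2 (volume.restrict (cell L η)) :=
    (ContinuousLinearMap.fst ℝ _ _).comp (ContinuousLinearMap.snd ℝ _ _)
  let p₂ : Quad L η →L[ℝ] Lp ℝ 2 (volume.restrict (cell L η)) :=
    (ContinuousLinearMap.fst ℝ _ _).comp
      ((ContinuousLinearMap.snd ℝ _ _).comp (ContinuousLinearMap.snd ℝ _ _))
  let p₃ : Quad L η →L[ℝ] Lp ℝ 2 (volume.restrict (Ioo (-L / 2) (L / 2))) :=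
    (ContinuousLinearMap.snd ℝ _ _).comp
      ((ContinuousLinearMap.snd ℝ _ _).comp (ContinuousLinearMap.snd ℝ _ _))
  obtain ⟨B₀₀, b₀₀⟩ := h₀₀.exists_form p₀ p₀
  obtain ⟨B₁₁, b₁₁⟩ := h₁₁.exists_form p₁ p₁
  obtain ⟨B₁₂, b₁₂⟩ := h₁₂.exists_form p₁ p₂
  obtain ⟨B₂₁, b₂₁⟩ := h₂₁.exists_form p₂ p₁
  obtain ⟨B₂₂, b₂₂⟩ := h₂₂.exists_form p₂ p₂
  obtain ⟨Be, be⟩ := he.exists_form p₃ p₃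
  refine ⟨B₀₀ + B₁₁ + B₁₂ + B₂₁ + B₂₂ + Be, fun U V => ?_⟩
  simp only [_root_.add_apply, b₀₀, b₁₁, b₁₂, b₂₁, b₂₂, be]
  have i₀₀ := h₀₀.integrable U.1 V.1
  have i₁₁ := h₁₁.integrable U.2.1 V.2.1
  have i₁₂ := h₁₂.integrable U.2.1 V.2.2.1
  have i₂₁ := h₂₁.integrable U.2.2.1 V.2.1
  have i₂₂ := h₂₂.integrable U.2.2.1 V.2.2.1
  have i1 := integral_add i₀₀ i₁₁
  have i2 := integral_add (i₀₀.add i₁₁) i₁₂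
  have i3 := integral_add ((i₀₀.add i₁₁).add i₁₂) i₂₁
  have i4 := integral_add (((i₀₀.add i₁₁).add i₁₂).add i₂₁) i₂₂
  simp only [Pi.add_apply] at i2 i3 i4
  unfold fn d1 d2 tr
  rw [i4, i3, i2, i1]
  rfl

end surface

/-! ### Transformation of the quadratic form -/

section transform

open Filter Topology

variable {ω : ℝ → ℝ} {L lam R : ℝ} {h : ℝ × ℝ → ℝ}

lemma integrableOn_cell_flat {g : ℝ × ℝ → ℝ} (hg : ContinuousOn g (closedStrip flat)) :
    IntegrableOn g (cell L flat) := by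
  rw [cell_flat]; exact integrableOn_box (continuousOn_box hg _ _)

lemma integrableOn_top {g : ℝ × ℝ → ℝ} (hg : ContinuousOn g (closedStrip flat)) :
    IntegrableOn (fun q => g (q, 1)) (Ioo (-L / 2) (L / 2)) :=
  (hg.comp_continuous (by fun_prop) top_mem).integrableOn_Icc.mono_set Ioo_subset_Icc_self

lemma integral_add_mul_sub {α : Type*} [MeasurableSpace α] {μ : Measure α} {f g e : α → ℝ}
    (hf : Integrable f μ) (hg : Integrable g μ) (he : Integrable e μ) (c : ℝ) :
    ∫ x, (f x + c * g x - e x) ∂μ = (∫ x, f x ∂μ) + c * (∫ x, g x ∂μ) - ∫ x, e x ∂μ := by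
  rw [← integral_const_mul, ← integral_add hf (hg.const_mul c)]
  exact integral_sub (hf.add (hg.const_mul c)) he

lemma IsCore.isPer {u : ℝ × ℝ → ℝ} (hu : IsCore L flat u) : IsPer L u :=
  fun q p hp => hu.periodic (q, p) hp

/-- Integration by parts in the second variable. -/
lemma integral_deriv_mul (hL : 0 < L) (hω : ContDiffOn ℝ 1 ω (Icc 0 1)) {X : ℝ × ℝ → ℝ}
    (hX : ContDiffOn ℝ 1 X (closedStrip flat)) (hX0 : ∀ q, X (q, 0) = 0) :
    ∫ z in cell L flat, (ω z.2 * pd2 flat X z + derivWithin ω (Icc 0 1) z.2 * X z)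
      = ∫ q in Ioo (-L / 2) (L / 2), ω 1 * X (q, 1) := by
  have hXd := hX.differentiableOn one_ne_zero
  have hω' := hω.continuousOn_derivWithin (uniqueDiffOn_Icc zero_lt_one) le_rfl
  have c1 : ContinuousOn (fun z : ℝ × ℝ => ω z.2) (closedStrip flat) :=
    hω.continuousOn.comp continuousOn_snd fun z hz => hz
  have c2 : ContinuousOn (fun z : ℝ × ℝ => derivWithin ω (Icc 0 1) z.2) (closedStrip flat) :=
    hω'.comp continuousOn_snd fun z hz => hz
  have c3 : ContinuousOn (fun z => ω z.2 * pd2 flat X z + derivWithin ω (Icc 0 1) z.2 * X z)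
      (closedStrip flat) :=
    (c1.mul (continuousOn_pd2 uniqueDiffOn_flat hX)).add (c2.mul hX.continuousOn)
  rw [integral_cell hL c3, integral_Ioo_eq (by linarith)]
  refine intervalIntegral.integral_congr fun q _ => ?_
  have hq : q ∈ Icc q q := ⟨le_rfl, le_rfl⟩
  have i1 := ((continuousOn_box c3 q q).slice_right hq).intervalIntegrable_of_Icc (μ := volume)
    zero_le_one
  have hprod := (continuousOn_box (c1.mul hX.continuousOn) q q).slice_right hq
  simp only [Pi.mul_apply] at hprod
  simp only
  rw [intervalIntegral.integral_eq_sub_of_hasDerivAt_of_le zero_le_one hprod (fun p hp => ?_) i1,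
    hX0, mul_zero, sub_zero]
  have hp' := Ioo_subset_Icc_self hp
  have hd : HasDerivAt ω (derivWithin ω (Icc 0 1) p) p :=
    ((hω.differentiableOn one_ne_zero) p hp').hasDerivWithinAt.hasDerivAt (Icc_mem_nhds hp.1 hp.2)
  have := hd.mul (hasDerivAt_pd2 hp (hXd (q, p) hp'))
  exact this.congr_deriv (by ring)

/-- The integrand of `formQ`. -/
def densQ (lam : ℝ) (h : ℝ × ℝ → ℝ) (z : ℝ × ℝ) (u₁ u₂ v₁ v₂ : ℝ) : ℝ :=
  ((1 + lam ^ 2 * pd1 flat h z ^ 2) / pd2 flat h z ^ 3 * u₂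
        - lam ^ 2 * pd1 flat h z / pd2 flat h z ^ 2 * u₁) * v₂
      + lam ^ 2 * (u₁ / pd2 flat h z - pd1 flat h z / pd2 flat h z ^ 2 * u₂) * v₁

namespace IsWave

variable (hh : IsWave ω L lam R h)
include hh

/-- Here u_q + F u_p and k u_p are the physical derivatives of u in x and in y. In this form
symmetry and ellipticity are visible. -/
lemma densQ_eq {z : ℝ × ℝ} (hz : z ∈ closedStrip flat) (u₁ u₂ v₁ v₂ : ℝ) :
    densQ lam h z u₁ u₂ v₁ v₂ = kCoef h z * (lam ^ 2 * (u₁ + fCoef h z * u₂) * (v₁ + fCoef h z * v₂)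
      + kCoef h z ^ 2 * u₂ * v₂) := by
  have hp := hh.hp_ne hz
  have hk : kCoef h z = (pd2 flat h z)⁻¹ := rfl
  rw [densQ, fCoef, hk]
  field_simp
  ring

/-- On functions that are `C¹` up to the boundary, `u ↦ Γ` transforms `formQ` into `formD`. -/
lemma formD_toProfile_core (hL : 0 < L) (hω : ContDiffOn ℝ 1 ω (Icc 0 1)) {U V : Quad L flat}
    {u v : ℝ × ℝ → ℝ} (hU : IsCoreQuad L flat U u) (hV : IsCoreQuad L flat V v) :
    formD ω L lam h (hh.toProfile hL U) (hh.toProfile hL V) = formQ L lam h U V := by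
  set k := kCoef h with hkdef
  set F := fCoef h with hFdef
  -- With this X, the integrand of `formD` times the Jacobian h_p exceeds that of `formQ` by λ²(F_p
  -- X_q - F_q X_p) - (ω X)_p.
  let X : ℝ × ℝ → ℝ := fun z => k z * (u z * v z)
  have hus := hU.core.smooth
  have hvs := hV.core.smooth
  have huv : ContDiffOn ℝ 1 (fun z => u z * v z) (closedStrip flat) := hus.mul hvs
  have hX : ContDiffOn ℝ 1 X (closedStrip flat) := hh.contDiffOn_kCoef.mul huv
  have hXP : IsPer L X := hh.isPer_kCoef.mul (hU.core.isPer.mul hV.core.isPer)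
  have hX0 : ∀ q, X (q, 0) = 0 := fun q => by simp [X, hU.core.bottom]
  have hJ := integral_jacobian hL hh.contDiffOn_fCoef hX hh.isPer_fCoef hXP hX0
  have hI := integral_deriv_mul hL hω hX hX0
  have hω' := hω.continuousOn_derivWithin (uniqueDiffOn_Icc zero_lt_one) le_rfl
  have cω : ContinuousOn (fun z : ℝ × ℝ => ω z.2) (closedStrip flat) :=
    hω.continuousOn.comp continuousOn_snd fun z hz => hz
  have cω' : ContinuousOn (fun z : ℝ × ℝ => derivWithin ω (Icc 0 1) z.2) (closedStrip flat) :=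
    hω'.comp continuousOn_snd fun z hz => hz
  have cF1 := continuousOn_pd1 uniqueDiffOn_flat hh.contDiffOn_fCoef
  have cF2 := continuousOn_pd2 uniqueDiffOn_flat hh.contDiffOn_fCoef
  have cX1 := continuousOn_pd1 uniqueDiffOn_flat hX
  have cX2 := continuousOn_pd2 uniqueDiffOn_flat hX
  have cu1 := continuousOn_pd1 uniqueDiffOn_flat hus
  have cu2 := continuousOn_pd2 uniqueDiffOn_flat hus
  have cv1 := continuousOn_pd1 uniqueDiffOn_flat hvs
  have cv2 := continuousOn_pd2 uniqueDiffOn_flat hvs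
  have ck := hh.contDiffOn_kCoef.continuousOn
  have cF := hh.contDiffOn_fCoef.continuousOn
  have cQ : ContinuousOn (fun z => densQ lam h z (pd1 flat u z) (pd2 flat u z) (pd1 flat v z)
      (pd2 flat v z)) (closedStrip flat) := by
    refine ContinuousOn.congr ?_ fun z hz => hh.densQ_eq hz _ _ _ _
    fun_prop
  have cJ : ContinuousOn (fun z => pd2 flat F z * pd1 flat X z - pd1 flat F z * pd2 flat X z)
      (closedStrip flat) := (cF2.mul cX1).sub (cF1.mul cX2)
  have cI : ContinuousOn (fun z => ω z.2 * pd2 flat X z + derivWithin ω (Icc 0 1) z.2 * X z)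
      (closedStrip flat) := (cω.mul cX2).add (cω'.mul hX.continuousOn)
  have hcell : ∫ w in cell L (profile h), (lam ^ 2 * d1 (hh.toProfile hL U) w
        * d1 (hh.toProfile hL V) w + d2 (hh.toProfile hL U) w * d2 (hh.toProfile hL V) w
        - derivWithin ω (Icc 0 1) (stream h w) * fn (hh.toProfile hL U) w
          * fn (hh.toProfile hL V) w)
      = (∫ z in cell L flat, densQ lam h z (d1 U z) (d2 U z) (d1 V z) (d2 V z))
        - (lam ^ 2 * ∫ q in Ioo (-L / 2) (L / 2), pd1 flat F (q, 1) * X (q, 1))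
        - ∫ q in Ioo (-L / 2) (L / 2), ω 1 * X (q, 1) := by
    have hQ : ∫ z in cell L flat, densQ lam h z (d1 U z) (d2 U z) (d1 V z) (d2 V z)
        = ∫ z in cell L flat, densQ lam h z (pd1 flat u z) (pd2 flat u z) (pd1 flat v z)
          (pd2 flat v z) := by
      refine integral_congr_ae ?_
      filter_upwards [hU.d1_eq, hU.d2_eq, hV.d1_eq, hV.d2_eq] with z e1 e2 e3 e4
      rw [e1, e2, e3, e4]
    have key := integral_add_mul_sub (integrableOn_cell_flat (L := L) cQ)
      (integrableOn_cell_flat cJ) (integrableOn_cell_flat cI) (lam ^ 2)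
    rw [hQ, hh.integral_cell_profile, sub_eq_add_neg _ (lam ^ 2 * _), ← mul_neg, ← hJ, ← hI, ← key]
    refine integral_congr_ae ?_
    obtain ⟨a0, a1, a2⟩ := hh.toProfile_toPhys hL U
    obtain ⟨b0, b1, b2⟩ := hh.toProfile_toPhys hL V
    filter_upwards [a0, a1, a2, b0, b1, b2, hU.fn_eq, hU.d1_eq, hU.d2_eq, hV.fn_eq, hV.d1_eq,
      hV.d2_eq, ae_mem_flat] with z a0 a1 a2 b0 b1 b2 u0 u1 u2 v0 v1 v2 hz
    have hk := hh.differentiableOn_kCoef z hz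
    have hu' := uniqueDiffOn_flat z hz
    have hX' := pd_mul hu' hk (huv.differentiableOn one_ne_zero z hz)
    have huv' := pd_mul hu' (hus.differentiableOn one_ne_zero z hz)
      (hvs.differentiableOn one_ne_zero z hz)
    have hx1 : pd1 flat X z = _ := hX'.1
    have hx2 : pd2 flat X z = _ := hX'.2
    -- The wave equation eliminates ω, and the symmetry relation k_q + F k_p = k F_p eliminates k_q;
    -- what remains is an algebraic identity.
    have heq := hh.equation hω hz
    have hkx := hh.kX_eq hz
    have hkq : pd1 flat (kCoef h) z
        = kCoef h z * pd2 flat (fCoef h) z - fCoef h z * pd2 flat (kCoef h) z := by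
      rw [← hkx, kX]; ring
    have hω0 : ω z.2 = -(kCoef h z * pd2 flat (kCoef h) z
        + lam ^ 2 * (fCoef h z * pd2 flat (fCoef h) z + pd1 flat (fCoef h) z)) := by
      rw [kY] at heq; linarith
    have hpk : pd2 flat h z = (kCoef h z)⁻¹ := by rw [kCoef, inv_inv]
    have hk0 := (hh.kCoef_pos hz).ne'
    rw [a0, a1, a2, b0, b1, b2, u0, u1, u2, v0, v1, v2, hh.stream_toPhys hz, hkx, kY,
      hh.densQ_eq hz, hx1, hx2, huv'.1, huv'.2, hkq, hω0, hpk]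
    simp only [X, hkdef, hFdef]
    field_simp
    ring
  have htop : ∫ x in Ioo (-L / 2) (L / 2), rho lam h x * tr (hh.toProfile hL U) x
        * tr (hh.toProfile hL V) x * arc h x
      = (∫ q in Ioo (-L / 2) (L / 2), tr U q * tr V q)
        - (lam ^ 2 * ∫ q in Ioo (-L / 2) (L / 2), pd1 flat F (q, 1) * X (q, 1))
        - ∫ q in Ioo (-L / 2) (L / 2), ω 1 * X (q, 1) := by
    have hT : ∫ q in Ioo (-L / 2) (L / 2), tr U q * tr V q
        = ∫ q in Ioo (-L / 2) (L / 2), u (q, 1) * v (q, 1) := by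
      refine integral_congr_ae ?_
      filter_upwards [hU.tr_eq, hV.tr_eq] with x e1 e2
      rw [e1, e2]; rfl
    have i1 : IntegrableOn (fun q => u (q, 1) * v (q, 1)) (Ioo (-L / 2) (L / 2)) :=
      integrableOn_top huv.continuousOn
    have i2 : IntegrableOn (fun q => pd1 flat F (q, 1) * X (q, 1)) (Ioo (-L / 2) (L / 2)) :=
      integrableOn_top (cF1.mul hX.continuousOn)
    have i3 : IntegrableOn (fun q => ω 1 * X (q, 1)) (Ioo (-L / 2) (L / 2)) :=
      (integrableOn_top hX.continuousOn).const_mul _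
    have key := integral_add_mul_sub i1 i2 i3 (-lam ^ 2)
    rw [hT, sub_eq_add_neg _ (lam ^ 2 * _), ← neg_mul, ← key]
    refine integral_congr_ae ?_
    obtain ⟨-, -, -, a3⟩ := hh.toProfile_spec hL U
    obtain ⟨-, -, -, b3⟩ := hh.toProfile_spec hL V
    filter_upwards [a3, b3, hU.tr_eq, hV.tr_eq] with x a b e1 e2
    have hz := top_mem x
    have heq := hh.equation hω hz
    have hr := hh.rho_mul_arc hL x
    have hpk : pd2 flat h (x, 1) = (kCoef h (x, 1))⁻¹ := by rw [kCoef, inv_inv]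
    have hk0 := (hh.kCoef_pos hz).ne'
    rw [a, b, e1, e2]
    have e : rho lam h x * (kCoef h (x, 1) * u (x, 1)) * (kCoef h (x, 1) * v (x, 1)) * arc h x
      = (rho lam h x * arc h x) * (kCoef h (x, 1) * u (x, 1)) * (kCoef h (x, 1) * v (x, 1)) := by
      ring
    refine e.trans ?_
    rw [hr, hpk]
    simp only [X, hkdef, hFdef]
    field_simp
    -- The 1 in the numerator of ρ produces u v; everything else is the wave equation at p = 1
    -- multiplied by k u v.
    linear_combination (u (x, 1) * v (x, 1) * kCoef h (x, 1)) * heq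
  rw [formD, formQ, hcell, htop]
  simp only [densQ]
  ring

end IsWave

end transform

/-! ### The forms as continuous bilinear forms -/

section forms

open Filter Topology

variable {ω : ℝ → ℝ} {L lam R : ℝ} {h : ℝ × ℝ → ℝ}

lemma isCoef_const {α : Type*} [MeasurableSpace α] (μ : Measure α) (c : ℝ) :
    IsCoef μ fun _ => c :=
  ⟨aestronglyMeasurable_const, |c|, ae_of_all _ fun _ => le_rfl⟩

lemma exists_massForm (L : ℝ) : ∃ B : Quad L flat →L[ℝ] Quad L flat →L[ℝ] ℝ,
    (∀ U V, B U V = massQ L U V) ∧ ∀ U, B U U = ‖U.1‖ ^ 2 := by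
  let p : Quad L flat →L[ℝ] Lp ℝ 2 (volume.restrict (cell L flat)) := ContinuousLinearMap.fst ℝ _ _
  obtain ⟨B, hB⟩ := (isCoef_const (volume.restrict (cell L flat)) 1).exists_form p p
  have h1 : ∀ U V, B U V = massQ L U V := fun U V => by
    rw [hB, massQ]
    simp only [one_mul]
    rfl
  refine ⟨B, h1, fun U => ?_⟩
  rw [h1, norm_sq_eq_integral U.1 (ae_eq_refl _), massQ]
  simp only [sq]
  rfl

/-- Weighted boundary forms. -/
lemma exists_topForm (L : ℝ) {w : ℝ → ℝ} {w₀ w₁ : ℝ} (hw : Continuous w)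
    (hlow : ∀ x, w₀ ≤ w x) (hpos : 0 < w₀) (hup : ∀ x, w x ≤ w₁) :
    ∃ B : Quad L flat →L[ℝ] Quad L flat →L[ℝ] ℝ,
      (∀ U V, B U V = ∫ x in Ioo (-L / 2) (L / 2), w x * tr U x * tr V x) ∧
      (∀ U, w₀ * ‖U.2.2.2‖ ^ 2 ≤ B U U) ∧ ∀ U, B U U ≤ w₁ * ‖U.2.2.2‖ ^ 2 := by
  let p : Quad L flat →L[ℝ] Lp ℝ 2 (volume.restrict (Ioo (-L / 2) (L / 2))) :=
    (ContinuousLinearMap.snd ℝ _ _).comp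
      ((ContinuousLinearMap.snd ℝ _ _).comp (ContinuousLinearMap.snd ℝ _ _))
  have hc : IsCoef (volume.restrict (Ioo (-L / 2) (L / 2))) w :=
    ⟨hw.aestronglyMeasurable, w₁, ae_of_all _ fun x => by
      rw [abs_of_pos (hpos.trans_le (hlow x))]; exact hup x⟩
  obtain ⟨B, hB⟩ := hc.exists_form p p
  have h1 : ∀ U V, B U V = ∫ x in Ioo (-L / 2) (L / 2), w x * tr U x * tr V x := hB
  have hint : ∀ (U : Quad L flat) (c : ℝ), Integrable (fun x => c * tr U x ^ 2)
      (volume.restrict (Ioo (-L / 2) (L / 2))) := fun U c => by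
    have := (isCoef_const (volume.restrict (Ioo (-L / 2) (L / 2))) c).integrable U.2.2.2 U.2.2.2
    refine this.congr (ae_of_all _ fun x => ?_)
    simp only [tr]; ring
  have hint' : ∀ U : Quad L flat, Integrable (fun x => w x * tr U x * tr U x)
      (volume.restrict (Ioo (-L / 2) (L / 2))) := fun U => hc.integrable U.2.2.2 U.2.2.2
  have hnorm : ∀ (U : Quad L flat) (c : ℝ), c * ‖U.2.2.2‖ ^ 2
      = ∫ x in Ioo (-L / 2) (L / 2), c * tr U x ^ 2 := fun U c => by
    rw [norm_sq_eq_integral U.2.2.2 (ae_eq_refl _), ← integral_const_mul]; rfl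
  refine ⟨B, h1, fun U => ?_, fun U => ?_⟩
  · rw [h1, hnorm]
    refine integral_mono (hint U _) (hint' U) fun x => ?_
    have := mul_le_mul_of_nonneg_right (hlow x) (sq_nonneg (tr U x))
    simp only
    linarith
  · rw [h1, hnorm]
    refine integral_mono (hint' U) (hint U _) fun x => ?_
    have := mul_le_mul_of_nonneg_right (hup x) (sq_nonneg (tr U x))
    simp only
    linarith

/-- The shear (a, b) ↦ (a + F b, b) distorts lengths boundedly: a² + b² ≤ 2(a + F b)² + (2K² + 1)b².
Comparison of the two squares with λ²(a + F b)² and k₀² b² gives the denominator. -/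
lemma ellipticity {k k₀ F K lam : ℝ} (hk₀ : 0 < k₀) (hk : k₀ ≤ k) (hF : |F| ≤ K) (hlam : 0 < lam)
    (a b : ℝ) : k₀ / (2 / lam ^ 2 + (2 * K ^ 2 + 1) / k₀ ^ 2) * (a ^ 2 + b ^ 2)
      ≤ k * (lam ^ 2 * (a + F * b) * (a + F * b) + k ^ 2 * b * b) := by
  have hF2 : F ^ 2 ≤ K ^ 2 := sq_le_sq' (abs_le.1 hF).1 (abs_le.1 hF).2
  have hC : 0 < 2 / lam ^ 2 + (2 * K ^ 2 + 1) / k₀ ^ 2 := by positivity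
  have h1 : a ^ 2 + b ^ 2 ≤ 2 * (a + F * b) ^ 2 + (2 * K ^ 2 + 1) * b ^ 2 := by
    have := mul_le_mul_of_nonneg_right hF2 (sq_nonneg b)
    nlinarith [sq_nonneg (a + 2 * (F * b))]
  have h2 : 2 * (a + F * b) ^ 2 + (2 * K ^ 2 + 1) * b ^ 2
      ≤ (2 / lam ^ 2 + (2 * K ^ 2 + 1) / k₀ ^ 2)
        * (lam ^ 2 * (a + F * b) ^ 2 + k₀ ^ 2 * b ^ 2) := by
    have e : (2 / lam ^ 2 + (2 * K ^ 2 + 1) / k₀ ^ 2)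
        * (lam ^ 2 * (a + F * b) ^ 2 + k₀ ^ 2 * b ^ 2)
        = 2 * (a + F * b) ^ 2 + (2 * K ^ 2 + 1) * b ^ 2
          + 2 / lam ^ 2 * (k₀ ^ 2 * b ^ 2)
          + (2 * K ^ 2 + 1) / k₀ ^ 2 * (lam ^ 2 * (a + F * b) ^ 2) := by
      field_simp
      ring
    rw [e]
    have p1 : 0 ≤ 2 / lam ^ 2 * (k₀ ^ 2 * b ^ 2) := by positivity
    have p2 : 0 ≤ (2 * K ^ 2 + 1) / k₀ ^ 2 * (lam ^ 2 * (a + F * b) ^ 2) := by positivity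
    linarith
  have h3 : k₀ ^ 2 * b ^ 2 ≤ k ^ 2 * b ^ 2 := by gcongr
  calc _ = k₀ * ((a ^ 2 + b ^ 2) / (2 / lam ^ 2 + (2 * K ^ 2 + 1) / k₀ ^ 2)) := by ring
    _ ≤ k₀ * (lam ^ 2 * (a + F * b) ^ 2 + k ^ 2 * b ^ 2) := by
      gcongr
      rw [div_le_iff₀ hC, mul_comm]
      refine (h1.trans h2).trans ?_
      gcongr
    _ ≤ k * (lam ^ 2 * (a + F * b) ^ 2 + k ^ 2 * b ^ 2) := by
      refine mul_le_mul_of_nonneg_right hk (by positivity)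
    _ = _ := by ring

namespace IsWave

variable (hh : IsWave ω L lam R h)
include hh

lemma exists_formQ (hL : 0 < L) (hlam : 0 < lam) :
    ∃ B : Quad L flat →L[ℝ] Quad L flat →L[ℝ] ℝ,
      (∀ U V, B U V = formQ L lam h U V) ∧ (∀ U V, B U V = B V U) ∧
      ∃ c > 0, ∀ U, c * (‖U.2.1‖ ^ 2 + ‖U.2.2.1‖ ^ 2) - ‖U.2.2.2‖ ^ 2 ≤ B U U := by
  have ck := hh.contDiffOn_kCoef.continuousOn
  have cF := hh.contDiffOn_fCoef.continuousOn
  have hk := hh.isPer_kCoef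
  have hF := hh.isPer_fCoef
  have i11 : IsCoef (volume.restrict (cell L flat)) fun z => lam ^ 2 * kCoef h z :=
    isCoef_flat hL (by fun_prop) fun q p hp => by simp only [hk q p hp]
  have i12 : IsCoef (volume.restrict (cell L flat)) fun z => lam ^ 2 * kCoef h z * fCoef h z :=
    isCoef_flat hL (by fun_prop) fun q p hp => by simp only [hk q p hp, hF q p hp]
  have i22 : IsCoef (volume.restrict (cell L flat)) fun z =>
      kCoef h z * (lam ^ 2 * fCoef h z ^ 2 + kCoef h z ^ 2) :=
    isCoef_flat hL (by fun_prop) fun q p hp => by simp only [hk q p hp, hF q p hp]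
  obtain ⟨B, hB⟩ := exists_quadForm (isCoef_const _ 0) i11 i12 i12 i22
    (isCoef_const (volume.restrict (Ioo (-L / 2) (L / 2))) (-1))
  have hform : ∀ U V, B U V = formQ L lam h U V := fun U V => by
    rw [hB, formQ, sub_eq_add_neg, ← integral_neg]
    congr 1
    · refine integral_congr_ae ?_
      filter_upwards [ae_mem_flat] with z hz
      refine Eq.trans ?_ (hh.densQ_eq hz _ _ _ _).symm
      ring
    · refine integral_congr_ae (ae_of_all _ fun x => ?_)
      simp only
      ring
  refine ⟨B, hform, fun U V => ?_, ?_⟩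
  · rw [hB, hB]
    congr 1
    · refine integral_congr_ae (ae_of_all _ fun x => ?_)
      simp only
      ring
    · refine integral_congr_ae (ae_of_all _ fun x => ?_)
      simp only
      ring
  obtain ⟨k₀, hk₀, hk₀'⟩ := hk.exists_pos_lower hL ck fun z hz => hh.kCoef_pos hz
  obtain ⟨K, hK, hK'⟩ := hF.exists_bound hL cF
  refine ⟨k₀ / (2 / lam ^ 2 + (2 * K ^ 2 + 1) / k₀ ^ 2), by positivity, fun U => ?_⟩
  set c := k₀ / (2 / lam ^ 2 + (2 * K ^ 2 + 1) / k₀ ^ 2)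
  have hsq : ∀ f : Lp ℝ 2 (volume.restrict (cell L flat)), Integrable (fun z => f z ^ 2)
      (volume.restrict (cell L flat)) := fun f => by
    refine ((isCoef_const _ 1).integrable f f).congr (ae_of_all _ fun x => ?_)
    simp only; ring
  have hdens : Integrable (fun z => densQ lam h z (d1 U z) (d2 U z) (d1 U z) (d2 U z))
      (volume.restrict (cell L flat)) := by
    refine ((((i11.integrable U.2.1 U.2.1).add (i12.integrable U.2.1 U.2.2.1)).add
      (i12.integrable U.2.2.1 U.2.1)).add (i22.integrable U.2.2.1 U.2.2.1)).congr ?_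
    filter_upwards [ae_mem_flat] with z hz
    rw [hh.densQ_eq hz]
    simp only [Pi.add_apply, d1, d2]
    ring
  have e : c * (‖U.2.1‖ ^ 2 + ‖U.2.2.1‖ ^ 2)
      = ∫ z in cell L flat, c * (d1 U z ^ 2 + d2 U z ^ 2) := by
    rw [norm_sq_eq_integral U.2.1 (ae_eq_refl _), norm_sq_eq_integral U.2.2.1 (ae_eq_refl _),
      integral_const_mul]
    congr 1
    exact (integral_add (hsq _) (hsq _)).symm
  have e3 : ‖U.2.2.2‖ ^ 2 = ∫ x in Ioo (-L / 2) (L / 2), tr U x * tr U x := by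
    rw [norm_sq_eq_integral U.2.2.2 (ae_eq_refl _)]
    simp only [sq]
    rfl
  rw [hform, e, e3, formQ]
  refine sub_le_sub_right (integral_mono_ae (((hsq U.2.1).add (hsq U.2.2.1)).const_mul c) hdens ?_) _
  filter_upwards [ae_mem_flat] with z hz
  rw [hh.densQ_eq hz]
  exact ellipticity hk₀ (hk₀' z hz) (hK' z hz) hlam _ _

/-- Continuity on the physical side lets the identity of the forms pass from C¹ functions to the
Sobolev space. -/
lemma exists_formD (hL : 0 < L) (hω : ContDiffOn ℝ 1 ω (Icc 0 1)) :
    ∃ B : Quad L (profile h) →L[ℝ] Quad L (profile h) →L[ℝ] ℝ,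
      ∀ U V, B U V = formD ω L lam h U V := by
  have hω' := hω.continuousOn_derivWithin (uniqueDiffOn_Icc zero_lt_one) le_rfl
  have cω' : ContinuousOn (fun z : ℝ × ℝ => -derivWithin ω (Icc 0 1) z.2) (closedStrip flat) :=
    (hω'.comp continuousOn_snd fun z hz => hz).neg
  have i00 : IsCoef (volume.restrict (cell L (profile h))) fun w =>
      -derivWithin ω (Icc 0 1) (stream h w) := hh.isCoef_profile hL cω' fun q p hp => rfl
  have ck := hh.contDiffOn_kCoef.continuousOn
  have cF := hh.contDiffOn_fCoef.continuousOn
  have cF2 := continuousOn_pd2 uniqueDiffOn_flat hh.contDiffOn_fCoef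
  have cY := hh.continuousOn_kY
  have cp := hh.contDiffOn_hp.continuousOn
  have ie : IsCoef (volume.restrict (Ioo (-L / 2) (L / 2))) fun x => -(rho lam h x * arc h x) := by
    have : ContinuousOn (fun z => -((1 + lam ^ 2 * (fCoef h z * (kCoef h z * pd2 flat (fCoef h) z))
      + kCoef h z * kY h z) * (pd2 flat h z * pd2 flat h z))) (closedStrip flat) := by fun_prop
    have := isCoef_top hL this fun q p hp => by
      simp only [hh.isPer_kCoef q p hp, hh.isPer_fCoef q p hp, hh.isPer_kY q p hp,
        hh.isPer_hp q p hp, hh.isPer_fCoef.pd2 hh.differentiableOn_fCoef q p hp]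
    convert this using 2 with x
    rw [hh.rho_mul_arc hL]
  obtain ⟨B, hB⟩ := exists_quadForm i00 (isCoef_const _ (lam ^ 2)) (isCoef_const _ 0)
    (isCoef_const _ 0) (isCoef_const _ 1) ie
  refine ⟨B, fun U V => ?_⟩
  rw [hB, formD, sub_eq_add_neg, ← integral_neg]
  congr 1
  · refine integral_congr_ae (ae_of_all _ fun x => ?_)
    simp only
    ring
  · refine integral_congr_ae (ae_of_all _ fun x => ?_)
    simp only
    ring

/-- The transformation `u ↦ Γ` carries `formQ` to `formD`. -/
lemma formD_toProfile (hL : 0 < L) (hlam : 0 < lam) (hω : ContDiffOn ℝ 1 ω (Icc 0 1)) :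
    ∀ U ∈ H1pe L flat, ∀ V ∈ H1pe L flat,
      formD ω L lam h (hh.toProfile hL U) (hh.toProfile hL V) = formQ L lam h U V := by
  obtain ⟨BQ, hQ, -⟩ := hh.exists_formQ hL hlam
  obtain ⟨BD, hD⟩ := hh.exists_formD hL hω
  simp only [← hQ, ← hD]
  -- Density in one argument after the other; the condition on U is closed as an intersection over
  -- all V.
  refine H1pe_flat_induction ?_ fun U u hU => H1pe_flat_induction ?_ fun V v hV => ?_
  · simp only [ofPred_forall]
    exact isClosed_iInter fun V => isClosed_iInter fun _ =>
      isClosed_eq (by fun_prop) (by fun_prop)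
  · exact isClosed_eq (by fun_prop) (by fun_prop)
  · rw [hQ, hD]
    exact hh.formD_toProfile_core hL hω hU hV

end IsWave

end forms
end
end StokesSpectral

/-! ### The five counts -/

theorem proposition2p3 (ω : ℝ → ℝ) (hω : ContDiffOn ℝ 1 ω (Set.Icc 0 1))
    (L lam R : ℝ) (hL : 0 < L) (hlam : 0 < lam)
    (h : ℝ × ℝ → ℝ) (hh : StokesSpectral.IsWave ω L lam R h) :
    ∃ n : ℕ,
      StokesSpectral.countSteklovQ L lam h = n ∧
      StokesSpectral.countRobinQ L lam h = n ∧
      StokesSpectral.countRobinD ω L lam h = n ∧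
      StokesSpectral.countSteklovD ω L lam h
        (fun x => StokesSpectral.streamY h (x, StokesSpectral.profile h x)
          / StokesSpectral.speed h x) = n ∧
      StokesSpectral.countSteklovD ω L lam h
        (fun x => 1 / (StokesSpectral.streamY h (x, StokesSpectral.profile h x)
          * StokesSpectral.speed h x)) = n := by
  open StokesSpectral in
  obtain ⟨a, haQ, hsymm, c, hc, hcoer⟩ := hh.exists_formQ hL hlam
  obtain ⟨bm, hbm, hbm'⟩ := exists_massForm L
  obtain ⟨b1, hb1, hb1l, hb1u⟩ := exists_topForm L (w := fun _ => 1) continuous_const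
    (fun _ => le_rfl) one_pos (fun _ => le_rfl)
  have hk : Continuous fun x => kCoef h (x, 1) :=
    hh.contDiffOn_kCoef.continuousOn.comp_continuous (by fun_prop) top_mem
  obtain ⟨m, hm, hm'⟩ := hh.isPer_kCoef.exists_pos_lower hL hh.contDiffOn_kCoef.continuousOn
    fun z hz => hh.kCoef_pos hz
  obtain ⟨K, hK, hK'⟩ := hh.isPer_kCoef.exists_bound hL hh.contDiffOn_kCoef.continuousOn
  -- The image of the weight ψ_y/|∇ψ|: with the arc length density it becomes 1, and the two traces
  -- contribute k².
  obtain ⟨b2, hb2, hb2l, hb2u⟩ := exists_topForm L (w := fun x => kCoef h (x, 1) * kCoef h (x, 1))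
    (hk.mul hk) (w₀ := m * m) (w₁ := K * K)
    (fun x => mul_le_mul (hm' _ (top_mem x)) (hm' _ (top_mem x)) hm.le (hh.kCoef_pos (top_mem x)).le)
    (by positivity)
    (fun x => mul_le_mul ((le_abs_self _).trans (hK' _ (top_mem x)))
      ((le_abs_self _).trans (hK' _ (top_mem x))) (hh.kCoef_pos (top_mem x)).le hK.le)
  have hmS : ∀ U V, bm U V = bm V U := fun U V => by
    simp only [hbm, massQ, mul_comm]
  have h1S : ∀ U V, b1 U V = b1 V U := fun U V => by
    rw [hb1, hb1]; simp only [mul_right_comm]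
  have h2S : ∀ U V, b2 U V = b2 V U := fun U V => by
    rw [hb2, hb2]; simp only [mul_right_comm _ (tr U _) (tr V _)]
  have pm := isSpectralPair_mass hL hsymm hmS hc hcoer hbm'
  have p1 := isSpectralPair_top hL hsymm h1S hc hcoer one_pos one_pos hb1l hb1u
  have p2 := isSpectralPair_top hL hsymm h2S hc hcoer (by positivity) (by positivity) hb2l hb2u
  -- The Morse index involves a only, so the n found with the L² product serves the two surface
  -- products as well.
  obtain ⟨n, hn⟩ := pm.exists_morseIndex
  have key : ∀ {b : Quad L flat →L[ℝ] Quad L flat →L[ℝ] ℝ}, IsSpectralPair (onH1 a) (onH1 b) →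
      negativeCount (H1pe L flat) (formQ L lam h) (fun U V => b U V) = n := fun {b} hp => by
    have e : formQ L lam h = fun U V => a U V := by
      ext U V; exact (haQ U V).symm
    rw [e, negativeCount_subtype]
    exact hp.negativeCount_eq hn
  have em : massQ L = fun U V => bm U V := by ext U V; exact (hbm U V).symm
  have e1 : topQ L = fun U V => b1 U V := by
    ext U V; rw [hb1]; simp only [topQ, one_mul]
  refine ⟨n, ?_, ?_, ?_, ?_, ?_⟩
  · rw [countSteklovQ, e1]; exact key p1
  · rw [countRobinQ, em]; exact key pm
  · rw [countRobinD, negativeCount_congr (hh.quadEquiv hL) (hh.map_quadEquiv hL)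
      (hh.formD_toProfile hL hlam hω) (fun U _ V _ => hh.massD_toProfile hL U V), em]
    exact key pm
  · rw [countSteklovD, negativeCount_congr (hh.quadEquiv hL) (hh.map_quadEquiv hL)
      (hh.formD_toProfile hL hlam hω) (b₁ := fun U V => b2 U V) (fun U _ V _ => ?_)]
    · exact key p2
    · rw [hb2]
      refine (hh.topD_toProfile hL _ U V).trans ?_
      simp only [(hh.weight_arc hL _).1, one_mul]
  · rw [countSteklovD, negativeCount_congr (hh.quadEquiv hL) (hh.map_quadEquiv hL)
      (hh.formD_toProfile hL hlam hω) (b₁ := fun U V => b1 U V) (fun U _ V _ => ?_)]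
    · exact key p1
    · rw [hb1]
      refine (hh.topD_toProfile hL _ U V).trans ?_
      refine MeasureTheory.integral_congr_ae (Filter.Eventually.of_forall fun x => ?_)
      simp only [(hh.weight_arc hL _).2]
      -- The factorisation k² h_p² - 1 = (k h_p + 1)(k h_p - 1).
      linear_combination (tr U x * tr V x) * (kCoef h (x, 1) * pd2 flat h (x, 1) + 1)
        * hh.kCoef_mul_hp (top_mem x)
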